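/- Let $K$ be a commutative $\mathbb{Q}$-algebra (for instance $K=\mathbb{C}$), let $R=K[[t_1,t_2,\ldots]]$, $\partial_n=\partial/\partial t_n$, $\partial=\partial_1$, $\xi(t,z)=\sum_{i\ge 1}t_iz^i$. Let $\epsilon_k\in K^\times$ ($k\in\mathbb{Z}$), $\epsilon=\sum_k\epsilon_kE_{kk}$, $\Lambda=\epsilon\big(\sum_{k\in\mathbb{Z}}E_{k,k+1}\big)\epsilon^{-1}$, and let $L=\Lambda+\sum_{i\ge 0}a_i\Lambda^{-i}$ with arbitrary infinite diagonal matrices $a_i=\sum_{k\in\mathbb Z}a_i(k,t)E_{kk}$, $a_i(k,t)\in R$. The 1-Toda lattice hierarchy for $L$ is the system $\partial_nL=[(L^n)_+,L]$, $n\ge1$, where $A_+$ is the upper triangular part of $A$, including the diagonal. A dressing matrix of $L$ is a matrix $P=I+\sum_{k\ge1}p_k\Lambda^{-k}$ ($p_k$ diagonal with entries in $R$) with $L=P\Lambda P^{-1}$. With $\chi(z)=(z^n)_{n\in\mathbb{Z}}$ it defines the vectors of formal products \[ \Psi(t,z)=Pe^{\sum_{k\ge1} t_k\Lambda^k}\epsilon\chi(z)=\big(P\epsilon\chi(z)\big)e^{\xi(t,z)}=(\epsilon_n\psi_n(t,z))_{n},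 \] \[ \Psi^*(t,z)=(P^T)^{-1}e^{-\sum_{k\ge1} t_k(\Lambda^T)^k}\epsilon^{-1}\chi(z^{-1})=\big((P^T)^{-1}\epsilon^{-1}\chi(z^{-1})\big)e^{-\xi(t,z)}=(\epsilon_n^{-1}z\psi^*_{n+1}(t,z))_{n}. \] Consider the condition (b) For every $n\in\mathbb{Z}$, $\psi_n$ is a wavefunction of type $z^n$ of the KP hierarchy, i.e. $\psi_n=(z^n+\sum_{j<n}\alpha_jz^j)e^{\xi}$ with $\alpha_j\in R$, and there is a pseudodifferential operator $\mathcal L=\partial+\sum_{j<0}\ell_j\partial^j$, $\ell_j\in R$, with $\mathcal L\psi_n=z\psi_n$ and $\partial_k\psi_n=(\mathcal L^k)_+\psi_n$ for all $k\ge1$; moreover $\psi_n^*$ is its adjoint wavefunction, i.e. if $\psi_n=\mathcal P(t,\partial)e^{\xi}$ then $\psi_n^*=(\mathcal P^*)^{-1}e^{-\xi}$. In addition the modified KP relations \[ \langle\psi_n(t,z)\,|\,\overline{z\psi_m^*(s,z)}\rangle=\mathrm{Res}_{z=0}\,\psi_n(t,z)\psi_m^*(s,z)=0\quad\text{in }K[[t,s]]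 \] hold for all $n\ge m$ (here $e^{\pm\xi}$ is expanded in powers of $z$, and $\mathrm{Res}_{z=0}$ is the coefficient of $z^{-1}$). Then: (1) $L$ satisfies the 1-Toda lattice hierarchy if and only if it has a dressing matrix $P$ for which (b) holds. (2) For every dressing matrix $P$ of $L$, condition (b) holds if and only if $\Psi,\Psi^*$ are a wavevector and an adjoint wavevector of the 1-Toda lattice hierarchy for $L$, i.e. $L\Psi=z\Psi$, $L^T\Psi^*=z\Psi^*$, $\partial_n\Psi=(L^n)_+\Psi$ and $\partial_n\Psi^*=-((L^n)_+)^T\Psi^*$ for all $n\ge1$. -/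

import Mathlib

noncomputable section

namespace OneToda

section Ring

variable {K : Type*} [CommRing K]

/-- The ring of functions of the times `t = (t₁, t₂, …)`: formal power series `K[[t₁, t₂, …]]`. -/
abbrev TimeSeries (K : Type*) [CommRing K] := MvPowerSeries ℕ+ K

/-- The partial derivative `∂ₙ = ∂/∂tₙ`. -/
def dt (n : ℕ+) (f : TimeSeries K) : TimeSeries K := MvPowerSeries.pderiv K n f

/-! ### Pseudodifferential operators

An operator `∑_{i ≤ N} aᵢ ∂ⁱ`, with `∂ = ∂₁`, is given by its coefficients `i ↦ aᵢ`. Every operator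
below has order bounded above, and then every sum over infinitely many indices written here has
only finitely many nonzero terms. -/

/-- Product of pseudodifferential operators,
`(a ∂ⁱ) ∘ (b ∂ʲ) = ∑_{k ≥ 0} binom(i, k) a ∂ᵏ(b) ∂^{i + j - k}`; the index `x` is `(i, k)`. -/
def psMul (A B : ℤ → TimeSeries K) : ℤ → TimeSeries K := fun l =>
  ∑ᶠ x : ℤ × ℕ, Ring.choose x.1 x.2 • (A x.1 * ((dt 1)^[x.2]) (B (l + x.2 - x.1)))

/-- The identity operator. -/
def psOne : ℤ → TimeSeries K := fun l => if l = 0 then 1 else 0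

/-- Powers of a pseudodifferential operator. -/
def psPow (A : ℤ → TimeSeries K) : ℕ → (ℤ → TimeSeries K)
  | 0 => psOne
  | n + 1 => psMul A (psPow A n)

/-- The differential operator part `A₊`. -/
def psPlus (A : ℤ → TimeSeries K) : ℤ → TimeSeries K := fun l => if 0 ≤ l then A l else 0

/-- The formal adjoint `(∑ pᵢ ∂ⁱ)^* = ∑ (-∂)ⁱ pᵢ`. -/
def psAdjoint (A : ℤ → TimeSeries K) : ℤ → TimeSeries K := fun l =>
  ∑ᶠ k : ℕ, (Int.negOnePow (l + k) : ℤ) •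
    (Ring.choose (l + k) k • ((dt 1)^[k]) (A (l + k)))

/-- A Lax operator `∂ + ∑_{j < 0} ℓⱼ ∂ʲ`. -/
def IsLaxOperator (L : ℤ → TimeSeries K) : Prop :=
  L 1 = 1 ∧ L 0 = 0 ∧ ∀ j : ℤ, 1 < j → L j = 0

/-! ### Oscillating functions

Write `ξ(t, z) = ∑_{i ≥ 1} tᵢ zⁱ`. An oscillating function is a formal product
`(∑_{j ≤ N} aⱼ(t) zʲ) e^{ξ(t, z)}`, a dual oscillating function is a formal product
`(∑_{j ≤ N} aⱼ(t) zʲ) e^{-ξ(t, z)}`. Both are given by the coefficients `j ↦ aⱼ`. -/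

/-- The coefficients `a` are those of `z^ℓ + ∑_{j < ℓ} aⱼ zʲ`: (dual) oscillating functions of
type `z^ℓ`. -/
def IsOscOfType (l : ℤ) (a : ℤ → TimeSeries K) : Prop :=
  a l = 1 ∧ ∀ j : ℤ, l < j → a j = 0

/-- The action of pseudodifferential operators on oscillating functions. As
`(∑ pⱼ ∂ʲ) e^ξ = (∑ pⱼ zʲ) e^ξ`, the coefficients of `A (P e^ξ)` are those of `A P`. -/
def oscAct (A φ : ℤ → TimeSeries K) : ℤ → TimeSeries K := psMul A φ

/-- Multiplication of a (dual) oscillating function by `z`. -/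
def zMul (a : ℤ → TimeSeries K) : ℤ → TimeSeries K := fun j => a (j - 1)

/-- `∂ₙ` on oscillating functions: `∂ₙ ((∑ aⱼ zʲ) e^ξ) = (∑ ∂ₙ(aⱼ) zʲ + ∑ aⱼ z^{j + n}) e^ξ`. -/
def oscDeriv (n : ℕ+) (a : ℤ → TimeSeries K) : ℤ → TimeSeries K := fun j =>
  dt n (a j) + a (j - (n : ℕ))

/-- `∂ₙ` on dual oscillating functions:
`∂ₙ ((∑ aⱼ zʲ) e^{-ξ}) = (∑ ∂ₙ(aⱼ) zʲ - ∑ aⱼ z^{j + n}) e^{-ξ}`. -/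
def dualDeriv (n : ℕ+) (a : ℤ → TimeSeries K) : ℤ → TimeSeries K := fun j =>
  dt n (a j) - a (j - (n : ℕ))

/-- `φ` is a wavefunction of type `z^ℓ` of the KP hierarchy: it is an oscillating function of that
type and for some Lax operator `L` one has `L φ = z φ` and `∂ₙ φ = (Lⁿ)₊ φ` for all `n ≥ 1`. -/
def IsKPWavefunction (l : ℤ) (φ : ℤ → TimeSeries K) : Prop :=
  IsOscOfType l φ ∧ ∃ L : ℤ → TimeSeries K, IsLaxOperator L ∧
    oscAct L φ = zMul φ ∧ ∀ n : ℕ+, oscDeriv n φ = oscAct (psPlus (psPow L n)) φ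

/-- The operator `Q` with `ψ = Q(t, ∂) e^{-ξ}`: by `(∑ qⱼ (-∂)ʲ) e^{-ξ} = (∑ qⱼ zʲ) e^{-ξ}`, the
coefficient of `∂ʲ` in `Q` is `(-1)ʲ` times that of `zʲ` in `ψ`. -/
def dualOperator (ψ : ℤ → TimeSeries K) : ℤ → TimeSeries K := fun j =>
  (Int.negOnePow j : ℤ) • ψ j

/-- The dual oscillating function `ψ` of type `z^{-ℓ}` is the adjoint of the oscillating function
`φ = P(t, ∂) e^ξ` of type `z^ℓ`, that is, `ψ = (P^*)⁻¹ e^{-ξ}`. -/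
def IsAdjointOf (l : ℤ) (φ ψ : ℤ → TimeSeries K) : Prop :=
  IsOscOfType l φ ∧ IsOscOfType (-l) ψ ∧
    psMul (dualOperator ψ) (psAdjoint φ) = psOne ∧
    psMul (psAdjoint φ) (dualOperator ψ) = psOne

/-! ### Infinite matrices

All matrices multiplied below vanish above some diagonal, so that the entries of a product are
finite sums. -/

/-- Product of infinite matrices. -/
def matMul (A B : Matrix ℤ ℤ (TimeSeries K)) : Matrix ℤ ℤ (TimeSeries K) := fun i j =>
  ∑ᶠ k : ℤ, A i k * B k j

/-- Powers of an infinite matrix. -/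
def matPow (A : Matrix ℤ ℤ (TimeSeries K)) : ℕ → Matrix ℤ ℤ (TimeSeries K)
  | 0 => 1
  | n + 1 => matMul A (matPow A n)

/-- The upper triangular part `A₊`, including the diagonal. -/
def matPlus (A : Matrix ℤ ℤ (TimeSeries K)) : Matrix ℤ ℤ (TimeSeries K) := fun i j =>
  if i ≤ j then A i j else 0

/-- The power `Λ^m`, `m ∈ ℤ`, of `Λ = ε (∑ₖ E_{k,k+1}) ε⁻¹`: its only nonzero entries are
`(Λ^m)_{k,k+m} = εₖ / ε_{k+m}`. -/
def shiftPow (ε : ℤ → Kˣ) (m : ℤ) : Matrix ℤ ℤ (TimeSeries K) := fun k l =>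
  if l = k + m then MvPowerSeries.C ((ε k * (ε l)⁻¹ : Kˣ) : K) else 0

/-- The matrix `L = Λ + ∑_{i ≥ 0} aᵢ Λ^{-i}` with `aᵢ = ∑ₖ aᵢ(k, t) E_{kk}`. -/
def laxMatrix (ε : ℤ → Kˣ) (a : ℕ → ℤ → TimeSeries K) : Matrix ℤ ℤ (TimeSeries K) := fun k l =>
  shiftPow ε 1 k l + ∑ᶠ i : ℕ, a i k * shiftPow ε (-(i : ℤ)) k l

/-- The matrix `P(t, Λ) = I + ∑_{i ≥ 1} pᵢ Λ^{-i}` with `pᵢ = ∑ₖ pᵢ(k, t) E_{kk}`. -/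
def waveMatrix (ε : ℤ → Kˣ) (p : ℕ+ → ℤ → TimeSeries K) : Matrix ℤ ℤ (TimeSeries K) := fun k l =>
  (1 : Matrix ℤ ℤ (TimeSeries K)) k l +
    ∑ᶠ i : ℕ+, p i k * shiftPow ε (-((i : ℕ) : ℤ)) k l

/-- The 1-Toda lattice hierarchy `∂ₙ L = [(Lⁿ)₊, L]`, `n ≥ 1`. -/
def SatisfiesToda (L : Matrix ℤ ℤ (TimeSeries K)) : Prop :=
  ∀ n : ℕ+, L.map (dt n) = matMul (matPlus (matPow L n)) L - matMul L (matPlus (matPow L n))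

/-- `L = P Λ P⁻¹`, where `Q = P⁻¹` (as matrices of the form `I + ∑_{i ≥ 1} qᵢ Λ^{-i}`). -/
def IsDressing (ε : ℤ → Kˣ) (L : Matrix ℤ ℤ (TimeSeries K)) (p q : ℕ+ → ℤ → TimeSeries K) : Prop :=
  matMul (waveMatrix ε p) (waveMatrix ε q) = 1 ∧ matMul (waveMatrix ε q) (waveMatrix ε p) = 1 ∧
    L = matMul (matMul (waveMatrix ε p) (shiftPow ε 1)) (waveMatrix ε q)

/-- The product of an infinite matrix with a column vector of (dual) oscillating functions
`v k = (∑ⱼ v k j zʲ) e^{±ξ}`. -/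
def matVec (A : Matrix ℤ ℤ (TimeSeries K)) (v : ℤ → ℤ → TimeSeries K) : ℤ → ℤ → TimeSeries K :=
  fun n j => ∑ᶠ k : ℤ, A n k * v k j

/-- The wavevector `Ψ = P(t, Λ) e^{∑ tₖ Λᵏ} ε χ(z)`, with `χ(z) = (zⁿ)ₙ`. As `Λ ε χ(z) = z ε χ(z)`,
this is the formal product `(P(t, Λ) ε χ(z)) e^{ξ(t, z)}`. -/
def waveVector (ε : ℤ → Kˣ) (p : ℕ+ → ℤ → TimeSeries K) : ℤ → ℤ → TimeSeries K :=
  matVec (waveMatrix ε p) fun k j =>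
    if j = k then MvPowerSeries.C ((ε k : Kˣ) : K) else 0

/-- The adjoint wavevector `Ψ^* = (P(t, Λ)ᵀ)⁻¹ e^{-∑ tₖ (Λᵀ)ᵏ} ε⁻¹ χ(z⁻¹)`, where `Q = P⁻¹`. As
`Λᵀ ε⁻¹ χ(z⁻¹) = z ε⁻¹ χ(z⁻¹)`, this is the formal product `(Qᵀ ε⁻¹ χ(z⁻¹)) e^{-ξ(t, z)}`. -/
def adjointWaveVector (ε : ℤ → Kˣ) (q : ℕ+ → ℤ → TimeSeries K) : ℤ → ℤ → TimeSeries K :=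
  matVec (waveMatrix ε q).transpose fun k j =>
    if j = -k then MvPowerSeries.C (((ε k)⁻¹ : Kˣ) : K) else 0

/-- The linear system of the wavevector and adjoint wavevector of the 1-Toda lattice hierarchy:
`L Ψ = z Ψ`, `Lᵀ Ψ^* = z Ψ^*`, `∂ₙ Ψ = (Lⁿ)₊ Ψ`, `∂ₙ Ψ^* = -((Lⁿ)₊)ᵀ Ψ^*` for all `n ≥ 1`. -/
def SatisfiesLinearSystem (L : Matrix ℤ ℤ (TimeSeries K)) (Ψ Ψs : ℤ → ℤ → TimeSeries K) : Prop :=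
  (matVec L Ψ = fun k => zMul (Ψ k)) ∧
  (matVec L.transpose Ψs = fun k => zMul (Ψs k)) ∧
  ∀ n : ℕ+, ((fun k => oscDeriv n (Ψ k)) = matVec (matPlus (matPow L n)) Ψ) ∧
    ((fun k => dualDeriv n (Ψs k)) = -matVec (matPlus (matPow L n)).transpose Ψs)

/-- The component `ψₙ`, defined by `Ψ = (εₙ ψₙ)ₙ`. -/
def psi (ε : ℤ → Kˣ) (p : ℕ+ → ℤ → TimeSeries K) (n : ℤ) : ℤ → TimeSeries K := fun j =>
  MvPowerSeries.C (((ε n)⁻¹ : Kˣ) : K) * waveVector ε p n j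

/-- The component `ψₙ^*`, defined by `Ψ^* = (εₙ⁻¹ z ψ_{n+1}^*)ₙ`. -/
def psiStar (ε : ℤ → Kˣ) (q : ℕ+ → ℤ → TimeSeries K) (n : ℤ) : ℤ → TimeSeries K := fun j =>
  MvPowerSeries.C ((ε (n - 1) : Kˣ) : K) * adjointWaveVector ε q (n - 1) (j + 1)

end Ring

section Pairing

variable {K : Type*} [CommRing K] [Algebra ℚ K]

/-- The coefficient of `zᵏ` in `e^{σ ξ(t, z)} = ∏ᵢ exp (σ tᵢ zⁱ)`: the sum of all
`∏ᵢ (σ tᵢ)^{dᵢ} / dᵢ!` with `∑ᵢ i dᵢ = k`. -/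
def expCoeff (K : Type*) [CommRing K] [Algebra ℚ K] (σ : ℤˣ) (k : ℕ) : TimeSeries K :=
  fun d : ℕ+ →₀ ℕ =>
    if (d.sum fun i m => (i : ℕ) * m) = k then
      algebraMap ℚ K (d.prod fun _ m => (((σ : ℤ) : ℚ) ^ m / (Nat.factorial m : ℚ)))
    else 0

/-- The coefficient of `z^ℓ` of the formal product `(∑ⱼ aⱼ(t) zʲ) e^{σ ξ(t, z)}`, that is, the power
series `∑_{k ≥ 0} a_{ℓ - k}(t) ⬝ expCoeff σ k`; each of its coefficients is a finite sum, since all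
monomials in the `k`-th term have weight at least `k` when `tᵢ` is given the weight `i`. -/
def expand (σ : ℤˣ) (a : ℤ → TimeSeries K) (l : ℤ) : TimeSeries K :=
  fun d : ℕ+ →₀ ℕ => ∑ᶠ k : ℕ, MvPowerSeries.coeff d (a (l - k) * expCoeff K σ k)

/-- The pairing `⟨φ(t, z) | \overline{z ψ(s, z)}⟩ = Res_{z = 0} φ(t, z) ψ(s, z)` of an oscillating
function `φ` and a dual oscillating function `ψ`, a power series in the two independent sets of
variables `t` (on the left of the sum type) and `s` (on the right). With `φ = ∑_ℓ φ_ℓ(t) z^ℓ` and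
`ψ = ∑_ℓ ψ_ℓ(s) z^ℓ` it is `∑_ℓ φ_ℓ(t) ψ_{-1-ℓ}(s)`; each of its coefficients is a finite sum. -/
def pairing (φ ψ : ℤ → TimeSeries K) : MvPowerSeries (ℕ+ ⊕ ℕ+) K :=
  fun d : (ℕ+ ⊕ ℕ+) →₀ ℕ => ∑ᶠ l : ℤ,
    MvPowerSeries.coeff (Finsupp.sumFinsuppEquivProdFinsupp d).1 (expand 1 φ l) *
    MvPowerSeries.coeff (Finsupp.sumFinsuppEquivProdFinsupp d).2 (expand (-1) ψ (-1 - l))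

/-- Every `ψₙ` is a KP wavefunction (of type `zⁿ`) with adjoint wavefunction `ψₙ^*`, and the
modified KP relations `⟨ψₙ(t, z) | \overline{z ψₘ^*(s, z)}⟩ = 0` hold for all `n ≥ m`. -/
def SatisfiesModifiedKP (ψ ψs : ℤ → ℤ → TimeSeries K) : Prop :=
  (∀ n : ℤ, IsKPWavefunction n (ψ n) ∧ IsAdjointOf n (ψ n) (ψs n)) ∧
    ∀ n m : ℤ, m ≤ n → pairing (ψ n) (ψs m) = 0

end Pairing

end OneToda

end

/-! Conjugation by `ε` turns Λ into the shift matrix S and P into a lower unitriangular matrix `w`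
with inverse `v`. The rows of `w` hold the coefficients of the ψₙ, the columns of `v` those of the
ψₘ^*. Everything is compared with the Sato equations `Evolves`: ∂ₖw + wSᵏ = (Lᵏ)₊w.

Linear system: given a dressing, the eigenvalue equations are automatic, the equation for Ψ is
`Evolves`, and the one for Ψ^* follows by differentiating vw = 1 (`satisfiesLinearSystem_iff`).

Toda: differentiating L = wSv gives the Lax equations (`IsDressed.toda`). Conversely, the Lax
equations make the system ∂ₙw = -(Lⁿ)₋w flat. It is solved with the initial value of a matrix
intertwining L and S; then Lw - wS solves the same linear system with initial value zero, so it
vanishes (`exists_isDressed_of_toda`).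

Bilinear relations: at s = t the exponentials cancel, and the residue of ψₙψₘ^* is the entry (n, m -
1) of wv = 1, zero for n ≥ m. As (Lᵏ)₊ is upper triangular, derivatives in t only bring in ψ_l with
l ≥ n, and derivatives in s only ψ_l^* with l ≤ m, so all Taylor coefficients vanish
(`IsDressed.pairing_eq_zero`). Conversely, one t-derivative restricted to s = t says that (∂ₖw +
wSᵏ)v is upper triangular. It differs from Lᵏ by a strictly lower triangular matrix, so it is (Lᵏ)₊
(`IsDressed.evolves_of_pairing`).

KP: write ψₙ = Pₙe^ξ and ψₘ^* = Qₘe^{-ξ}. The residue of PₙQₘ^* is the same residue at s = t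
(`PDO.residue_mul_adj`), so it vanishes for n ≥ m. Since ∂Pₙ = Pₙ₊₁ + LₙₙPₙ, every negative
coefficient of PₙQₘ^* then vanishes. For n = m this forces PₙQₙ^* = 1, and Pₙ∂Pₙ⁻¹ is the required
Lax operator (`IsDressed.isKPWavefunction`). -/

noncomputable section

namespace OneToda

/-! ### Derivations of the ring of time series -/

section Series

variable {K : Type*} [CommRing K]

lemma dt_eq (n : ℕ+) (f : TimeSeries K) : dt n f = MvPowerSeries.pderiv K n f := rfl

/-- `∂ₙ` as an additive homomorphism. -/
def dtHom (n : ℕ+) : TimeSeries K →+ TimeSeries K where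
  toFun := dt n
  map_zero' := map_zero (MvPowerSeries.pderiv K n)
  map_add' := map_add (MvPowerSeries.pderiv K n)

@[simp] lemma dt_zero (n : ℕ+) : dt n (0 : TimeSeries K) = 0 := map_zero (dtHom n)

@[simp] lemma dt_one (n : ℕ+) : dt n (1 : TimeSeries K) = 0 := MvPowerSeries.pderiv_one

@[simp] lemma dt_C (n : ℕ+) (r : K) : dt n (MvPowerSeries.C r) = 0 := MvPowerSeries.pderiv_C

lemma dt_add (n : ℕ+) (f g : TimeSeries K) : dt n (f + g) = dt n f + dt n g := map_add (dtHom n) f g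

lemma dt_neg (n : ℕ+) (f : TimeSeries K) : dt n (-f) = -dt n f := map_neg (dtHom n) f

lemma dt_sub (n : ℕ+) (f g : TimeSeries K) : dt n (f - g) = dt n f - dt n g := map_sub (dtHom n) f g

lemma dt_zsmul (n : ℕ+) (r : ℤ) (f : TimeSeries K) : dt n (r • f) = r • dt n f :=
  map_zsmul (dtHom n) r f

lemma dt_sum {ι : Type*} (n : ℕ+) (s : Finset ι) (f : ι → TimeSeries K) :
    dt n (∑ i ∈ s, f i) = ∑ i ∈ s, dt n (f i) := map_sum (dtHom n) f s

lemma dt_mul (n : ℕ+) (f g : TimeSeries K) : dt n (f * g) = dt n f * g + f * dt n g := by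
  simp only [dt_eq, Derivation.leibniz, smul_eq_mul]
  ring

lemma coeff_dt (n : ℕ+) (f : TimeSeries K) (d : ℕ+ →₀ ℕ) :
    MvPowerSeries.coeff d (dt n f) = MvPowerSeries.coeff (d + Finsupp.single n 1) f * (d n + 1) :=
  MvPowerSeries.coeff_pderiv f d

lemma dt_iter_zero (n : ℕ+) (k : ℕ) : (dt n)^[k] (0 : TimeSeries K) = 0 :=
  iterate_map_zero (dtHom n) k

lemma dt_iter_add (n : ℕ+) (k : ℕ) (f g : TimeSeries K) :
    (dt n)^[k] (f + g) = (dt n)^[k] f + (dt n)^[k] g := iterate_map_add (dtHom n) k f g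

lemma dt_iter_zsmul (n : ℕ+) (k : ℕ) (r : ℤ) (f : TimeSeries K) :
    (dt n)^[k] (r • f) = r • (dt n)^[k] f := by
  induction k with
  | zero => rfl
  | succ k ih => simp only [Function.iterate_succ_apply', ih, dt_zsmul]

lemma dt_iter_sum {ι : Type*} (n : ℕ+) (k : ℕ) (s : Finset ι) (f : ι → TimeSeries K) :
    (dt n)^[k] (∑ i ∈ s, f i) = ∑ i ∈ s, (dt n)^[k] (f i) := by
  induction k with
  | zero => rfl
  | succ k ih => simp only [Function.iterate_succ_apply', ih, dt_sum]

lemma dt_iter_mul (n : ℕ+) (k : ℕ) (f g : TimeSeries K) :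
    (dt n)^[k] (f * g) = ∑ x ∈ Finset.HasAntidiagonal.antidiagonal k,
      ((k.choose x.1 : ℕ) : ℤ) • ((dt n)^[x.1] f * (dt n)^[x.2] g) := by
  simp only [natCast_zsmul]
  induction k with
  | zero => simp
  | succ k ih =>
    rw [Finset.sum_antidiagonal_choose_succ_nsmul
      (fun i j => (dt n)^[i] f * (dt n)^[j] g), Function.iterate_succ_apply', ih, dt_sum,
      ← Finset.sum_add_distrib]
    refine Finset.sum_congr rfl fun x hx => ?_
    rw [← natCast_zsmul, dt_zsmul, dt_mul, natCast_zsmul, smul_add, add_comm,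
      Function.iterate_succ_apply', Function.iterate_succ_apply', ]
    congr 2
    rw [← Finset.HasAntidiagonal.mem_antidiagonal.mp hx]
    exact Nat.choose_symm_add

end Series

/-! ### Uniqueness and primitives for power series over a ℚ-algebra -/

section Rational

variable {K : Type*} [CommRing K] [Algebra ℚ K] {σ : Type*}

lemma isUnit_natCast_succ (n : ℕ) : IsUnit ((n : K) + 1) := by
  have h : (algebraMap ℚ K) ((n : ℚ) + 1) = (n : K) + 1 := by simp
  rw [← h]
  exact (IsUnit.mk0 ((n : ℚ) + 1) (by positivity)).map _

/-- A family of power series vanishes if its constant coefficients do and every coefficient of a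
derivative depends homogeneously on the coefficients of the family at smaller exponents. -/
theorem eq_zero_of_coeff_pderiv {ι : Type*} (F : ι → MvPowerSeries σ K)
    (h0 : ∀ i, MvPowerSeries.coeff 0 (F i) = 0)
    (h : ∀ i s d, (∀ j, ∀ e ≤ d, MvPowerSeries.coeff e (F j) = 0) →
      MvPowerSeries.coeff d (MvPowerSeries.pderiv K s (F i)) = 0) (i : ι) : F i = 0 := by
  have key : ∀ N : ℕ, ∀ i d, Finsupp.degree d = N → MvPowerSeries.coeff d (F i) = 0 := by
    intro N
    induction N using Nat.strong_induction_on with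
    | _ N ih =>
      intro i d hd
      by_cases hd0 : d = 0
      · rw [hd0]; exact h0 i
      obtain ⟨s, hs⟩ := Finsupp.support_nonempty_iff.mpr hd0
      obtain ⟨e, rfl⟩ : ∃ e, d = e + Finsupp.single s 1 :=
        ⟨d - Finsupp.single s 1, (tsub_add_cancel_of_le (by
          rw [Finsupp.single_le_iff]
          exact Nat.one_le_iff_ne_zero.mpr (Finsupp.mem_support_iff.mp hs))).symm⟩
      have h1 := h i s e fun j e' he' => ih (Finsupp.degree e') (by
        have := Finsupp.degree_mono he'
        rw [map_add, Finsupp.degree_single] at hd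
        omega) j e' rfl
      -- The coefficient of the derivative at `e` is the one sought times `e s + 1`, a unit because
      -- K contains ℚ.
      rw [MvPowerSeries.coeff_pderiv] at h1
      exact (isUnit_natCast_succ (e s)).mul_left_eq_zero.mp h1
  ext d
  exact key _ i d rfl

/-- A primitive of a closed family `f` with vanishing constant coefficient. -/
def primitive (f : σ → MvPowerSeries σ K) : MvPowerSeries σ K := fun d =>
  algebraMap ℚ K (((Finsupp.degree d : ℕ) : ℚ)⁻¹) *
    ∑ s ∈ d.support, MvPowerSeries.coeff (d - Finsupp.single s 1) (f s)

lemma coeff_zero_primitive (f : σ → MvPowerSeries σ K) :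
    MvPowerSeries.coeff 0 (primitive f) = 0 := by
  change primitive f 0 = 0
  simp [primitive]

/-- Euler's identity ∑ tₛ∂ₛF = ∑ tₛfₛ dictates the formula for `primitive`. Closedness turns each
summand, multiplied by `d s + 1`, into `e s'` times the coefficient of `f s` at `d`; the `e s'` add
up to the degree of `e`, which the prefactor cancels. -/
theorem pderiv_primitive (f : σ → MvPowerSeries σ K)
    (hf : ∀ s s', MvPowerSeries.pderiv K s (f s') = MvPowerSeries.pderiv K s' (f s)) (s : σ) :
    MvPowerSeries.pderiv K s (primitive f) = f s := by
  classical
  ext d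
  rw [MvPowerSeries.coeff_pderiv]
  set e := d + Finsupp.single s 1 with he
  change (algebraMap ℚ K (((Finsupp.degree e : ℕ) : ℚ)⁻¹) *
    ∑ s' ∈ e.support, MvPowerSeries.coeff (e - Finsupp.single s' 1) (f s')) * _ = _
  have hterm : ∀ s' ∈ e.support, MvPowerSeries.coeff (e - Finsupp.single s' 1) (f s') *
      ((d s : K) + 1) = (e s' : K) * MvPowerSeries.coeff d (f s) := by
    intro s' hs'
    rcases eq_or_ne s' s with rfl | hne
    · simp [he, mul_comm]
    · have hpos : 1 ≤ d s' := by
        have := Finsupp.mem_support_iff.mp hs'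
        rw [he, Finsupp.add_apply, Finsupp.single_eq_of_ne hne, add_zero] at this
        omega
      obtain ⟨c, rfl⟩ : ∃ c, d = c + Finsupp.single s' 1 :=
        ⟨d - Finsupp.single s' 1, (tsub_add_cancel_of_le (by
          rwa [Finsupp.single_le_iff])).symm⟩
      have h := congrArg (MvPowerSeries.coeff c) (hf s s')
      rw [MvPowerSeries.coeff_pderiv, MvPowerSeries.coeff_pderiv] at h
      have e1 : e - Finsupp.single s' 1 = c + Finsupp.single s 1 := by
        rw [he, add_right_comm, add_tsub_cancel_right]
      have e2 : e s' = c s' + 1 := by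
        rw [he]; simp [Finsupp.single_eq_of_ne hne]
      have e3 : (c + Finsupp.single s' 1 : σ →₀ ℕ) s = c s := by
        simp [Finsupp.single_eq_of_ne hne.symm]
      rw [e1, e2, e3, h]
      push_cast
      ring
  rw [mul_assoc, Finset.sum_mul, Finset.sum_congr rfl hterm, ← Finset.sum_mul, ← mul_assoc]
  have hdeg : (∑ s' ∈ e.support, (e s' : K)) = algebraMap ℚ K ((Finsupp.degree e : ℕ) : ℚ) := by
    rw [Finsupp.degree_apply]
    simp
  have hne : ((Finsupp.degree e : ℕ) : ℚ) ≠ 0 := by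
    rw [he, map_add, Finsupp.degree_single]
    positivity
  rw [hdeg, ← map_mul, inv_mul_cancel₀ hne, map_one, one_mul]

end Rational

/-! ### Expansion of formal products with e^{±ξ} -/

section Exponential

variable {K : Type*} [CommRing K] [Algebra ℚ K]

/-- The weight of a monomial, where `tᵢ` has weight `i`. -/
def wt (d : ℕ+ →₀ ℕ) : ℕ := d.sum fun i m => (i : ℕ) * m

lemma wt_add (d e : ℕ+ →₀ ℕ) : wt (d + e) = wt d + wt e :=
  Finsupp.sum_add_index' (by simp) (by intros; ring)

lemma wt_single (n : ℕ+) : wt (Finsupp.single n 1) = n := by simp [wt]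

lemma coeff_expCoeff (σ : ℤˣ) (k : ℕ) (d : ℕ+ →₀ ℕ) :
    MvPowerSeries.coeff d (expCoeff K σ k) = if wt d = k then
      algebraMap ℚ K (d.prod fun _ m => (((σ : ℤ) : ℚ) ^ m / (Nat.factorial m : ℚ))) else 0 := rfl

/-- Coefficientwise form of ∂ₙe^{σξ} = σzⁿe^{σξ}. -/
lemma dt_expCoeff (σ : ℤˣ) (n : ℕ+) (k : ℕ) :
    dt n (expCoeff K σ k) = if (n : ℕ) ≤ k then (σ : ℤ) • expCoeff K σ (k - n) else 0 := by
  classical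
  ext d
  have hprod : (d + Finsupp.single n 1).prod
        (fun _ m => (((σ : ℤ) : ℚ) ^ m / (Nat.factorial m : ℚ))) * ((d n : ℚ) + 1) =
      (σ : ℤ) * d.prod fun _ m => (((σ : ℤ) : ℚ) ^ m / (Nat.factorial m : ℚ)) := by
    rw [← Finsupp.mul_prod_erase' d n _ (by simp),
      ← Finsupp.mul_prod_erase' (d + Finsupp.single n 1) n _ (by simp)]
    have h1 : (d + Finsupp.single n 1).erase n = d.erase n := by
      rw [Finsupp.erase_add, Finsupp.erase_single, add_zero]
    have h2 : (d + Finsupp.single n 1 : ℕ+ →₀ ℕ) n = d n + 1 := by simp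
    rw [h1, h2, Nat.factorial_succ, pow_succ]
    push_cast
    field_simp
  rw [coeff_dt, coeff_expCoeff, wt_add, wt_single]
  by_cases hk : wt d + n = k
  · rw [if_pos hk, if_pos (by omega), map_zsmul, coeff_expCoeff, if_pos (by omega)]
    have h := congrArg (algebraMap ℚ K) hprod
    simp only [map_mul, map_add, map_natCast, map_one, map_intCast] at h
    rw [h, zsmul_eq_mul]
  · rw [if_neg hk, zero_mul]
    split_ifs with h
    · rw [map_zsmul, coeff_expCoeff, if_neg (by omega), smul_zero]
    · simp

lemma coeff_mul_expCoeff (σ : ℤˣ) (f : TimeSeries K) {k : ℕ} {d : ℕ+ →₀ ℕ} (h : wt d < k) :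
    MvPowerSeries.coeff d (f * expCoeff K σ k) = 0 := by
  classical
  rw [MvPowerSeries.coeff_mul]
  refine Finset.sum_eq_zero fun x hx => ?_
  have hx' : wt x.1 + wt x.2 = wt d := by
    rw [← wt_add, Finset.HasAntidiagonal.mem_antidiagonal.mp hx]
  rw [coeff_expCoeff, if_neg (by omega), mul_zero]

/-- Any cut-off above the weight is allowed, so that different expansions can be summed over a
common range. -/
lemma coeff_expand (σ : ℤˣ) (a : ℤ → TimeSeries K) (l : ℤ) {d : ℕ+ →₀ ℕ} {M : ℕ} (h : wt d < M) :
    MvPowerSeries.coeff d (expand σ a l) =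
      ∑ k ∈ Finset.range M, MvPowerSeries.coeff d (a (l - k) * expCoeff K σ k) := by
  change ∑ᶠ k : ℕ, MvPowerSeries.coeff d (a (l - k) * expCoeff K σ k) = _
  refine finsum_eq_sum_of_support_subset _ fun k hk => ?_
  by_contra hk'
  simp only [Finset.coe_range, Set.mem_Iio, not_lt] at hk'
  exact hk (coeff_mul_expCoeff σ _ (by omega))

lemma expand_add (σ : ℤˣ) (a b : ℤ → TimeSeries K) (l : ℤ) :
    expand σ (fun j => a j + b j) l = expand σ a l + expand σ b l := by
  ext d
  simp only [map_add, coeff_expand σ _ l (Nat.lt_succ_self (wt d)), add_mul,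
    Finset.sum_add_distrib]

lemma expand_mul_left (σ : ℤˣ) (c : TimeSeries K) (a : ℤ → TimeSeries K) (l : ℤ) :
    expand σ (fun j => c * a j) l = c * expand σ a l := by
  classical
  ext d
  rw [MvPowerSeries.coeff_mul, coeff_expand σ _ l (Nat.lt_succ_self (wt d))]
  have h : ∀ x ∈ Finset.HasAntidiagonal.antidiagonal d,
      MvPowerSeries.coeff x.1 c * MvPowerSeries.coeff x.2 (expand σ a l) =
      ∑ k ∈ Finset.range (wt d).succ, MvPowerSeries.coeff x.1 c *
        MvPowerSeries.coeff x.2 (a (l - k) * expCoeff K σ k) := by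
    intro x hx
    have hx' : wt x.1 + wt x.2 = wt d := by
      rw [← wt_add, Finset.HasAntidiagonal.mem_antidiagonal.mp hx]
    rw [coeff_expand σ _ l (show wt x.2 < (wt d).succ by omega), Finset.mul_sum]
  rw [Finset.sum_congr rfl h, Finset.sum_comm]
  refine Finset.sum_congr rfl fun k _ => ?_
  rw [mul_assoc, MvPowerSeries.coeff_mul]

lemma dt_expand (σ : ℤˣ) (n : ℕ+) (a : ℤ → TimeSeries K) (l : ℤ) :
    dt n (expand σ a l) =
      expand σ (fun j => dt n (a j)) l + (σ : ℤ) • expand σ a (l - (n : ℕ)) := by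
  ext d
  -- The cut-off is split as `n + (wt d + 1)` because differentiating the exponential kills its
  -- first `n` coefficients and shifts the others.
  have hd : wt (d + Finsupp.single n 1) < (n : ℕ) + (wt d + 1) := by
    rw [wt_add, wt_single]; omega
  rw [coeff_dt, coeff_expand σ a l hd, Finset.sum_mul, map_add, map_zsmul,
    coeff_expand σ _ l (show wt d < (n : ℕ) + (wt d + 1) by omega),
    coeff_expand σ _ _ (Nat.lt_succ_self (wt d))]
  simp only [← coeff_dt, dt_mul, map_add, Finset.sum_add_distrib, dt_expCoeff]
  congr 1
  rw [Finset.sum_range_add, Finset.sum_eq_zero, zero_add, Finset.smul_sum]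
  · refine Finset.sum_congr rfl fun k _ => ?_
    rw [if_pos (by omega), Nat.add_sub_cancel_left, mul_smul_comm, map_zsmul]
    push_cast
    rw [sub_sub]
  · intro k hk
    rw [if_neg (by simpa using hk), mul_zero, map_zero]

lemma expand_oscDeriv (n : ℕ+) (a : ℤ → TimeSeries K) (l : ℤ) :
    expand 1 (oscDeriv n a) l = dt n (expand 1 a l) := by
  change expand 1 (fun j => dt n (a j) + a (j - (n : ℕ))) l = _
  rw [expand_add, dt_expand, Units.val_one, one_zsmul]
  congr 1
  ext d
  simp only [coeff_expand _ _ _ (Nat.lt_succ_self (wt d)), sub_right_comm]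

lemma expand_dualDeriv (n : ℕ+) (a : ℤ → TimeSeries K) (l : ℤ) :
    expand (-1) (dualDeriv n a) l = dt n (expand (-1) a l) := by
  have h : dualDeriv n a = fun j => dt n (a j) + (-1) * a (j - (n : ℕ)) := by
    funext j; simp [dualDeriv, sub_eq_add_neg]
  rw [h, expand_add, dt_expand, expand_mul_left]
  simp only [Units.val_neg, Units.val_one, neg_smul, one_smul, neg_mul, one_mul]
  congr 2
  ext d
  simp only [coeff_expand _ _ _ (Nat.lt_succ_self (wt d)), sub_right_comm]

lemma coeff_expand_eq_zero (σ : ℤˣ) {a : ℤ → TimeSeries K} {N : ℤ} (ha : ∀ j, N < j → a j = 0)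
    {d : ℕ+ →₀ ℕ} {l : ℤ} (hl : N + wt d < l) : MvPowerSeries.coeff d (expand σ a l) = 0 := by
  rw [coeff_expand σ a l (Nat.lt_succ_self (wt d))]
  refine Finset.sum_eq_zero fun k hk => ?_
  rw [Finset.mem_range] at hk
  rw [ha _ (by omega), zero_mul, map_zero]

lemma coeff_zero_expand (σ : ℤˣ) (a : ℤ → TimeSeries K) (l : ℤ) :
    MvPowerSeries.coeff 0 (expand σ a l) = MvPowerSeries.coeff 0 (a l) := by
  rw [coeff_expand σ a l (show wt 0 < 1 by simp [wt])]
  have : MvPowerSeries.coeff 0 (expCoeff K σ 0) = 1 := by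
    rw [coeff_expCoeff, if_pos (by simp [wt])]; simp
  simp only [Finset.range_one, Finset.sum_singleton, Nat.cast_zero, sub_zero]
  rw [MvPowerSeries.coeff_zero_eq_constantCoeff_apply, map_mul,
    ← MvPowerSeries.coeff_zero_eq_constantCoeff_apply,
    ← MvPowerSeries.coeff_zero_eq_constantCoeff_apply, this, mul_one]

end Exponential

/-! ### Series with exponents bounded above, and the residue at s = t -/

section BoundedExponents

variable {K : Type*} [CommRing K]

/-- A formal series in `z` with exponents bounded above. -/
def BddExp (a : ℤ → TimeSeries K) : Prop := ∃ N : ℤ, ∀ j, N < j → a j = 0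

lemma BddExp.oscDeriv {a : ℤ → TimeSeries K} (n : ℕ+) (h : BddExp a) : BddExp (oscDeriv n a) := by
  obtain ⟨N, h⟩ := h
  refine ⟨N + (n : ℕ), fun j hj => ?_⟩
  rw [OneToda.oscDeriv, h _ (by omega), h _ (by omega), dt_zero, add_zero]

lemma BddExp.dualDeriv {a : ℤ → TimeSeries K} (n : ℕ+) (h : BddExp a) :
    BddExp (dualDeriv n a) := by
  obtain ⟨N, h⟩ := h
  refine ⟨N + (n : ℕ), fun j hj => ?_⟩
  rw [OneToda.dualDeriv, h _ (by omega), h _ (by omega), dt_zero, sub_zero]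

lemma BddExp.mul_left {a : ℤ → TimeSeries K} (c : TimeSeries K) (h : BddExp a) :
    BddExp fun j => c * a j := by
  obtain ⟨N, h⟩ := h
  exact ⟨N, fun j hj => by simp only [h j hj, mul_zero]⟩

lemma BddExp.add {a b : ℤ → TimeSeries K} (ha : BddExp a) (hb : BddExp b) :
    BddExp fun j => a j + b j := by
  obtain ⟨N, ha⟩ := ha
  obtain ⟨N', hb⟩ := hb
  exact ⟨max N N', fun j hj => by
    simp only [ha j (by omega), hb j (by omega), add_zero]⟩

lemma BddExp.sum {ι : Type*} (s : Finset ι) {a : ι → ℤ → TimeSeries K} (h : ∀ i, BddExp (a i)) :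
    BddExp fun j => ∑ i ∈ s, a i j := by
  classical
  induction s using Finset.induction_on with
  | empty => exact ⟨0, by simp⟩
  | insert i s hi ih => simpa only [Finset.sum_insert hi] using (h i).add ih

/-- The value of the pairing on the diagonal `s = t`. -/
def diagPairing (φ ψ : ℤ → TimeSeries K) : TimeSeries K := ∑ᶠ l : ℤ, φ l * ψ (-1 - l)

lemma diagPairing_eq_sum {φ ψ : ℤ → TimeSeries K} {lo hi : ℤ} (hφ : ∀ j, hi < j → φ j = 0)
    (hψ : ∀ j, -1 - lo < j → ψ j = 0) :
    diagPairing φ ψ = ∑ l ∈ Finset.Icc lo hi, φ l * ψ (-1 - l) := by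
  refine finsum_eq_sum_of_support_subset _ fun l hl => ?_
  rw [Finset.coe_Icc, Set.mem_Icc]
  by_contra hcon
  refine hl ?_
  dsimp only
  rcases lt_or_ge hi l with h | h
  · rw [hφ _ h, zero_mul]
  · rw [hψ _ (by by_contra; exact hcon ⟨by omega, h⟩), mul_zero]

/-- The factors e^ξ and e^{-ξ} cancel on the diagonal: the two terms with zⁿ have opposite signs,
and `hshift` moves zⁿ from one factor to the other. -/
lemma dt_diagPairing {φ ψ : ℤ → TimeSeries K} (hφ : BddExp φ) (hψ : BddExp ψ) (n : ℕ+) :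
    dt n (diagPairing φ ψ) = diagPairing (oscDeriv n φ) ψ + diagPairing φ (dualDeriv n ψ) := by
  obtain ⟨N, hφ⟩ := hφ
  obtain ⟨M, hψ⟩ := hψ
  have hn := n.pos
  have hφ1 : ∀ j, N + (n : ℕ) < j → φ j = 0 := fun j hj => hφ j (by omega)
  have hψ1 : ∀ j, -1 - (-1 - M - (n : ℕ)) < j → ψ j = 0 := fun j hj => hψ j (by omega)
  have hφ2 : ∀ j, N + (n : ℕ) < j → oscDeriv n φ j = 0 := fun j hj => by
    rw [OneToda.oscDeriv, hφ _ (by omega), hφ _ (by omega), dt_zero, add_zero]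
  have hψ2 : ∀ j, -1 - (-1 - M - (n : ℕ)) < j → dualDeriv n ψ j = 0 := fun j hj => by
    rw [OneToda.dualDeriv, hψ _ (by omega), hψ _ (by omega), dt_zero, sub_zero]
  have hshift : diagPairing (fun j => φ (j - (n : ℕ))) ψ =
      diagPairing φ (fun j => ψ (j - (n : ℕ))) := by
    unfold diagPairing
    refine finsum_eq_of_bijective (fun l : ℤ => l - (n : ℕ)) (Equiv.subRight _).bijective
      fun l => ?_
    simp only
    congr 2
    ring
  rw [diagPairing_eq_sum (lo := -1 - M - (n : ℕ)) (hi := N + (n : ℕ))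
      (fun j hj => hφ _ (by omega)) (fun j hj => hψ _ (by omega)),
    diagPairing_eq_sum (lo := -1 - M - (n : ℕ)) (hi := N + (n : ℕ))
      (fun j hj => hφ _ (by omega)) (fun j hj => hψ _ (by omega))] at hshift
  rw [diagPairing_eq_sum hφ1 hψ1, diagPairing_eq_sum hφ2 hψ1, diagPairing_eq_sum hφ1 hψ2, dt_sum]
  simp only [dt_mul, OneToda.oscDeriv, OneToda.dualDeriv, add_mul, mul_sub,
    Finset.sum_add_distrib, Finset.sum_sub_distrib]
  rw [hshift]
  ring

end BoundedExponents

/-! ### The pairing in two sets of times -/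

section Pairing

variable {K : Type*} [CommRing K] [Algebra ℚ K]

/-- The exponent of `t`-monomials. -/
def expL (d : (ℕ+ ⊕ ℕ+) →₀ ℕ) : ℕ+ →₀ ℕ := (Finsupp.sumFinsuppAddEquivProdFinsupp d).1

/-- The exponent of `s`-monomials. -/
def expR (d : (ℕ+ ⊕ ℕ+) →₀ ℕ) : ℕ+ →₀ ℕ := (Finsupp.sumFinsuppAddEquivProdFinsupp d).2

lemma coeff_pairing {φ ψ : ℤ → TimeSeries K} {N M : ℤ} (hφ : ∀ j, N < j → φ j = 0)
    (hψ : ∀ j, M < j → ψ j = 0) (d : (ℕ+ ⊕ ℕ+) →₀ ℕ) {lo hi : ℤ} (hhi : N + wt (expL d) ≤ hi)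
    (hlo : lo ≤ -1 - M - wt (expR d)) :
    MvPowerSeries.coeff d (pairing φ ψ) = ∑ l ∈ Finset.Icc lo hi,
      MvPowerSeries.coeff (expL d) (expand 1 φ l) *
      MvPowerSeries.coeff (expR d) (expand (-1) ψ (-1 - l)) := by
  change ∑ᶠ l : ℤ, MvPowerSeries.coeff (expL d) (expand 1 φ l) *
      MvPowerSeries.coeff (expR d) (expand (-1) ψ (-1 - l)) = _
  refine finsum_eq_sum_of_support_subset _ fun l hl => ?_
  rw [Finset.coe_Icc, Set.mem_Icc]
  by_contra hcon
  refine hl ?_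
  dsimp only
  rcases lt_or_ge hi l with h | h
  · rw [coeff_expand_eq_zero _ hφ (by omega), zero_mul]
  · rw [coeff_expand_eq_zero _ hψ (l := -1 - l) (by by_contra; exact hcon ⟨by omega, h⟩), mul_zero]

lemma expL_add_inl (d : (ℕ+ ⊕ ℕ+) →₀ ℕ) (n : ℕ+) :
    expL (d + Finsupp.single (Sum.inl n) 1) = expL d + Finsupp.single n 1 := by
  ext i
  simp [expL, Finsupp.single_apply]

lemma expR_add_inl (d : (ℕ+ ⊕ ℕ+) →₀ ℕ) (n : ℕ+) :
    expR (d + Finsupp.single (Sum.inl n) 1) = expR d := by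
  ext i
  simp [expR]

lemma expL_add_inr (d : (ℕ+ ⊕ ℕ+) →₀ ℕ) (n : ℕ+) :
    expL (d + Finsupp.single (Sum.inr n) 1) = expL d := by
  ext i
  simp [expL]

lemma expR_add_inr (d : (ℕ+ ⊕ ℕ+) →₀ ℕ) (n : ℕ+) :
    expR (d + Finsupp.single (Sum.inr n) 1) = expR d + Finsupp.single n 1 := by
  ext i
  simp [expR, Finsupp.single_apply]

theorem pderiv_inl_pairing {φ ψ : ℤ → TimeSeries K} (hφ : BddExp φ) (hψ : BddExp ψ) (n : ℕ+) :
    MvPowerSeries.pderiv K (Sum.inl n) (pairing φ ψ) = pairing (oscDeriv n φ) ψ := by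
  obtain ⟨N', hφ'⟩ := hφ.oscDeriv n
  obtain ⟨N, hφ⟩ := hφ
  obtain ⟨M, hψ⟩ := hψ
  ext d
  have hhi : N + wt (expL d) + (n : ℕ) ≤ max (N + wt (expL d) + (n : ℕ)) (N' + wt (expL d)) :=
    le_max_left _ _
  rw [MvPowerSeries.coeff_pderiv,
    coeff_pairing hφ hψ _ (hi := max (N + wt (expL d) + (n : ℕ)) (N' + wt (expL d)))
      (by rw [expL_add_inl, wt_add, wt_single]; omega) (by rw [expR_add_inl]),
    coeff_pairing hφ' hψ d (le_max_right _ _) le_rfl, Finset.sum_mul]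
  refine Finset.sum_congr rfl fun l _ => ?_
  rw [expL_add_inl, expR_add_inl, expand_oscDeriv, coeff_dt]
  have : d (Sum.inl n) = expL d n := by simp [expL]
  rw [this]
  ring

theorem pderiv_inr_pairing {φ ψ : ℤ → TimeSeries K} (hφ : BddExp φ) (hψ : BddExp ψ) (n : ℕ+) :
    MvPowerSeries.pderiv K (Sum.inr n) (pairing φ ψ) = pairing φ (dualDeriv n ψ) := by
  obtain ⟨M', hψ'⟩ := hψ.dualDeriv n
  obtain ⟨N, hφ⟩ := hφ
  obtain ⟨M, hψ⟩ := hψ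
  ext d
  rw [MvPowerSeries.coeff_pderiv,
    coeff_pairing hφ hψ _
      (lo := min (-1 - M - wt (expR d) - (n : ℕ)) (-1 - M' - wt (expR d)))
      (by rw [expL_add_inr]) (by rw [expR_add_inr, wt_add, wt_single]; omega),
    coeff_pairing hφ hψ' d le_rfl (min_le_right _ _), Finset.sum_mul]
  refine Finset.sum_congr rfl fun l _ => ?_
  rw [expL_add_inr, expR_add_inr, expand_dualDeriv, coeff_dt]
  have : d (Sum.inr n) = expR d n := by simp [expR]
  rw [this]
  ring

lemma pairing_add_left {φ φ' ψ : ℤ → TimeSeries K} (hφ : BddExp φ) (hφ' : BddExp φ')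
    (hψ : BddExp ψ) : pairing (fun j => φ j + φ' j) ψ = pairing φ ψ + pairing φ' ψ := by
  obtain ⟨N, hφ⟩ := hφ
  obtain ⟨N', hφ'⟩ := hφ'
  obtain ⟨M, hψ⟩ := hψ
  ext d
  rw [map_add,
    coeff_pairing (fun j (hj : max N N' < j) => by
      rw [hφ j (by omega), hφ' j (by omega), add_zero]) hψ d le_rfl le_rfl,
    coeff_pairing hφ hψ d (hi := max N N' + wt (expL d)) (by omega) le_rfl,
    coeff_pairing hφ' hψ d (hi := max N N' + wt (expL d)) (by omega) le_rfl,
    ← Finset.sum_add_distrib]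
  simp only [expand_add, map_add, add_mul]

lemma pairing_add_right {φ ψ ψ' : ℤ → TimeSeries K} (hφ : BddExp φ) (hψ : BddExp ψ)
    (hψ' : BddExp ψ') : pairing φ (fun j => ψ j + ψ' j) = pairing φ ψ + pairing φ ψ' := by
  obtain ⟨N, hφ⟩ := hφ
  obtain ⟨M, hψ⟩ := hψ
  obtain ⟨M', hψ'⟩ := hψ'
  ext d
  rw [map_add,
    coeff_pairing hφ (fun j (hj : max M M' < j) => by
      rw [hψ j (by omega), hψ' j (by omega), add_zero]) d le_rfl le_rfl,
    coeff_pairing hφ hψ d (lo := -1 - max M M' - wt (expR d)) le_rfl (by omega),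
    coeff_pairing hφ hψ' d (lo := -1 - max M M' - wt (expR d)) le_rfl (by omega),
    ← Finset.sum_add_distrib]
  simp only [expand_add, map_add, mul_add]

lemma pairing_zero_left (ψ : ℤ → TimeSeries K) : pairing (fun _ => 0) ψ = 0 := by
  have h : ∀ l, expand 1 (fun _ => (0 : TimeSeries K)) l = 0 := fun l => by
    simpa using expand_mul_left 1 (0 : TimeSeries K) (fun _ => 0) l
  ext d
  change ∑ᶠ l : ℤ, MvPowerSeries.coeff (expL d) (expand 1 (fun _ => (0 : TimeSeries K)) l) *
      MvPowerSeries.coeff (expR d) (expand (-1) ψ (-1 - l)) = _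
  simp [h]

lemma pairing_zero_right (φ : ℤ → TimeSeries K) : pairing φ (fun _ => 0) = 0 := by
  have h : ∀ l, expand (-1) (fun _ => (0 : TimeSeries K)) l = 0 := fun l => by
    simpa using expand_mul_left (-1) (0 : TimeSeries K) (fun _ => 0) l
  ext d
  change ∑ᶠ l : ℤ, MvPowerSeries.coeff (expL d) (expand 1 φ l) *
      MvPowerSeries.coeff (expR d) (expand (-1) (fun _ => (0 : TimeSeries K)) (-1 - l)) = _
  simp [h]

lemma pairing_sum_left {ι : Type*} (s : Finset ι) {φ : ι → ℤ → TimeSeries K}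
    {ψ : ℤ → TimeSeries K} (hφ : ∀ i, BddExp (φ i)) (hψ : BddExp ψ) :
    pairing (fun j => ∑ i ∈ s, φ i j) ψ = ∑ i ∈ s, pairing (φ i) ψ := by
  classical
  induction s using Finset.induction_on with
  | empty => simpa using pairing_zero_left ψ
  | insert i s hi ih =>
    simp only [Finset.sum_insert hi]
    rw [pairing_add_left (hφ i) (BddExp.sum s hφ) hψ, ih]

lemma pairing_sum_right {ι : Type*} (s : Finset ι) {φ : ℤ → TimeSeries K}
    {ψ : ι → ℤ → TimeSeries K} (hφ : BddExp φ) (hψ : ∀ i, BddExp (ψ i)) :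
    pairing φ (fun j => ∑ i ∈ s, ψ i j) = ∑ i ∈ s, pairing φ (ψ i) := by
  classical
  induction s using Finset.induction_on with
  | empty => simpa using pairing_zero_right φ
  | insert i s hi ih =>
    simp only [Finset.sum_insert hi]
    rw [pairing_add_right hφ (hψ i) (BddExp.sum s hψ), ih]

/-- Linearity over K[[t]], in the form demanded by `eq_zero_of_coeff_pderiv`: only coefficients at
exponents below `d` enter. -/
lemma coeff_pairing_mul_left {φ ψ : ℤ → TimeSeries K} (c : TimeSeries K) (hφ : BddExp φ)
    (hψ : BddExp ψ) (d : (ℕ+ ⊕ ℕ+) →₀ ℕ)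
    (h : ∀ e ≤ d, MvPowerSeries.coeff e (pairing φ ψ) = 0) :
    MvPowerSeries.coeff d (pairing (fun j => c * φ j) ψ) = 0 := by
  classical
  obtain ⟨N, hφ⟩ := hφ
  obtain ⟨M, hψ⟩ := hψ
  rw [coeff_pairing (fun j hj => by rw [hφ j hj, mul_zero]) hψ d le_rfl le_rfl]
  simp only [expand_mul_left, MvPowerSeries.coeff_mul, Finset.sum_mul]
  rw [Finset.sum_comm]
  refine Finset.sum_eq_zero fun x hx => ?_
  have hx' := Finset.HasAntidiagonal.mem_antidiagonal.mp hx
  -- As `c` depends on t alone, splitting off one of its monomials lowers the t-exponent and keeps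
  -- the s-exponent.
  let e : (ℕ+ ⊕ ℕ+) →₀ ℕ := Finsupp.sumFinsuppAddEquivProdFinsupp.symm (x.2, expR d)
  have hL : expL e = x.2 := by simp [expL, e]
  have hR : expR e = expR d := by simp [expR, e]
  have hle : e ≤ d := by
    rintro (i | i)
    · have h1 : e (Sum.inl i) = x.2 i := by simp [e]
      have h2 : d (Sum.inl i) = expL d i := by simp [expL]
      rw [h1, h2, ← hx', Finsupp.add_apply]
      exact Nat.le_add_left _ _
    · have h1 : e (Sum.inr i) = expR d i := by simp [e]
      have h2 : d (Sum.inr i) = expR d i := by simp [expR]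
      rw [h1, h2]
  have hwt : wt x.1 + wt x.2 = wt (expL d) := by rw [← wt_add, hx']
  have := h e hle
  rw [coeff_pairing hφ hψ e (hi := N + wt (expL d)) (by rw [hL]; omega) (by rw [hR]),
    hL, hR] at this
  simp only [mul_assoc]
  rw [← Finset.mul_sum, this, mul_zero]

lemma coeff_pairing_mul_right {φ ψ : ℤ → TimeSeries K} (c : TimeSeries K) (hφ : BddExp φ)
    (hψ : BddExp ψ) (d : (ℕ+ ⊕ ℕ+) →₀ ℕ)
    (h : ∀ e ≤ d, MvPowerSeries.coeff e (pairing φ ψ) = 0) :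
    MvPowerSeries.coeff d (pairing φ (fun j => c * ψ j)) = 0 := by
  classical
  obtain ⟨N, hφ⟩ := hφ
  obtain ⟨M, hψ⟩ := hψ
  rw [coeff_pairing hφ (fun j hj => by rw [hψ j hj, mul_zero]) d le_rfl le_rfl]
  simp only [expand_mul_left, MvPowerSeries.coeff_mul, Finset.mul_sum]
  rw [Finset.sum_comm]
  refine Finset.sum_eq_zero fun x hx => ?_
  have hx' := Finset.HasAntidiagonal.mem_antidiagonal.mp hx
  let e : (ℕ+ ⊕ ℕ+) →₀ ℕ := Finsupp.sumFinsuppAddEquivProdFinsupp.symm (expL d, x.2)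
  have hL : expL e = expL d := by simp [expL, e]
  have hR : expR e = x.2 := by simp [expR, e]
  have hle : e ≤ d := by
    rintro (i | i)
    · have h1 : e (Sum.inl i) = expL d i := by simp [e]
      have h2 : d (Sum.inl i) = expL d i := by simp [expL]
      rw [h1, h2]
    · have h1 : e (Sum.inr i) = x.2 i := by simp [e]
      have h2 : d (Sum.inr i) = expR d i := by simp [expR]
      rw [h1, h2, ← hx', Finsupp.add_apply]
      exact Nat.le_add_left _ _
  have hwt : wt x.1 + wt x.2 = wt (expR d) := by rw [← wt_add, hx']
  have := h e hle
  rw [coeff_pairing hφ hψ e (lo := -1 - M - wt (expR d)) (by rw [hL]) (by rw [hR]; omega),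
    hL, hR] at this
  simp only [mul_left_comm _ (MvPowerSeries.coeff x.1 c)]
  rw [← Finset.mul_sum, this, mul_zero]

lemma coeff_zero_pairing {φ ψ : ℤ → TimeSeries K} (hφ : BddExp φ) (hψ : BddExp ψ) :
    MvPowerSeries.coeff 0 (pairing φ ψ) = MvPowerSeries.coeff 0 (diagPairing φ ψ) := by
  obtain ⟨N, hφ⟩ := hφ
  obtain ⟨M, hψ⟩ := hψ
  have hL : expL 0 = 0 := by ext; simp [expL]
  have hR : expR 0 = 0 := by ext; simp [expR]
  rw [coeff_pairing hφ hψ 0 (lo := -1 - M) (hi := N) (by rw [hL]; simp [wt])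
      (by rw [hR]; simp [wt]),
    diagPairing_eq_sum (lo := -1 - M) hφ (fun j hj => hψ j (by omega)), map_sum]
  refine Finset.sum_congr rfl fun l _ => ?_
  rw [hL, hR, coeff_zero_expand, coeff_zero_expand]
  simp only [MvPowerSeries.coeff_zero_eq_constantCoeff_apply, map_mul]

/-- Restriction of the bilinear identity to the diagonal `s = t`. -/
theorem diagPairing_eq_zero {φ ψ : ℤ → TimeSeries K} (hφ : BddExp φ) (hψ : BddExp ψ)
    (h : pairing φ ψ = 0) : diagPairing φ ψ = 0 := by
  -- The induction on exponents needs a family stable under differentiation, hence all pairs with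
  -- vanishing pairing at once. The derivative of a diagonal value is the sum of the diagonal values
  -- of the t- and s-derivatives, which again belong to the family.
  let ι := {x : (ℤ → TimeSeries K) × (ℤ → TimeSeries K) //
    BddExp x.1 ∧ BddExp x.2 ∧ pairing x.1 x.2 = 0}
  refine eq_zero_of_coeff_pderiv (fun x : ι => diagPairing x.1.1 x.1.2) ?_ ?_ ⟨(φ, ψ), hφ, hψ, h⟩
  · rintro ⟨⟨φ, ψ⟩, hφ, hψ, h⟩
    dsimp only at hφ hψ h ⊢
    rw [← coeff_zero_pairing hφ hψ, h, map_zero]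
  · rintro ⟨⟨φ, ψ⟩, hφ, hψ, h⟩ n d hd
    dsimp only at hφ hψ h ⊢
    have h1 := hd ⟨(oscDeriv n φ, ψ), hφ.oscDeriv n, hψ, by
      dsimp only; rw [← pderiv_inl_pairing hφ hψ, h, map_zero]⟩ d le_rfl
    have h2 := hd ⟨(φ, dualDeriv n ψ), hφ, hψ.dualDeriv n, by
      dsimp only; rw [← pderiv_inr_pairing hφ hψ, h, map_zero]⟩ d le_rfl
    rw [← dt_eq, dt_diagPairing hφ hψ, map_add, h1, h2, add_zero]

end Pairing

/-! ### The ring of infinite matrices vanishing above some diagonal -/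

section BandedMatrices

variable {K : Type*} [CommRing K]

/-- The matrix vanishes above the `N`-th diagonal. -/
def VanishesAbove (N : ℤ) (A : Matrix ℤ ℤ (TimeSeries K)) : Prop := ∀ i j, i + N < j → A i j = 0

lemma VanishesAbove.mono {N M : ℤ} {A : Matrix ℤ ℤ (TimeSeries K)} (h : VanishesAbove N A)
    (hNM : N ≤ M) : VanishesAbove M A := fun i j hij => h i j (by omega)

lemma matMul_eq_sum {A B : Matrix ℤ ℤ (TimeSeries K)} {N M lo hi i j : ℤ}
    (hA : VanishesAbove N A) (hB : VanishesAbove M B) (hlo : lo ≤ j - M) (hhi : i + N ≤ hi) :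
    matMul A B i j = ∑ k ∈ Finset.Icc lo hi, A i k * B k j := by
  refine finsum_eq_sum_of_support_subset _ fun k hk => ?_
  rw [Finset.coe_Icc, Set.mem_Icc]
  by_contra hcon
  refine hk ?_
  dsimp only
  rcases lt_or_ge hi k with h | h
  · rw [hA _ _ (by omega), zero_mul]
  · rw [hB _ _ (by by_contra; exact hcon ⟨by omega, h⟩), mul_zero]

lemma VanishesAbove.matMul {A B : Matrix ℤ ℤ (TimeSeries K)} {N M : ℤ}
    (hA : VanishesAbove N A) (hB : VanishesAbove M B) : VanishesAbove (N + M) (matMul A B) := by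
  intro i j hij
  rw [matMul_eq_sum hA hB le_rfl le_rfl, Finset.Icc_eq_empty (by omega), Finset.sum_empty]

variable (K) in
/-- The ring of infinite matrices vanishing above some diagonal. -/
structure BMat where
  /-- The underlying matrix. -/
  val : Matrix ℤ ℤ (TimeSeries K)
  exists_vanishesAbove : ∃ N, VanishesAbove N val

namespace BMat

instance : CoeFun (BMat K) (fun _ => ℤ → ℤ → TimeSeries K) := ⟨fun A => A.1⟩

lemma ext {A B : BMat K} (h : ∀ i j, A i j = B i j) : A = B := by
  obtain ⟨A, hA⟩ := A
  obtain ⟨B, hB⟩ := B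
  obtain rfl : A = B := funext fun i => funext fun j => h i j
  rfl

instance : Zero (BMat K) := ⟨⟨0, 0, fun _ _ _ => rfl⟩⟩

instance : Add (BMat K) := ⟨fun A B => ⟨A.1 + B.1, by
  obtain ⟨N, hA⟩ := A.2
  obtain ⟨M, hB⟩ := B.2
  refine ⟨max N M, fun i j hij => ?_⟩
  rw [Matrix.add_apply, hA _ _ (by omega), hB _ _ (by omega), add_zero]⟩⟩

instance : Neg (BMat K) := ⟨fun A => ⟨-A.1, by
  obtain ⟨N, hA⟩ := A.2
  refine ⟨N, fun i j hij => ?_⟩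
  rw [Matrix.neg_apply, hA _ _ hij, neg_zero]⟩⟩

@[simp] lemma add_apply (A B : BMat K) (i j : ℤ) : (A + B) i j = A i j + B i j := rfl
@[simp] lemma neg_apply (A : BMat K) (i j : ℤ) : (-A) i j = -A i j := rfl
@[simp] lemma zero_apply (i j : ℤ) : (0 : BMat K) i j = 0 := rfl

instance : Mul (BMat K) := ⟨fun A B => ⟨matMul A.1 B.1, by
  obtain ⟨N, hA⟩ := A.2
  obtain ⟨M, hB⟩ := B.2
  exact ⟨N + M, hA.matMul hB⟩⟩⟩

lemma mul_val (A B : BMat K) : (A * B).1 = matMul A.1 B.1 := rfl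

lemma vanishesAbove_one : VanishesAbove 0 (1 : Matrix ℤ ℤ (TimeSeries K)) :=
  fun _ _ hij => Matrix.one_apply_ne (by omega)

instance : One (BMat K) := ⟨⟨1, 0, vanishesAbove_one⟩⟩

lemma one_val : (1 : BMat K).1 = 1 := rfl

lemma one_apply (i j : ℤ) : (1 : BMat K) i j = if i = j then 1 else 0 := Matrix.one_apply

lemma mul_apply_eq_sum {A B : BMat K} {N M lo hi i j : ℤ}
    (hA : VanishesAbove N A.1) (hB : VanishesAbove M B.1) (hlo : lo ≤ j - M) (hhi : i + N ≤ hi) :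
    (A * B) i j = ∑ k ∈ Finset.Icc lo hi, A i k * B k j := matMul_eq_sum hA hB hlo hhi

lemma mul_apply (A B : BMat K) (i j : ℤ) : (A * B) i j = ∑ᶠ k : ℤ, A i k * B k j := rfl

instance : Ring (BMat K) where
  add_assoc A B C := BMat.ext fun i j => add_assoc _ _ _
  zero_add A := BMat.ext fun i j => zero_add _
  add_zero A := BMat.ext fun i j => add_zero _
  add_comm A B := BMat.ext fun i j => add_comm _ _
  neg_add_cancel A := BMat.ext fun i j => neg_add_cancel _
  nsmul := nsmulRec
  mul_assoc A B C := by
    obtain ⟨N₁, hA⟩ := A.2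
    obtain ⟨N₂, hB⟩ := B.2
    obtain ⟨N₃, hC⟩ := C.2
    have hAB : VanishesAbove (N₁ + N₂) (A * B).1 := hA.matMul hB
    have hBC : VanishesAbove (N₂ + N₃) (B * C).1 := hB.matMul hC
    refine BMat.ext fun i j => ?_
    rw [mul_apply_eq_sum hAB hC le_rfl le_rfl, mul_apply_eq_sum hA hBC le_rfl le_rfl]
    -- The inner ranges are widened until they no longer depend on the outer index, so that the two
    -- sums can be exchanged.
    have h1 : ∀ k ∈ Finset.Icc (j - N₃) (i + (N₁ + N₂)), (A * B) i k * C k j =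
        ∑ m ∈ Finset.Icc (j - (N₂ + N₃)) (i + N₁), A i m * B m k * C k j := by
      intro k hk
      rw [Finset.mem_Icc] at hk
      rw [mul_apply_eq_sum hA hB (show j - (N₂ + N₃) ≤ k - N₂ by omega) le_rfl,
        Finset.sum_mul]
    have h2 : ∀ m ∈ Finset.Icc (j - (N₂ + N₃)) (i + N₁), A i m * (B * C) m j =
        ∑ k ∈ Finset.Icc (j - N₃) (i + (N₁ + N₂)), A i m * B m k * C k j := by
      intro m hm
      rw [Finset.mem_Icc] at hm
      rw [mul_apply_eq_sum hB hC le_rfl (show m + N₂ ≤ i + (N₁ + N₂) by omega), Finset.mul_sum]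
      simp only [mul_assoc]
    rw [Finset.sum_congr rfl h1, Finset.sum_congr rfl h2, Finset.sum_comm]
  one_mul A := by
    refine BMat.ext fun i j => ?_
    rw [mul_apply, finsum_eq_single _ i]
    · rw [one_apply, if_pos rfl, one_mul]
    · intro k hk
      rw [one_apply, if_neg hk.symm, zero_mul]
  mul_one A := by
    refine BMat.ext fun i j => ?_
    rw [mul_apply, finsum_eq_single _ j]
    · rw [one_apply, if_pos rfl, mul_one]
    · intro k hk
      rw [one_apply, if_neg hk, mul_zero]
  left_distrib A B C := by
    obtain ⟨N₁, hA⟩ := A.2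
    obtain ⟨N₂, hB⟩ := B.2
    obtain ⟨N₃, hC⟩ := C.2
    refine BMat.ext fun i j => ?_
    have hBC : VanishesAbove (max N₂ N₃) (B + C).1 := fun i j hij => by
      change B i j + C i j = 0
      rw [hB _ _ (by omega), hC _ _ (by omega), add_zero]
    change (A * (B + C)) i j = (A * B) i j + (A * C) i j
    rw [mul_apply_eq_sum hA hBC le_rfl le_rfl,
      mul_apply_eq_sum (lo := j - max N₂ N₃) hA hB (by omega) le_rfl,
      mul_apply_eq_sum (lo := j - max N₂ N₃) hA hC (by omega) le_rfl, ← Finset.sum_add_distrib]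
    exact Finset.sum_congr rfl fun k _ => mul_add _ _ _
  right_distrib A B C := by
    obtain ⟨N₁, hA⟩ := A.2
    obtain ⟨N₂, hB⟩ := B.2
    obtain ⟨N₃, hC⟩ := C.2
    refine BMat.ext fun i j => ?_
    have hAB : VanishesAbove (max N₁ N₂) (A + B).1 := fun i j hij => by
      change A i j + B i j = 0
      rw [hA _ _ (by omega), hB _ _ (by omega), add_zero]
    change ((A + B) * C) i j = (A * C) i j + (B * C) i j
    rw [mul_apply_eq_sum hAB hC le_rfl le_rfl,
      mul_apply_eq_sum (hi := i + max N₁ N₂) hA hC le_rfl (by omega),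
      mul_apply_eq_sum (hi := i + max N₁ N₂) hB hC le_rfl (by omega), ← Finset.sum_add_distrib]
    exact Finset.sum_congr rfl fun k _ => add_mul _ _ _
  zero_mul A := by
    refine BMat.ext fun i j => ?_
    change ∑ᶠ k : ℤ, (0 : TimeSeries K) * A k j = 0
    simp
  mul_zero A := by
    refine BMat.ext fun i j => ?_
    change ∑ᶠ k : ℤ, A i k * (0 : TimeSeries K) = 0
    simp
  zsmul := zsmulRec

@[simp] lemma sub_apply (A B : BMat K) (i j : ℤ) : (A - B) i j = A i j - B i j := by
  rw [sub_eq_add_neg, sub_eq_add_neg]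
  rfl

lemma matPow_val (A : BMat K) (n : ℕ) : matPow A.1 n = (A ^ n).1 := by
  induction n with
  | zero => rw [pow_zero, one_val]; rfl
  | succ n ih => rw [pow_succ', mul_val, ← ih]; rfl

/-- Entrywise derivative. -/
def deriv (n : ℕ+) (A : BMat K) : BMat K := ⟨A.1.map (dt n), by
  obtain ⟨N, hA⟩ := A.2
  exact ⟨N, fun i j hij => by rw [Matrix.map_apply, hA _ _ hij, dt_zero]⟩⟩

@[simp] lemma deriv_apply (n : ℕ+) (A : BMat K) (i j : ℤ) : deriv n A i j = dt n (A i j) := rfl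

lemma deriv_sub (n : ℕ+) (A B : BMat K) : deriv n (A - B) = deriv n A - deriv n B := by
  refine BMat.ext fun i j => ?_; simp [dt_sub]

lemma deriv_neg (n : ℕ+) (A : BMat K) : deriv n (-A) = -deriv n A := by
  refine BMat.ext fun i j => ?_; simp [dt_neg]

@[simp] lemma deriv_one (n : ℕ+) : deriv n (1 : BMat K) = 0 := by
  refine BMat.ext fun i j => ?_
  rw [deriv_apply, one_apply]
  split_ifs <;> simp

lemma deriv_mul (n : ℕ+) (A B : BMat K) :
    deriv n (A * B) = deriv n A * B + A * deriv n B := by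
  obtain ⟨N, hA⟩ := A.2
  obtain ⟨M, hB⟩ := B.2
  have hA' : VanishesAbove N (deriv n A).1 := fun i j hij => by
    change dt n (A i j) = 0
    rw [hA _ _ hij, dt_zero]
  have hB' : VanishesAbove M (deriv n B).1 := fun i j hij => by
    change dt n (B i j) = 0
    rw [hB _ _ hij, dt_zero]
  refine BMat.ext fun i j => ?_
  rw [deriv_apply, add_apply, mul_apply_eq_sum hA hB le_rfl le_rfl,
    mul_apply_eq_sum hA' hB le_rfl le_rfl, mul_apply_eq_sum hA hB' le_rfl le_rfl,
    ← Finset.sum_add_distrib, dt_sum]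
  exact Finset.sum_congr rfl fun k _ => dt_mul _ _ _

/-- The upper triangular part, including the diagonal. -/
def plus (A : BMat K) : BMat K := ⟨matPlus A.1, by
  obtain ⟨N, hA⟩ := A.2
  exact ⟨N, fun i j hij => by rw [matPlus, hA _ _ hij, ite_self]⟩⟩

lemma plus_val (A : BMat K) : (plus A).1 = matPlus A.1 := rfl

lemma plus_apply (A : BMat K) (i j : ℤ) : plus A i j = if i ≤ j then A i j else 0 := rfl

/-- The strictly lower triangular part. -/
def minus (A : BMat K) : BMat K := A - plus A

lemma minus_apply (A : BMat K) (i j : ℤ) : minus A i j = if i ≤ j then 0 else A i j := by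
  rw [minus, sub_apply, plus_apply]
  split_ifs <;> simp

lemma plus_add_minus (A : BMat K) : plus A + minus A = A := by rw [minus]; abel

/-- Strictly lower triangular matrices. -/
def StrictLower (A : BMat K) : Prop := ∀ i j, i ≤ j → A i j = 0

/-- Upper triangular matrices. -/
def Upper (A : BMat K) : Prop := ∀ i j, j < i → A i j = 0

lemma strictLower_minus (A : BMat K) : StrictLower (minus A) := fun i j hij => by
  rw [minus_apply, if_pos hij]

lemma upper_plus (A : BMat K) : Upper (plus A) := fun i j hij => by
  rw [plus_apply, if_neg (by omega)]

lemma StrictLower.vanishesAbove {A : BMat K} (h : StrictLower A) : VanishesAbove (-1) A.1 :=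
  fun i j hij => h i j (by omega)

lemma StrictLower.of_vanishesAbove {A : BMat K} (h : VanishesAbove (-1) A.1) : StrictLower A :=
  fun i j hij => h i j (by omega)

lemma StrictLower.mul_of_vanishesAbove {A B : BMat K} (hA : StrictLower A)
    (hB : VanishesAbove 0 B.1) : StrictLower (A * B) :=
  StrictLower.of_vanishesAbove (hA.vanishesAbove.matMul hB)

lemma StrictLower.mul {A B : BMat K} (hA : StrictLower A) (hB : StrictLower B) :
    StrictLower (A * B) := hA.mul_of_vanishesAbove (hB.vanishesAbove.mono (by norm_num))

lemma Upper.mul {A B : BMat K} (hA : Upper A) (hB : Upper B) : Upper (A * B) := by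
  intro i j hij
  rw [mul_apply]
  refine finsum_eq_zero_of_forall_eq_zero fun k => ?_
  rcases lt_or_ge k i with h | h
  · rw [hA i k h, zero_mul]
  · rw [hB k j (by omega), mul_zero]

lemma Upper.sub {A B : BMat K} (hA : Upper A) (hB : Upper B) : Upper (A - B) := fun i j hij => by
  rw [sub_apply, hA i j hij, hB i j hij, sub_zero]

lemma StrictLower.sub {A B : BMat K} (hA : StrictLower A) (hB : StrictLower B) :
    StrictLower (A - B) := fun i j hij => by
  rw [sub_apply, hA i j hij, hB i j hij, sub_zero]

/-- Uniqueness of the splitting into an upper and a strictly lower triangular part. -/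
lemma minus_eq_of_eq_add {A B C : BMat K} (h : A = B + C) (hB : Upper B) (hC : StrictLower C) :
    minus A = C := by
  refine BMat.ext fun i j => ?_
  rw [minus_apply, h, add_apply]
  split_ifs with hij
  · exact (hC i j hij).symm
  · rw [hB i j (by omega), zero_add]

lemma minus_sub (A B : BMat K) : minus (A - B) = minus A - minus B := by
  refine BMat.ext fun i j => ?_
  simp only [minus_apply, sub_apply]
  split_ifs <;> simp

lemma deriv_minus (n : ℕ+) (A : BMat K) : deriv n (minus A) = minus (deriv n A) := by
  refine BMat.ext fun i j => ?_
  simp only [minus_apply, deriv_apply]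
  split_ifs <;> simp

/-- The shift matrix `∑ₖ E_{k,k+1}`. -/
def shift : BMat K := ⟨fun i j => if j = i + 1 then 1 else 0, 1,
  fun i j hij => if_neg (by omega)⟩

lemma shift_apply (i j : ℤ) : (shift : BMat K) i j = if j = i + 1 then 1 else 0 := rfl

lemma mul_shift_apply (A : BMat K) (i j : ℤ) : (A * shift : BMat K) i j = A i (j - 1) := by
  rw [mul_apply, finsum_eq_single _ (j - 1)]
  · rw [shift_apply, if_pos (by ring), mul_one]
  · intro k hk
    rw [shift_apply, if_neg (by omega), mul_zero]

lemma shift_mul_apply (A : BMat K) (i j : ℤ) : (shift * A : BMat K) i j = A (i + 1) j := by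
  rw [mul_apply, finsum_eq_single _ (i + 1)]
  · rw [shift_apply, if_pos rfl, one_mul]
  · intro k hk
    rw [shift_apply, if_neg (by omega), zero_mul]

lemma mul_shift_pow_apply (A : BMat K) (n : ℕ) (i j : ℤ) :
    (A * shift ^ n : BMat K) i j = A i (j - n) := by
  induction n generalizing j with
  | zero => simp
  | succ n ih =>
    rw [pow_succ, ← mul_assoc, mul_shift_apply, ih]
    congr 1; push_cast; ring

lemma shift_pow_mul_apply (A : BMat K) (n : ℕ) (i j : ℤ) :
    (shift ^ n * A : BMat K) i j = A (i + n) j := by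
  induction n generalizing i with
  | zero => simp
  | succ n ih =>
    rw [pow_succ', mul_assoc, shift_mul_apply, ih]
    congr 1; push_cast; ring

@[simp] lemma deriv_shift (n : ℕ+) : deriv n (shift : BMat K) = 0 := by
  refine BMat.ext fun i j => ?_
  rw [deriv_apply, shift_apply]
  split_ifs <;> simp

/-- Lower triangular matrices with ones on the diagonal. -/
def LowerUnitriangular (A : BMat K) : Prop := VanishesAbove 0 A.1 ∧ ∀ i, A i i = 1

lemma LowerUnitriangular.mul_apply_self {A B : BMat K} (hA : VanishesAbove 0 A.1)
    (hB : VanishesAbove 0 B.1) (i : ℤ) : (A * B) i i = A i i * B i i := by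
  rw [mul_apply_eq_sum hA hB le_rfl le_rfl]
  simp

/-- Conjugation by the diagonal matrix `ε`. -/
def conj (ε : ℤ → Kˣ) : BMat K ≃+* BMat K where
  toFun A := ⟨fun i j => MvPowerSeries.C (((ε i)⁻¹ * ε j : Kˣ) : K) * A i j, by
    obtain ⟨N, hA⟩ := A.2
    exact ⟨N, fun i j hij => by simp only [hA _ _ hij, mul_zero]⟩⟩
  invFun A := ⟨fun i j => MvPowerSeries.C ((ε i * (ε j)⁻¹ : Kˣ) : K) * A i j, by
    obtain ⟨N, hA⟩ := A.2
    exact ⟨N, fun i j hij => by simp only [hA _ _ hij, mul_zero]⟩⟩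
  left_inv A := by
    refine BMat.ext fun i j => ?_
    change MvPowerSeries.C _ * (MvPowerSeries.C _ * A i j) = A i j
    rw [← mul_assoc, ← map_mul, ← Units.val_mul]
    simp [mul_assoc, mul_left_comm]
  right_inv A := by
    refine BMat.ext fun i j => ?_
    change MvPowerSeries.C _ * (MvPowerSeries.C _ * A i j) = A i j
    rw [← mul_assoc, ← map_mul, ← Units.val_mul]
    simp [mul_assoc, mul_left_comm]
  map_add' A B := by
    refine BMat.ext fun i j => ?_
    exact mul_add _ _ _
  map_mul' A B := by
    obtain ⟨N, hA⟩ := A.2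
    obtain ⟨M, hB⟩ := B.2
    refine BMat.ext fun i j => ?_
    rw [mul_apply_eq_sum (N := N) (M := M)
      (fun i j hij => by
        change _ * A i j = 0
        rw [hA _ _ hij, mul_zero]) (fun i j hij => by
        change _ * B i j = 0
        rw [hB _ _ hij, mul_zero]) le_rfl le_rfl]
    change _ * (A * B) i j = ∑ k ∈ _, (_ * A i k) * (_ * B k j)
    rw [mul_apply_eq_sum hA hB le_rfl le_rfl, Finset.mul_sum]
    refine Finset.sum_congr rfl fun k _ => ?_
    have : (ε i)⁻¹ * ε j = ((ε i)⁻¹ * ε k) * ((ε k)⁻¹ * ε j) := by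
      rw [mul_assoc, mul_inv_cancel_left]
    rw [this, Units.val_mul, map_mul]
    ring

lemma conj_apply (ε : ℤ → Kˣ) (A : BMat K) (i j : ℤ) :
    conj ε A i j = MvPowerSeries.C (((ε i)⁻¹ * ε j : Kˣ) : K) * A i j := rfl

lemma conj_plus (ε : ℤ → Kˣ) (A : BMat K) : conj ε (plus A) = plus (conj ε A) := by
  refine BMat.ext fun i j => ?_
  simp only [conj_apply, plus_apply, mul_ite, mul_zero]

lemma conj_deriv (ε : ℤ → Kˣ) (n : ℕ+) (A : BMat K) :
    conj ε (deriv n A) = deriv n (conj ε A) := by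
  refine BMat.ext fun i j => ?_
  simp only [conj_apply, deriv_apply, dt_mul, dt_C, zero_mul, zero_add]

end BMat

end BandedMatrices

/-! ### Binomial identities with integer upper index -/

section Binomial

lemma sum_antidiagonal_assoc {M : Type*} [AddCommMonoid M] (f : ℕ → ℕ → ℕ → M) (s : ℕ) :
    ∑ p ∈ Finset.HasAntidiagonal.antidiagonal s,
        ∑ x ∈ Finset.HasAntidiagonal.antidiagonal p.1, f x.1 x.2 p.2 =
      ∑ p ∈ Finset.HasAntidiagonal.antidiagonal s,
        ∑ y ∈ Finset.HasAntidiagonal.antidiagonal p.2, f p.1 y.1 y.2 := by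
  rw [Finset.sum_sigma', Finset.sum_sigma']
  refine Finset.sum_bij' (fun a _ => ⟨(a.2.1, a.2.2 + a.1.2), (a.2.2, a.1.2)⟩)
    (fun a _ => ⟨(a.1.1 + a.2.1, a.2.2), (a.1.1, a.2.1)⟩) ?_ ?_ ?_ ?_ ?_
  · rintro ⟨⟨a, b⟩, ⟨c, d⟩⟩ h
    simp only [Finset.mem_sigma, Finset.HasAntidiagonal.mem_antidiagonal] at h ⊢
    obtain ⟨h₁, h₂⟩ := h
    exact ⟨by simp only [← h₁, ← h₂]; ring, by simp only⟩
  · rintro ⟨⟨a, b⟩, ⟨c, d⟩⟩ h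
    simp only [Finset.mem_sigma, Finset.HasAntidiagonal.mem_antidiagonal] at h ⊢
    obtain ⟨h₁, h₂⟩ := h
    exact ⟨by simp only [← h₁, ← h₂]; ring, by simp only⟩
  · rintro ⟨⟨a, b⟩, ⟨c, d⟩⟩ h
    simp only [Finset.mem_sigma, Finset.HasAntidiagonal.mem_antidiagonal] at h
    obtain ⟨-, rfl⟩ := h
    rfl
  · rintro ⟨⟨a, b⟩, ⟨c, d⟩⟩ h
    simp only [Finset.mem_sigma, Finset.HasAntidiagonal.mem_antidiagonal] at h
    obtain ⟨-, rfl⟩ := h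
    rfl
  · rintro ⟨⟨a, b⟩, ⟨c, d⟩⟩ h
    rfl

lemma choose_add_mul_choose (r : ℤ) (x y : ℕ) :
    Ring.choose r (x + y) * ((x + y).choose x : ℤ) = Ring.choose r x * Ring.choose (r - x) y := by
  have := Ring.choose_smul_choose r (Nat.le_add_right x y)
  rw [Nat.add_sub_cancel_left, nsmul_eq_mul] at this
  rw [mul_comm, this]

lemma vandermonde (r s : ℤ) (k : ℕ) : Ring.choose (r + s) k =
    ∑ x ∈ Finset.HasAntidiagonal.antidiagonal k, Ring.choose r x.1 * Ring.choose s x.2 :=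
  Ring.add_choose_eq k (Commute.all r s)

end Binomial

/-! ### The ring of pseudodifferential operators, adjoints and residues -/

section PseudoDifferential

variable {K : Type*} [CommRing K]

/-- The operator has order at most `N`. -/
def OrdLE (N : ℤ) (A : ℤ → TimeSeries K) : Prop := ∀ l, N < l → A l = 0

lemma OrdLE.mono {N M : ℤ} {A : ℤ → TimeSeries K} (h : OrdLE N A) (hNM : N ≤ M) : OrdLE M A :=
  fun l hl => h l (by omega)

lemma psMul_eq_sum {A B : ℤ → TimeSeries K} {N M lo hi l : ℤ} {n : ℕ} (hA : OrdLE N A)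
    (hB : OrdLE M B) (hlo : lo ≤ l - M) (hhi : N ≤ hi) (hn : N + M - l < n) :
    psMul A B l = ∑ i ∈ Finset.Icc lo hi, ∑ k ∈ Finset.range n,
      Ring.choose i k • (A i * (dt 1)^[k] (B (l + k - i))) := by
  rw [← Finset.sum_product']
  refine finsum_eq_sum_of_support_subset _ fun x hx => ?_
  obtain ⟨i, k⟩ := x
  simp only [Finset.coe_product, Finset.coe_Icc, Finset.coe_range, Set.mem_prod, Set.mem_Icc,
    Set.mem_Iio]
  by_contra hcon
  refine hx ?_
  dsimp only
  rcases lt_or_ge N i with h | h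
  · rw [hA _ h, zero_mul, smul_zero]
  · rw [hB _ (by by_contra; exact hcon (by omega)), dt_iter_zero, mul_zero, smul_zero]

lemma OrdLE.psMul {A B : ℤ → TimeSeries K} {N M : ℤ} (hA : OrdLE N A) (hB : OrdLE M B) :
    OrdLE (N + M) (psMul A B) := by
  intro l hl
  rw [psMul_eq_sum (n := 0) hA hB le_rfl le_rfl (by push_cast; omega)]
  simp

variable (K) in
/-- Pseudodifferential operators. -/
structure PDO where
  /-- The coefficients. -/
  val : ℤ → TimeSeries K
  exists_ordLE : ∃ N, OrdLE N val

namespace PDO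

instance : CoeFun (PDO K) (fun _ => ℤ → TimeSeries K) := ⟨fun A => A.1⟩

lemma ext {A B : PDO K} (h : ∀ l, A l = B l) : A = B := by
  obtain ⟨A, hA⟩ := A
  obtain ⟨B, hB⟩ := B
  obtain rfl : A = B := funext h
  rfl

lemma ordLE_add {A B : ℤ → TimeSeries K} {N : ℤ} (hA : OrdLE N A) (hB : OrdLE N B) :
    OrdLE N (A + B) := fun l hl => by rw [Pi.add_apply, hA l hl, hB l hl, add_zero]

instance : Zero (PDO K) := ⟨⟨0, 0, fun _ _ => rfl⟩⟩

instance : Add (PDO K) := ⟨fun A B => ⟨A.1 + B.1, by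
  obtain ⟨N, hA⟩ := A.2
  obtain ⟨M, hB⟩ := B.2
  exact ⟨max N M, ordLE_add (hA.mono (le_max_left _ _)) (hB.mono (le_max_right _ _))⟩⟩⟩

instance : Neg (PDO K) := ⟨fun A => ⟨-A.1, by
  obtain ⟨N, hA⟩ := A.2
  exact ⟨N, fun l hl => by rw [Pi.neg_apply, hA l hl, neg_zero]⟩⟩⟩

instance : Mul (PDO K) := ⟨fun A B => ⟨psMul A.1 B.1, by
  obtain ⟨N, hA⟩ := A.2
  obtain ⟨M, hB⟩ := B.2
  exact ⟨N + M, hA.psMul hB⟩⟩⟩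

lemma ordLE_one : OrdLE 0 (psOne : ℤ → TimeSeries K) := fun l hl => if_neg (by omega)

instance : One (PDO K) := ⟨⟨psOne, 0, ordLE_one⟩⟩

@[simp] lemma add_apply (A B : PDO K) (l : ℤ) : (A + B) l = A l + B l := rfl
@[simp] lemma neg_apply (A : PDO K) (l : ℤ) : (-A) l = -A l := rfl
@[simp] lemma zero_apply (l : ℤ) : (0 : PDO K) l = 0 := rfl
lemma one_apply (l : ℤ) : (1 : PDO K) l = if l = 0 then 1 else 0 := rfl
lemma one_val : (1 : PDO K).1 = psOne := rfl
lemma mul_val (A B : PDO K) : (A * B).1 = psMul A.1 B.1 := rfl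

lemma mul_apply_eq_sum {A B : PDO K} {N M lo hi l : ℤ} {n : ℕ} (hA : OrdLE N A.1)
    (hB : OrdLE M B.1) (hlo : lo ≤ l - M) (hhi : N ≤ hi) (hn : N + M - l < n) :
    (A * B) l = ∑ i ∈ Finset.Icc lo hi, ∑ k ∈ Finset.range n,
      Ring.choose i k • (A i * (dt 1)^[k] (B (l + k - i))) := psMul_eq_sum hA hB hlo hhi hn

lemma ordLE_mul {A B : PDO K} {N M : ℤ} (hA : OrdLE N A.1) (hB : OrdLE M B.1) :
    OrdLE (N + M) (A * B).1 := OrdLE.psMul hA hB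

/-- The operator `a ∂ⁱ`. -/
def mono (i : ℤ) (a : TimeSeries K) : PDO K :=
  ⟨fun l => if l = i then a else 0, i, fun l hl => if_neg (by omega)⟩

lemma mono_apply (i : ℤ) (a : TimeSeries K) (l : ℤ) : mono i a l = if l = i then a else 0 := rfl

lemma ordLE_mono (i : ℤ) (a : TimeSeries K) : OrdLE i (mono i a).1 := fun l hl => if_neg (by omega)

lemma mono_mul_apply (i : ℤ) (a : TimeSeries K) {B : PDO K} {M l : ℤ} {n : ℕ} (hB : OrdLE M B.1)
    (hn : i + M - l < n) : (mono i a * B) l =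
      ∑ k ∈ Finset.range n, Ring.choose i k • (a * (dt 1)^[k] (B (l + k - i))) := by
  rw [mul_apply_eq_sum (lo := min (l - M) i) (ordLE_mono i a) hB (min_le_left _ _) le_rfl hn,
    Finset.sum_eq_single i]
  · simp only [mono_apply, if_pos]
  · intro j _ hj
    simp only [mono_apply, if_neg hj, zero_mul, smul_zero, Finset.sum_const_zero]
  · intro h
    exact absurd (Finset.mem_Icc.mpr ⟨min_le_right _ _, le_rfl⟩) h

lemma mul_mono_apply (m : ℤ) (c : TimeSeries K) {A : PDO K} {N l : ℤ} {n : ℕ} (hA : OrdLE N A.1)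
    (hn : N + m - l < n) : (A * mono m c) l =
      ∑ k ∈ Finset.range n, Ring.choose (l + k - m) k • (A (l + k - m) * (dt 1)^[k] c) := by
  rw [mul_apply_eq_sum (hi := N + n) (lo := l - m) hA (ordLE_mono m c) le_rfl (by omega) hn,
    Finset.sum_comm]
  refine Finset.sum_congr rfl fun k hk => ?_
  rw [Finset.mem_range] at hk
  by_cases hmem : l + k - m ≤ N + n
  · rw [Finset.sum_eq_single (l + k - m)]
    · rw [mono_apply, if_pos (by ring)]
    · intro j _ hj
      rw [mono_apply, if_neg (by omega), dt_iter_zero, mul_zero, smul_zero]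
    · intro h
      exact absurd (Finset.mem_Icc.mpr ⟨by omega, hmem⟩) h
  · rw [Finset.sum_eq_zero, hA _ (by omega), zero_mul, smul_zero]
    intro j hj
    rw [Finset.mem_Icc] at hj
    rw [mono_apply, if_neg (by omega), dt_iter_zero, mul_zero, smul_zero]

lemma mono_mul_mono_apply (i j : ℤ) (a b : TimeSeries K) (r : ℕ) :
    (mono i a * mono j b) (i + j - r) = Ring.choose i r • (a * (dt 1)^[r] b) := by
  rw [mono_mul_apply (n := r + 1) i a (ordLE_mono j b) (by push_cast; omega),
    Finset.sum_eq_single r]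
  · rw [mono_apply, if_pos (by ring)]
  · intro k _ hk
    rw [mono_apply, if_neg (by omega), dt_iter_zero, mul_zero, smul_zero]
  · simp

protected lemma add_mul (A B C : PDO K) : (A + B) * C = A * C + B * C := by
  obtain ⟨N₁, hA⟩ := A.2
  obtain ⟨N₂, hB⟩ := B.2
  obtain ⟨N₃, hC⟩ := C.2
  have hA := hA.mono (le_max_left N₁ N₂)
  have hB := hB.mono (le_max_right N₁ N₂)
  have hAB : OrdLE (max N₁ N₂) (A + B).1 := ordLE_add hA hB
  refine ext fun l => ?_
  have hn : max N₁ N₂ + N₃ - l < ((max N₁ N₂ + N₃ - l).toNat + 1 : ℕ) := by push_cast; omega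
  rw [add_apply, mul_apply_eq_sum hAB hC le_rfl le_rfl hn, mul_apply_eq_sum hA hC le_rfl le_rfl hn,
    mul_apply_eq_sum hB hC le_rfl le_rfl hn]
  simp only [← Finset.sum_add_distrib, add_apply, add_mul, smul_add]

protected lemma mul_add (A B C : PDO K) : A * (B + C) = A * B + A * C := by
  obtain ⟨N₁, hA⟩ := A.2
  obtain ⟨N₂, hB⟩ := B.2
  obtain ⟨N₃, hC⟩ := C.2
  have hB := hB.mono (le_max_left N₂ N₃)
  have hC := hC.mono (le_max_right N₂ N₃)
  have hBC : OrdLE (max N₂ N₃) (B + C).1 := ordLE_add hB hC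
  refine ext fun l => ?_
  have hn : N₁ + max N₂ N₃ - l < ((N₁ + max N₂ N₃ - l).toNat + 1 : ℕ) := by push_cast; omega
  rw [add_apply, mul_apply_eq_sum hA hBC le_rfl le_rfl hn, mul_apply_eq_sum hA hB le_rfl le_rfl hn,
    mul_apply_eq_sum hA hC le_rfl le_rfl hn]
  simp only [← Finset.sum_add_distrib, add_apply, dt_iter_add, mul_add, smul_add]

/-- An additive property of operators holds if it holds for operators of sufficiently low order
and for the operators `a ∂ⁱ`. -/
lemma induction_mono (c : ℤ) {P : PDO K → Prop} (hlow : ∀ A : PDO K, OrdLE c A.1 → P A)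
    (hmono : ∀ i a, P (mono i a)) (hadd : ∀ A B, P A → P B → P (A + B)) (A : PDO K) : P A := by
  have key : ∀ n : ℕ, ∀ A : PDO K, OrdLE (c + n) A.1 → P A := by
    intro n
    induction n with
    | zero => exact fun A hA => hlow A (by simpa using hA)
    | succ n ih =>
      intro A hA
      let B : PDO K := ⟨fun l => if l = c + n + 1 then 0 else A l, c + n, fun l hl => by
        dsimp only
        split_ifs with h
        · rfl
        · exact hA l (by push_cast; omega)⟩
      have hB : OrdLE (c + n) B.1 := fun l hl => by
        change (if l = c + n + 1 then 0 else A l) = 0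
        split_ifs with h
        · rfl
        · exact hA l (by push_cast; omega)
      have : A = mono (c + n + 1) (A (c + n + 1)) + B := by
        refine ext fun l => ?_
        rw [add_apply, mono_apply]
        change A l = _ + if l = c + n + 1 then 0 else A l
        split_ifs with h
        · rw [h, add_zero]
        · rw [zero_add]
      rw [this]
      exact hadd _ _ (hmono _ _) (ih B hB)
  obtain ⟨N, hN⟩ := A.2
  exact key (N - c).toNat A (hN.mono (by omega))

/-- Both sides become sums over triples x + y + q = s of multiples of a·∂ˣ(b)·∂^{y+q}(c). On the
left, Vandermonde splits the binomial of i + j - x, and `choose_add_mul_choose` recombines one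
factor with binom(i, x); on the right, the triples come from the Leibniz rule. -/
lemma mono_assoc (i j m : ℤ) (a b c : TimeSeries K) :
    (mono i a * mono j b) * mono m c = mono i a * (mono j b * mono m c) := by
  have hij := ordLE_mul (ordLE_mono i a) (ordLE_mono j b)
  have hjm := ordLE_mul (ordLE_mono j b) (ordLE_mono m c)
  refine ext fun l => ?_
  rcases lt_or_ge (i + j + m) l with hl | hl
  · rw [ordLE_mul hij (ordLE_mono m c) l hl,
      ordLE_mul (ordLE_mono i a) hjm l (by omega)]
  obtain ⟨s, rfl⟩ : ∃ s : ℕ, l = i + j + m - s := ⟨(i + j + m - l).toNat, by omega⟩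
  rw [mul_mono_apply (n := s + 1) m c hij (by push_cast; omega),
    mono_mul_apply (n := s + 1) i a hjm (by push_cast; omega)]
  have hL : ∀ k ∈ Finset.range (s + 1), Ring.choose (i + j + m - s + k - m) k •
      ((mono i a * mono j b) (i + j + m - s + k - m) * (dt 1)^[k] c) =
      ∑ x ∈ Finset.HasAntidiagonal.antidiagonal k,
        (Ring.choose i ((s - k) + x.1) * (((s - k) + x.1).choose (s - k) : ℤ) *
          Ring.choose j x.2) •
            (a * (dt 1)^[s - k] b * (dt 1)^[k] c) := by
    intro k hk
    rw [Finset.mem_range] at hk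
    have e : i + j + m - s + k - m = i + j - (s - k : ℕ) := by omega
    rw [e, mono_mul_mono_apply, ← Finset.sum_smul]
    simp only [choose_add_mul_choose, mul_assoc]
    rw [← Finset.mul_sum, ← vandermonde, smul_mul_assoc, smul_smul, mul_comm,
      show i - ((s - k : ℕ) : ℤ) + j = i + j - ((s - k : ℕ) : ℤ) by ring, mul_assoc]
  have hR : ∀ k ∈ Finset.range (s + 1), Ring.choose i k •
      (a * (dt 1)^[k] ((mono j b * mono m c) (i + j + m - s + k - i))) =
      ∑ x ∈ Finset.HasAntidiagonal.antidiagonal k,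
        (Ring.choose i (x.1 + x.2) * ((x.1 + x.2).choose x.1 : ℤ) * Ring.choose j (s - k)) •
          (a * (dt 1)^[x.1] b * (dt 1)^[x.2 + (s - k)] c) := by
    intro k hk
    rw [Finset.mem_range] at hk
    have e : i + j + m - s + k - i = j + m - (s - k : ℕ) := by omega
    rw [e, mono_mul_mono_apply, dt_iter_zsmul, dt_iter_mul, Finset.smul_sum, Finset.mul_sum,
      Finset.smul_sum]
    refine Finset.sum_congr rfl fun x hx => ?_
    rw [Finset.HasAntidiagonal.mem_antidiagonal.mp hx, ← Function.iterate_add_apply]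
    simp only [mul_smul_comm, smul_smul, mul_assoc]
    congr 1
    ring
  rw [Finset.sum_congr rfl hL, Finset.sum_congr rfl hR,
    ← Finset.Nat.sum_antidiagonal_eq_sum_range_succ (fun k q =>
      ∑ x ∈ Finset.HasAntidiagonal.antidiagonal k,
        (Ring.choose i (x.1 + x.2) * ((x.1 + x.2).choose x.1 : ℤ) * Ring.choose j q) •
          (a * (dt 1)^[x.1] b * (dt 1)^[x.2 + q] c)),
    ← Finset.Nat.sum_antidiagonal_eq_sum_range_succ (fun k q =>
      ∑ x ∈ Finset.HasAntidiagonal.antidiagonal k,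
        (Ring.choose i (q + x.1) * ((q + x.1).choose q : ℤ) * Ring.choose j x.2) •
            (a * (dt 1)^[q] b * (dt 1)^[k] c)),
    sum_antidiagonal_assoc (fun x y q => (Ring.choose i (x + y) * ((x + y).choose x : ℤ) *
      Ring.choose j q) • (a * (dt 1)^[x] b * (dt 1)^[y + q] c)),
    ← Finset.Nat.sum_antidiagonal_swap]
  refine Finset.sum_congr rfl fun p _ => Finset.sum_congr rfl fun x hx => ?_
  rw [Finset.HasAntidiagonal.mem_antidiagonal.mp hx]
  rfl

protected lemma mul_assoc (A B C : PDO K) : A * B * C = A * (B * C) := by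
  obtain ⟨N₁, hA⟩ := A.2
  obtain ⟨N₂, hB⟩ := B.2
  obtain ⟨N₃, hC⟩ := C.2
  refine ext fun l => ?_
  -- If `A` has order at most this threshold, both triple products have order below `l`. Hence the
  -- coefficient at `l` only sees finitely many monomials of each factor.
  refine induction_mono (l - N₂ - N₃ - 1) (P := fun A => (A * B * C) l = (A * (B * C)) l)
    ?_ ?_ ?_ A
  · intro A hA
    rw [ordLE_mul (ordLE_mul hA hB) hC l (by omega), ordLE_mul hA (ordLE_mul hB hC) l (by omega)]
  · intro i a
    refine induction_mono (l - i - N₃ - 1)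
      (P := fun B => (mono i a * B * C) l = (mono i a * (B * C)) l) ?_ ?_ ?_ B
    · intro B hB
      rw [ordLE_mul (ordLE_mul (ordLE_mono i a) hB) hC l (by omega),
        ordLE_mul (ordLE_mono i a) (ordLE_mul hB hC) l (by omega)]
    · intro j b
      refine induction_mono (l - i - j - 1)
        (P := fun C => (mono i a * mono j b * C) l = (mono i a * (mono j b * C)) l) ?_ ?_ ?_ C
      · intro C hC
        rw [ordLE_mul (ordLE_mul (ordLE_mono i a) (ordLE_mono j b)) hC l (by omega),
          ordLE_mul (ordLE_mono i a) (ordLE_mul (ordLE_mono j b) hC) l (by omega)]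
      · intro m c
        rw [mono_assoc]
      · intro C C' h h'
        simp only [PDO.mul_add, add_apply, h, h']
    · intro B B' h h'
      simp only [PDO.mul_add, PDO.add_mul, add_apply, h, h']
  · intro A A' h h'
    simp only [PDO.add_mul, add_apply, h, h']

lemma one_eq_mono : (1 : PDO K) = mono 0 1 := rfl

lemma mono_zero_mul_apply (a : TimeSeries K) (B : PDO K) (l : ℤ) : (mono 0 a * B) l = a * B l := by
  obtain ⟨M, hB⟩ := B.2
  rw [mono_mul_apply (n := (M - l).toNat + 1) 0 a hB (by push_cast; omega),
    Finset.sum_eq_single 0]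
  · simp
  · intro k _ hk
    rw [Ring.choose_zero_pos ℤ (Nat.pos_of_ne_zero hk), zero_smul]
  · simp

/-- Constants have no derivatives, so right multiplication by ∂ᵐ only shifts; on P e^ξ it is
multiplication by zᵐ. -/
lemma mul_mono_one_apply (A : PDO K) (m l : ℤ) : (A * mono m 1 : PDO K) l = A (l - m) := by
  obtain ⟨N, hA⟩ := A.2
  rw [mul_mono_apply (n := (N + m - l).toNat + 1) m 1 hA (by push_cast; omega),
    Finset.sum_eq_single 0]
  · simp
  · intro k _ hk
    obtain ⟨k, rfl⟩ := Nat.exists_eq_succ_of_ne_zero hk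
    rw [Function.iterate_succ_apply, dt_one, dt_iter_zero, mul_zero, smul_zero]
  · simp

instance : Ring (PDO K) where
  add_assoc A B C := ext fun l => add_assoc _ _ _
  zero_add A := ext fun l => zero_add _
  add_zero A := ext fun l => add_zero _
  add_comm A B := ext fun l => add_comm _ _
  neg_add_cancel A := ext fun l => neg_add_cancel _
  nsmul := nsmulRec
  mul_assoc := PDO.mul_assoc
  left_distrib := PDO.mul_add
  right_distrib := PDO.add_mul
  zero_mul A := ext fun l => by
    obtain ⟨N, hA⟩ := A.2
    -- The zero operator has every order, and this choice pushes the product below `l`.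
    exact ordLE_mul (N := l - N - 1) (A := 0) (fun _ _ => rfl) hA l (by omega)
  mul_zero A := ext fun l => by
    obtain ⟨N, hA⟩ := A.2
    exact ordLE_mul (M := l - N - 1) (B := 0) hA (fun _ _ => rfl) l (by omega)
  one_mul A := ext fun l => by rw [one_eq_mono, mono_zero_mul_apply, one_mul]
  mul_one A := ext fun l => by rw [one_eq_mono, mul_mono_one_apply, sub_zero]
  zsmul := zsmulRec

@[simp] lemma sub_apply (A B : PDO K) (l : ℤ) : (A - B) l = A l - B l := by
  rw [sub_eq_add_neg, sub_eq_add_neg]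
  rfl

lemma sum_apply {ι : Type*} (s : Finset ι) (A : ι → PDO K) (l : ℤ) :
    (∑ i ∈ s, A i) l = ∑ i ∈ s, A i l := by
  classical
  induction s using Finset.induction_on with
  | empty => rfl
  | insert i s hi ih => rw [Finset.sum_insert hi, Finset.sum_insert hi, add_apply, ih]

lemma psPow_val (A : PDO K) (n : ℕ) : psPow A.1 n = (A ^ n).1 := by
  induction n with
  | zero => rw [pow_zero, one_val]; rfl
  | succ n ih => rw [pow_succ', mul_val, ← ih]; rfl

lemma der_mul_apply (B : PDO K) (l : ℤ) : (mono 1 1 * B : PDO K) l = dt 1 (B l) + B (l - 1) := by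
  obtain ⟨M, hB⟩ := B.2
  rw [mono_mul_apply (n := (1 + M - l).toNat + 2) 1 1 hB (by push_cast; omega),
    Finset.sum_range_succ', Finset.sum_range_succ', Finset.sum_eq_zero]
  · simp
  · intro k _
    have : Ring.choose (1 : ℤ) (k + 1 + 1) = 0 := by
      have := Ring.choose_natCast (R := ℤ) 1 (k + 1 + 1)
      rw [Nat.choose_eq_zero_of_lt (by omega)] at this
      simpa using this
    rw [this, zero_smul]

lemma mul_apply_top {A B : PDO K} {N M : ℤ} (hA : OrdLE N A.1) (hB : OrdLE M B.1) :
    (A * B) (N + M) = A N * B M := by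
  rw [mul_apply_eq_sum (n := 1) (lo := N) hA hB (by omega) le_rfl (by push_cast; omega)]
  simp

lemma mono_one_pow (n : ℕ) : (mono 1 1 : PDO K) ^ n = mono n 1 := by
  induction n with
  | zero => rw [pow_zero, one_eq_mono]; rfl
  | succ n ih =>
    refine ext fun l => ?_
    rw [pow_succ, ih, mul_mono_one_apply, mono_apply, mono_apply]
    push_cast
    simp only [sub_eq_iff_eq_add]

/-- The differential part. -/
def plus (A : PDO K) : PDO K := ⟨psPlus A.1, by
  obtain ⟨N, hA⟩ := A.2
  exact ⟨N, fun l hl => by rw [psPlus, hA l hl, ite_self]⟩⟩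

/-- Differential operators. -/
def IsDiff (A : PDO K) : Prop := ∀ l, l < 0 → A l = 0

lemma IsDiff.mono_zero_mul {A : PDO K} (hA : IsDiff A) (a : TimeSeries K) :
    IsDiff (mono 0 a * A) := fun l hl => by rw [mono_zero_mul_apply, hA l hl, mul_zero]

lemma IsDiff.sum {ι : Type*} {s : Finset ι} {A : ι → PDO K} (h : ∀ i ∈ s, IsDiff (A i)) :
    IsDiff (∑ i ∈ s, A i) := fun l hl => by
  rw [sum_apply]
  exact Finset.sum_eq_zero fun i hi => h i hi l hl

/-- Uniqueness of the splitting into a differential operator and one of negative order. -/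
lemma psPlus_eq_of_eq_add {A B C : PDO K} (h : A = B + C) (hB : IsDiff B) (hC : OrdLE (-1) C.1) :
    psPlus A.1 = B.1 := by
  funext l
  rw [psPlus, h, add_apply]
  split_ifs with hl
  · rw [hC l (by omega), add_zero]
  · rw [hB l (by omega)]

/-- An operator is differential if it starts a sequence of operators with vanishing residues that
is closed under composition with `∂` up to multiplication by functions. -/
lemma isDiff_of_residue {X : ℕ → PDO K} (hres : ∀ k, X k (-1) = 0)
    (hX : ∀ k, ∃ b c, mono 1 1 * X k = mono 0 b * X (k + 1) + mono 0 c * X k) (k : ℕ) :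
    IsDiff (X k) := by
  -- Compare coefficients of ∂^{-1-j} in the relation: the known vanishing leaves only `X k (-2 -
  -- j)`, contributed by ∂ acting on ∂^{-2-j}.
  have key : ∀ j k : ℕ, X k (-1 - j) = 0 := by
    intro j
    induction j with
    | zero => simpa using hres
    | succ j ih =>
      intro k
      obtain ⟨b, c, h⟩ := hX k
      have := congrArg (fun A : PDO K => A (-1 - j)) h
      simp only [der_mul_apply, add_apply, mono_zero_mul_apply, ih, dt_zero, mul_zero, add_zero,
        zero_add] at this
      rw [← this]
      congr 1
      push_cast
      ring
  intro l hl
  have := key (-1 - l).toNat k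
  rwa [show (-1 : ℤ) - ((-1 - l).toNat : ℤ) = l by omega] at this

lemma eq_one_of_isDiff {A : PDO K} (h : IsDiff A) (hA : OrdLE 0 A.1) (h1 : A 0 = 1) : A = 1 := by
  refine ext fun l => ?_
  rw [one_apply]
  split_ifs with hl
  · rw [hl, h1]
  · rcases lt_or_gt_of_ne hl with h' | h'
    · exact h l h'
    · exact hA l h'

/-- From A(A - 1) = 0 and the leading coefficient 1 of A, the leading coefficient of A - 1 vanishes
at every order in turn. -/
lemma eq_one_of_isIdempotent {A : PDO K} (h : A * A = A) (hA : OrdLE 0 A.1) (h1 : A 0 = 1) :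
    A = 1 := by
  by_contra hne
  have key : ∀ n : ℕ, OrdLE (-n) (A - 1).1 := by
    intro n
    induction n with
    | zero =>
      intro l hl
      rw [sub_apply, hA l (by simpa using hl), one_apply, if_neg (by push_cast at hl; omega),
        sub_zero]
    | succ n ih =>
      have hz : A * (A - 1) = 0 := by rw [mul_sub, h, mul_one, sub_self]
      intro l hl
      rcases lt_or_ge (-(n : ℤ)) l with h' | h'
      · exact ih l h'
      · obtain rfl : l = 0 + -(n : ℤ) := by push_cast at hl; omega
        have := mul_apply_top hA ih
        rw [hz, h1, one_mul, zero_apply] at this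
        rw [zero_add]
        exact this.symm
  refine hne (sub_eq_zero.mp (ext fun l => ?_))
  exact key ((-l).toNat + 1) l (by push_cast; omega)

/-- A right inverse of an operator is a left inverse, provided that the leading terms match. -/
lemma mul_eq_one_comm_of_leading {A B : PDO K} {N : ℤ} (hA : OrdLE N A.1) (hB : OrdLE (-N) B.1)
    (h : A * B = 1) (hlead : A N * B (-N) = 1) : B * A = 1 := by
  -- B A is idempotent since A B = 1, and its leading coefficient is 1 since coefficients commute.
  refine eq_one_of_isIdempotent ?_ ?_ ?_
  · rw [mul_assoc, ← mul_assoc A, h, one_mul]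
  · simpa using ordLE_mul hB hA
  · have := mul_apply_top hB hA
    rw [neg_add_cancel] at this
    rw [this, mul_comm, hlead]

lemma psAdjoint_eq_sum {A : ℤ → TimeSeries K} {N l : ℤ} {n : ℕ} (hA : OrdLE N A)
    (hn : N - l < n) : psAdjoint A l = ∑ k ∈ Finset.range n, (Int.negOnePow (l + k) : ℤ) •
      (Ring.choose (l + k) k • ((dt 1)^[k] (A (l + k)))) := by
  refine finsum_eq_sum_of_support_subset _ fun k hk => ?_
  by_contra hcon
  simp only [Finset.coe_range, Set.mem_Iio, not_lt] at hcon
  refine hk ?_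
  dsimp only
  rw [hA _ (by omega), dt_iter_zero, smul_zero, smul_zero]

lemma ordLE_psAdjoint {A : ℤ → TimeSeries K} {N : ℤ} (hA : OrdLE N A) : OrdLE N (psAdjoint A) :=
  fun l hl => by
    rw [psAdjoint_eq_sum (n := 0) hA (by push_cast; omega), Finset.range_zero, Finset.sum_empty]

/-- The formal adjoint. -/
def adj (A : PDO K) : PDO K := ⟨psAdjoint A.1, by
  obtain ⟨N, hA⟩ := A.2
  exact ⟨N, ordLE_psAdjoint hA⟩⟩

lemma adj_apply_top {A : PDO K} {N : ℤ} (hA : OrdLE N A.1) :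
    adj A N = (Int.negOnePow N : ℤ) • A N := by
  refine (psAdjoint_eq_sum (n := 1) hA (by push_cast; omega)).trans ?_
  simp

/-- The operator residue equals the residue of the symbols: by Vandermonde, the terms with s ≥ 1
derivatives of B have total coefficient binom(i + (s - 1 - i), s) = binom(s - 1, s) = 0. -/
theorem residue_mul_adj {A B : PDO K} {N M lo : ℤ} (hA : OrdLE N A.1) (hB : OrdLE M B.1)
    (hlo : lo ≤ -1 - M) : (A * adj B) (-1) =
      ∑ i ∈ Finset.Icc lo N, (Int.negOnePow (-1 - i) : ℤ) • (A i * B (-1 - i)) := by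
  have hn : N + M - (-1) < ((N + M + 1).toNat + 1 : ℕ) := by push_cast; omega
  rw [mul_apply_eq_sum hA (ordLE_psAdjoint hB : OrdLE M (adj B).1) hlo le_rfl hn]
  refine Finset.sum_congr rfl fun i hi => ?_
  rw [Finset.mem_Icc] at hi
  set n : ℕ := (N + M + 1).toNat + 1
  have h1 : ∀ k ∈ Finset.range n, Ring.choose i k • (A i * (dt 1)^[k] (adj B (-1 + k - i))) =
      ∑ r ∈ Finset.range (n - k), (Ring.choose i k * Ring.choose (((k + r : ℕ) : ℤ) - 1 - i) r) •
        ((Int.negOnePow (((k + r : ℕ) : ℤ) - 1 - i) : ℤ) •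
          (A i * (dt 1)^[k + r] (B (((k + r : ℕ) : ℤ) - 1 - i)))) := by
    intro k hk
    rw [Finset.mem_range] at hk
    change Ring.choose i k • (A i * (dt 1)^[k] (psAdjoint B.1 (-1 + k - i))) = _
    rw [psAdjoint_eq_sum (n := n - k) hB (by omega), dt_iter_sum, Finset.mul_sum,
      Finset.smul_sum]
    refine Finset.sum_congr rfl fun r _ => ?_
    rw [dt_iter_zsmul, dt_iter_zsmul, ← Function.iterate_add_apply,
      show -1 + (k : ℤ) - i + r = ((k + r : ℕ) : ℤ) - 1 - i by push_cast; ring]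
    simp only [mul_smul_comm, smul_smul]
    congr 1
    ring
  rw [Finset.sum_congr rfl h1, ← Finset.sum_range_diag_flip n (fun k r =>
    (Ring.choose i k * Ring.choose (((k + r : ℕ) : ℤ) - 1 - i) r) •
        ((Int.negOnePow (((k + r : ℕ) : ℤ) - 1 - i) : ℤ) •
          (A i * (dt 1)^[k + r] (B (((k + r : ℕ) : ℤ) - 1 - i))))),
    Finset.sum_eq_single 0]
  · simp
  · intro s _ hs
    have h2 : ∀ k ∈ Finset.range (s + 1),
        (Ring.choose i k * Ring.choose (((k + (s - k) : ℕ) : ℤ) - 1 - i) (s - k)) •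
        ((Int.negOnePow (((k + (s - k) : ℕ) : ℤ) - 1 - i) : ℤ) •
          (A i * (dt 1)^[k + (s - k)] (B (((k + (s - k) : ℕ) : ℤ) - 1 - i)))) =
        (Ring.choose i k * Ring.choose ((s : ℤ) - 1 - i) (s - k)) •
        ((Int.negOnePow ((s : ℤ) - 1 - i) : ℤ) •
          (A i * (dt 1)^[s] (B ((s : ℤ) - 1 - i)))) := by
      intro k hk
      rw [Finset.mem_range] at hk
      rw [show k + (s - k) = s by omega]
    rw [Finset.sum_congr rfl h2, ← Finset.sum_smul,
      ← Finset.Nat.sum_antidiagonal_eq_sum_range_succ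
        (fun k r => Ring.choose i k * Ring.choose ((s : ℤ) - 1 - i) r), ← vandermonde]
    have h3 : Ring.choose (i + ((s : ℤ) - 1 - i)) s = 0 := by
      obtain ⟨s, rfl⟩ := Nat.exists_eq_succ_of_ne_zero hs
      have := Ring.choose_natCast (R := ℤ) s (s + 1)
      rw [Nat.choose_succ_self] at this
      rw [show i + (((s.succ : ℕ) : ℤ) - 1 - i) = (s : ℤ) by push_cast; ring]
      simpa using this
    rw [h3, zero_smul]
  · intro h
    exact absurd (Finset.mem_range.mpr (Nat.succ_pos _)) h

end PDO

end PseudoDifferential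

/-! ### Dressing by a unitriangular matrix, Sato equations and Lax equations -/

section Dressing

variable {K : Type*} [CommRing K]

open BMat

/-- `L = w S w⁻¹` with the shift matrix `S` and a lower unitriangular matrix `w` with inverse
`v`. -/
structure IsDressed (L w v : BMat K) : Prop where
  left : LowerUnitriangular w
  right : LowerUnitriangular v
  mul_inv : w * v = 1
  inv_mul : v * w = 1
  eq : L = w * shift * v

/-- The evolution equations `∂ₖ w + w Sᵏ = (Lᵏ)₊ w`. -/
def Evolves (L w : BMat K) : Prop :=
  ∀ k : ℕ+, deriv k w + w * shift ^ (k : ℕ) = plus (L ^ (k : ℕ)) * w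

/-- The column `m` of `w⁻¹`, as a dual oscillating function. -/
def dualColumn (v : BMat K) (m : ℤ) : ℤ → TimeSeries K := fun j => v (-j - 1) (m - 1)

/-- Only rows of B with index at least `i` enter. This keeps the range n ≥ m of the bilinear
relations stable under the flows. -/
lemma BMat.Upper.mul_apply_eq_sum {U : BMat K} {N : ℤ} (hU : Upper U) (hN : VanishesAbove N U.1)
    (B : BMat K) (i j : ℤ) : (U * B) i j = ∑ k ∈ Finset.Icc i (i + N), U i k * B k j := by
  rw [BMat.mul_apply]
  refine finsum_eq_sum_of_support_subset _ fun k hk => ?_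
  rw [Finset.coe_Icc, Set.mem_Icc]
  by_contra hcon
  refine hk ?_
  dsimp only
  rcases lt_or_ge k i with h | h
  · rw [hU _ _ h, zero_mul]
  · rw [hN _ _ (by by_contra; exact hcon ⟨h, by omega⟩), zero_mul]

lemma BMat.Upper.apply_mul_eq_sum {U : BMat K} {N : ℤ} (hU : Upper U) (hN : VanishesAbove N U.1)
    (B : BMat K) (i j : ℤ) : (B * U) i j = ∑ k ∈ Finset.Icc (j - N) j, B i k * U k j := by
  rw [BMat.mul_apply]
  refine finsum_eq_sum_of_support_subset _ fun k hk => ?_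
  rw [Finset.coe_Icc, Set.mem_Icc]
  by_contra hcon
  refine hk ?_
  dsimp only
  rcases lt_or_ge j k with h | h
  · rw [hU _ _ h, mul_zero]
  · rw [hN _ _ (by by_contra; exact hcon ⟨by omega, h⟩), mul_zero]

lemma BMat.LowerUnitriangular.strictLower_deriv {w : BMat K} (hw : LowerUnitriangular w) (k : ℕ+) :
    StrictLower (deriv k w) := by
  intro i j hij
  rw [deriv_apply]
  rcases hij.lt_or_eq with h | rfl
  · rw [hw.1 _ _ (by omega), dt_zero]
  · rw [hw.2, dt_one]

lemma BMat.vanishesAbove_shift : VanishesAbove 1 (shift : BMat K).1 := fun _ _ _ =>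
  if_neg (by omega)

lemma diagPairing_comm (φ ψ : ℤ → TimeSeries K) : diagPairing φ ψ = diagPairing ψ φ := by
  refine finsum_eq_of_bijective (fun l : ℤ => -1 - l) (Equiv.subLeft _).bijective fun l => ?_
  rw [sub_sub_cancel, mul_comm]

/-- The offset `-j - 1` in `dualColumn` undoes the reflection l ↦ -1 - l of the residue, which
becomes a matrix product. -/
lemma diagPairing_dualColumn (A v : BMat K) (n m : ℤ) :
    diagPairing (A n) (dualColumn v m) = (A * v) n (m - 1) := by
  rw [BMat.mul_apply]
  refine finsum_congr fun l => ?_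
  rw [dualColumn]
  congr 2
  ring

/-- The factor zᵏ produced by differentiating e^ξ shifts columns, as Sᵏ on the right does. -/
lemma oscDeriv_row (w : BMat K) (k : ℕ+) (n : ℤ) :
    oscDeriv k (w n) = (deriv k w + w * shift ^ (k : ℕ) : BMat K) n := by
  funext j
  rw [BMat.add_apply, mul_shift_pow_apply]
  rfl

lemma dualDeriv_dualColumn (v : BMat K) (k : ℕ+) (m j : ℤ) :
    dualDeriv k (dualColumn v m) j =
      (deriv k v - shift ^ (k : ℕ) * v : BMat K) (-j - 1) (m - 1) := by
  rw [BMat.sub_apply, shift_pow_mul_apply, dualDeriv, dualColumn, dualColumn, deriv_apply]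
  congr 2
  ring

namespace IsDressed

variable {L w v : BMat K}

lemma pow_eq (h : IsDressed L w v) (k : ℕ) : L ^ k = w * shift ^ k * v := by
  induction k with
  | zero => rw [pow_zero, pow_zero, mul_one, h.mul_inv]
  | succ k ih =>
    calc L ^ (k + 1) = w * shift ^ k * (v * w) * shift * v := by
          rw [pow_succ, ih, h.eq]; simp only [mul_assoc]
      _ = w * shift ^ (k + 1) * v := by rw [h.inv_mul, mul_one, pow_succ]; simp only [mul_assoc]

lemma pow_mul (h : IsDressed L w v) (k : ℕ) : L ^ k * w = w * shift ^ k := by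
  rw [h.pow_eq, mul_assoc, h.inv_mul, mul_one]

lemma mul_pow (h : IsDressed L w v) (k : ℕ) : v * L ^ k = shift ^ k * v := by
  rw [h.pow_eq, ← mul_assoc, ← mul_assoc, h.inv_mul, one_mul]

/-- Lᵏ = wSᵏv = (∂ₖw + wSᵏ)v - (∂ₖw)v. The last term is strictly lower triangular because `w` has
constant diagonal, so an upper triangular first term must be (Lᵏ)₊. -/
lemma evolves_of_upper (h : IsDressed L w v)
    (hup : ∀ k : ℕ+, Upper ((deriv k w + w * shift ^ (k : ℕ)) * v)) : Evolves L w := by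
  intro k
  have h1 : L ^ (k : ℕ) = (deriv k w + w * shift ^ (k : ℕ)) * v + (-deriv k w) * v := by
    rw [h.pow_eq, add_mul, neg_mul]; abel
  have hs : StrictLower ((-deriv k w) * v) := by
    refine StrictLower.mul_of_vanishesAbove (fun i j hij => ?_) h.right.1
    rw [BMat.neg_apply, h.left.strictLower_deriv k i j hij, neg_zero]
  have h2 := minus_eq_of_eq_add h1 (hup k) hs
  have h3 : plus (L ^ (k : ℕ)) = (deriv k w + w * shift ^ (k : ℕ)) * v := by
    have := plus_add_minus (L ^ (k : ℕ))
    rw [h2] at this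
    nth_rw 2 [h1] at this
    exact add_right_cancel this
  rw [h3, mul_assoc, h.inv_mul, mul_one]

/-- The dual evolution equation, from differentiating vw = 1. -/
lemma deriv_inv (h : IsDressed L w v) (hw : Evolves L w) (k : ℕ+) :
    deriv k v - shift ^ (k : ℕ) * v = -(v * plus (L ^ (k : ℕ))) := by
  have h1 : deriv k v * w + v * deriv k w = 0 := by
    rw [← BMat.deriv_mul, h.inv_mul, BMat.deriv_one]
  have h2 : deriv k w = plus (L ^ (k : ℕ)) * w - w * shift ^ (k : ℕ) := by
    rw [← hw k]; abel
  have h3 : deriv k v = -(v * deriv k w * v) := by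
    calc deriv k v = deriv k v * (w * v) := by rw [h.mul_inv, mul_one]
      _ = (deriv k v * w + v * deriv k w) * v - v * deriv k w * v := by noncomm_ring
      _ = _ := by rw [h1]; noncomm_ring
  have h4 : v * (plus (L ^ (k : ℕ)) * w - w * shift ^ (k : ℕ)) * v =
      v * plus (L ^ (k : ℕ)) * (w * v) - (v * w) * shift ^ (k : ℕ) * v := by
    simp only [mul_sub, sub_mul, mul_assoc]
  rw [h3, h2, h4, h.mul_inv, h.inv_mul]
  noncomm_ring

/-- In the derivative of wSv the two terms containing Sᵏ cancel because Sᵏ commutes with S. -/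
lemma toda (h : IsDressed L w v) (hw : Evolves L w) (k : ℕ+) :
    deriv k L = plus (L ^ (k : ℕ)) * L - L * plus (L ^ (k : ℕ)) := by
  have h1 := h.deriv_inv hw k
  have h2 : deriv k w = plus (L ^ (k : ℕ)) * w - w * shift ^ (k : ℕ) := by
    rw [← hw k]; abel
  have h3 : deriv k v = shift ^ (k : ℕ) * v - v * plus (L ^ (k : ℕ)) := by
    rw [sub_eq_iff_eq_add] at h1
    rw [h1]; abel
  have h4 : shift ^ (k : ℕ) * shift = shift * shift ^ (k : ℕ) := (pow_mul_comm' (shift : BMat K) _)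
  have h5 : w * shift ^ (k : ℕ) * shift * v = w * shift * shift ^ (k : ℕ) * v := by
    rw [mul_assoc w, h4, mul_assoc w shift]
  calc deriv k L = (plus (L ^ (k : ℕ)) * w - w * shift ^ (k : ℕ)) * shift * v +
        w * shift * (shift ^ (k : ℕ) * v - v * plus (L ^ (k : ℕ))) := by
        rw [← h3, ← h2]
        conv_lhs => rw [h.eq, BMat.deriv_mul, BMat.deriv_mul, deriv_shift, mul_zero, add_zero]
    _ = plus (L ^ (k : ℕ)) * (w * shift * v) - (w * shift * v) * plus (L ^ (k : ℕ)) +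
        (w * shift * shift ^ (k : ℕ) * v - w * shift ^ (k : ℕ) * shift * v) := by
        noncomm_ring
    _ = _ := by rw [h5, sub_self, add_zero, ← h.eq]

lemma vanishesAbove (h : IsDressed L w v) : VanishesAbove 1 L.1 := by
  rw [h.eq]
  exact (h.left.1.matMul vanishesAbove_shift).matMul h.right.1

lemma apply_succ (h : IsDressed L w v) (n : ℤ) : L n (n + 1) = 1 := by
  have : VanishesAbove (0 + 1) (w * shift).1 := h.left.1.matMul vanishesAbove_shift
  rw [h.eq, BMat.mul_apply_eq_sum this h.right.1 le_rfl le_rfl]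
  simp [mul_shift_apply, h.left.2, h.right.2]

lemma bddExp_row (h : IsDressed L w v) (n : ℤ) : BddExp (w n) :=
  ⟨n, fun j hj => h.left.1 n j (by omega)⟩

lemma ordLE_row (h : IsDressed L w v) (n : ℤ) : OrdLE n (w n) :=
  fun j hj => h.left.1 n j (by omega)

lemma ordLE_dualColumn (h : IsDressed L w v) (m : ℤ) : OrdLE (-m) (dualColumn v m) :=
  fun j hj => h.right.1 _ _ (by omega)

lemma bddExp_dualColumn (h : IsDressed L w v) (m : ℤ) : BddExp (dualColumn v m) :=
  ⟨-m, h.ordLE_dualColumn m⟩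

/-- The residue is an entry of wv = 1 strictly below the diagonal. -/
lemma diagPairing_eq_zero (h : IsDressed L w v) {n m : ℤ} (hnm : m ≤ n) :
    diagPairing (w n) (dualColumn v m) = 0 := by
  rw [diagPairing_dualColumn, h.mul_inv, one_apply, if_neg (by omega)]

end IsDressed

end Dressing

/-! ### Equivalence of the Sato equations with the bilinear relations -/

section Bilinear

variable {K : Type*} [CommRing K] [Algebra ℚ K] {L w v : BMat K}

open BMat

theorem IsDressed.evolves_of_pairing (h : IsDressed L w v)
    (hp : ∀ n m : ℤ, m ≤ n → pairing (w n) (dualColumn v m) = 0) : Evolves L w := by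
  refine h.evolves_of_upper fun k n m hmn => ?_
  -- Column `m` of `v` is `dualColumn v (m + 1)`, and m < n puts m + 1 in the range of the
  -- relations.
  have h1 : pairing (oscDeriv k (w n)) (dualColumn v (m + 1)) = 0 := by
    rw [← pderiv_inl_pairing (h.bddExp_row n) (h.bddExp_dualColumn (m + 1)),
      hp n (m + 1) (by omega), map_zero]
  have h2 := OneToda.diagPairing_eq_zero ((h.bddExp_row n).oscDeriv k)
    (h.bddExp_dualColumn (m + 1)) h1
  rwa [oscDeriv_row, diagPairing_dualColumn, add_sub_cancel_right] at h2

/-- The family indexed by all m ≤ n has zero constant terms. By the Sato equations each derivative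
is a combination of members with larger n or smaller m (or equal), with coefficients in one set of
times, so `eq_zero_of_coeff_pderiv` applies. -/
theorem IsDressed.pairing_eq_zero (h : IsDressed L w v) (hw : Evolves L w) (n m : ℤ)
    (hnm : m ≤ n) : pairing (w n) (dualColumn v m) = 0 := by
  refine eq_zero_of_coeff_pderiv
    (fun x : {x : ℤ × ℤ // x.2 ≤ x.1} => pairing (w x.1.1) (dualColumn v x.1.2)) ?_ ?_
    ⟨(n, m), hnm⟩
  · rintro ⟨⟨n, m⟩, hnm⟩
    dsimp only at hnm ⊢
    rw [coeff_zero_pairing (h.bddExp_row n) (h.bddExp_dualColumn m), h.diagPairing_eq_zero hnm,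
      map_zero]
  · rintro ⟨⟨n, m⟩, hnm⟩ s d hd
    dsimp only at hnm hd ⊢
    rcases s with k | k
    · obtain ⟨N, hN⟩ := (plus (L ^ (k : ℕ))).2
      have hrow : oscDeriv k (w n) =
          fun j => ∑ l ∈ Finset.Icc n (n + N), plus (L ^ (k : ℕ)) n l * w l j := by
        funext j
        rw [oscDeriv_row, hw k, (upper_plus _).mul_apply_eq_sum hN]
      rw [pderiv_inl_pairing (h.bddExp_row n) (h.bddExp_dualColumn m), hrow,
        pairing_sum_left _ (fun l => (h.bddExp_row l).mul_left _) (h.bddExp_dualColumn m), map_sum]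
      refine Finset.sum_eq_zero fun l hl => ?_
      rw [Finset.mem_Icc] at hl
      exact coeff_pairing_mul_left _ (h.bddExp_row l) (h.bddExp_dualColumn m) d
        fun e he => hd ⟨(l, m), by dsimp only; omega⟩ e he
    · obtain ⟨N, hN⟩ := (plus (L ^ (k : ℕ))).2
      have hcol : dualDeriv k (dualColumn v m) = fun j => ∑ l ∈ Finset.Icc (m - 1 - N) (m - 1),
          -plus (L ^ (k : ℕ)) l (m - 1) * dualColumn v (l + 1) j := by
        funext j
        rw [dualDeriv_dualColumn, h.deriv_inv hw, BMat.neg_apply,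
          (upper_plus _).apply_mul_eq_sum hN, ← Finset.sum_neg_distrib]
        refine Finset.sum_congr rfl fun l _ => ?_
        rw [dualColumn, add_sub_cancel_right]
        ring
      rw [pderiv_inr_pairing (h.bddExp_row n) (h.bddExp_dualColumn m), hcol,
        pairing_sum_right _ (h.bddExp_row n) (fun l => (h.bddExp_dualColumn (l + 1)).mul_left _),
        map_sum]
      refine Finset.sum_eq_zero fun l hl => ?_
      rw [Finset.mem_Icc] at hl
      exact coeff_pairing_mul_right _ (h.bddExp_row n) (h.bddExp_dualColumn (l + 1)) d
        fun e he => hd ⟨(n, l + 1), by dsimp only; omega⟩ e he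

end Bilinear

/-! ### From the Sato equations to KP wavefunctions -/

section Wavefunctions

variable {K : Type*} [CommRing K] {L w v : BMat K}

open BMat PDO

lemma negOnePow_mul_self_smul (l : ℤ) (f : TimeSeries K) :
    (Int.negOnePow l : ℤ) • (Int.negOnePow l : ℤ) • f = f := by
  rw [smul_smul, ← Units.val_mul, Int.units_mul_self, Units.val_one, one_smul]

namespace IsDressed

/-- The operator `P` with `ψₙ = P e^ξ`. -/
def waveOp (h : IsDressed L w v) (n : ℤ) : PDO K := ⟨w n, n, h.ordLE_row n⟩

/-- The operator `Q` with `ψₘ^* = Q e^{-ξ}`. -/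
def dualOp (h : IsDressed L w v) (m : ℤ) : PDO K :=
  ⟨dualOperator (dualColumn v m), -m, fun l hl => by
    rw [dualOperator, h.ordLE_dualColumn m l hl, smul_zero]⟩

lemma waveOp_apply (h : IsDressed L w v) (n l : ℤ) : h.waveOp n l = w n l := rfl

lemma dualOp_apply (h : IsDressed L w v) (m l : ℤ) :
    h.dualOp m l = (Int.negOnePow l : ℤ) • dualColumn v m l := rfl

lemma ordLE_waveOp (h : IsDressed L w v) (n : ℤ) : OrdLE n (h.waveOp n).1 := h.ordLE_row n

lemma ordLE_dualOp (h : IsDressed L w v) (m : ℤ) : OrdLE (-m) (h.dualOp m).1 := fun l hl => by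
  change (Int.negOnePow l : ℤ) • dualColumn v m l = 0
  rw [h.ordLE_dualColumn m l hl, smul_zero]

lemma waveOp_top (h : IsDressed L w v) (n : ℤ) : h.waveOp n n = 1 := h.left.2 n

lemma dualColumn_top (h : IsDressed L w v) (m : ℤ) : dualColumn v m (-m) = 1 := by
  rw [dualColumn, neg_neg, h.right.2]

lemma ordLE_adj {A : PDO K} {N : ℤ} (hA : OrdLE N A.1) : OrdLE N (adj A).1 := ordLE_psAdjoint hA

lemma adj_dualOp_top (h : IsDressed L w v) (m : ℤ) : adj (h.dualOp m) (-m) = 1 := by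
  rw [adj_apply_top (h.ordLE_dualOp m), dualOp_apply, negOnePow_mul_self_smul, h.dualColumn_top]

lemma dualOp_mul_adj_top (h : IsDressed L w v) (m : ℤ) :
    h.dualOp m (-m) * adj (h.waveOp m) m = 1 := by
  rw [adj_apply_top (h.ordLE_waveOp m), dualOp_apply, h.waveOp_top, h.dualColumn_top,
    Int.negOnePow_neg, smul_mul_smul_comm, ← Units.val_mul, Int.units_mul_self, Units.val_one,
    one_smul, one_mul]

/-- The sign in `dualOperator` cancels the one in `residue_mul_adj`, up to reflection, leaving the
vanishing residue at s = t. -/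
lemma residue_waveOp_mul_adj (h : IsDressed L w v) {n m : ℤ} (hnm : m ≤ n) :
    (h.waveOp n * adj (h.dualOp m)) (-1) = 0 := by
  rw [residue_mul_adj (lo := -1 - -m) (h.ordLE_waveOp n) (h.ordLE_dualOp m) le_rfl,
    ← h.diagPairing_eq_zero hnm,
    diagPairing_eq_sum (lo := -1 - -m) (h.ordLE_row n)
      (fun j hj => h.ordLE_dualColumn m j (by omega))]
  refine Finset.sum_congr rfl fun i _ => ?_
  rw [dualOp_apply, mul_smul_comm, negOnePow_mul_self_smul, waveOp_apply]

lemma residue_dualOp_mul_adj (h : IsDressed L w v) {n m : ℤ} (hnm : m ≤ n) :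
    (h.dualOp m * adj (h.waveOp n)) (-1) = 0 := by
  have h0 := h.diagPairing_eq_zero hnm
  rw [diagPairing_comm, diagPairing_eq_sum (lo := -1 - n) (h.ordLE_dualColumn m)
      (fun j hj => h.ordLE_row n j (by omega))] at h0
  rw [residue_mul_adj (lo := -1 - n) (h.ordLE_dualOp m) (h.ordLE_waveOp n) le_rfl,
    ← neg_zero, ← h0, ← Finset.sum_neg_distrib]
  refine Finset.sum_congr rfl fun i _ => ?_
  rw [dualOp_apply, smul_mul_assoc, Int.negOnePow_sub, Int.negOnePow_neg, Int.negOnePow_one,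
    Units.val_mul, mul_smul, negOnePow_mul_self_smul, waveOp_apply]
  simp

/-- The first flow: L₊ has only the diagonal and a superdiagonal of ones. -/
lemma der_mul_waveOp (h : IsDressed L w v) (hw : Evolves L w) (n : ℤ) :
    mono 1 1 * h.waveOp n = mono 0 1 * h.waveOp (n + 1) + mono 0 (L n n) * h.waveOp n := by
  refine PDO.ext fun l => ?_
  have hN : VanishesAbove 1 (plus L).1 := fun i j hij => by
    change (if i ≤ j then L i j else 0) = 0
    rw [h.vanishesAbove i j hij, ite_self]
  have h1 : oscDeriv 1 (w n) l = (plus L * w) n l := by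
    have := hw 1
    rw [PNat.one_coe, pow_one, pow_one] at this
    rw [← this, oscDeriv_row, PNat.one_coe, pow_one]
  rw [(upper_plus L).mul_apply_eq_sum hN, show Finset.Icc n (n + 1) = {n, n + 1} by
    ext; simp; omega, Finset.sum_pair (by omega), plus_apply, plus_apply, if_pos le_rfl,
    if_pos (by omega), h.apply_succ] at h1
  rw [der_mul_apply, PDO.add_apply, mono_zero_mul_apply, mono_zero_mul_apply, waveOp_apply,
    waveOp_apply, waveOp_apply]
  rw [oscDeriv, PNat.one_coe, Nat.cast_one] at h1
  rw [h1, add_comm]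

lemma der_mul_dualOp (h : IsDressed L w v) (hw : Evolves L w) (m : ℤ) :
    mono 1 1 * h.dualOp m =
      mono 0 (-1) * h.dualOp (m - 1) + mono 0 (-L (m - 1) (m - 1)) * h.dualOp m := by
  refine PDO.ext fun l => ?_
  have hN : VanishesAbove 1 (plus L).1 := fun i j hij => by
    change (if i ≤ j then L i j else 0) = 0
    rw [h.vanishesAbove i j hij, ite_self]
  have h1 : dualDeriv 1 (dualColumn v m) l = -(v * plus L) (-l - 1) (m - 1) := by
    have := h.deriv_inv hw 1
    rw [PNat.one_coe, pow_one, pow_one] at this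
    rw [← BMat.neg_apply, ← this, dualDeriv_dualColumn, PNat.one_coe, pow_one]
  have hsucc : L (m - 1 - 1) (m - 1) = 1 := by
    have := h.apply_succ (m - 1 - 1)
    rwa [sub_add_cancel] at this
  rw [(upper_plus L).apply_mul_eq_sum hN,
    show Finset.Icc (m - 1 - 1) (m - 1) = {m - 1 - 1, m - 1} by
    ext; simp; omega, Finset.sum_pair (by omega), plus_apply, plus_apply, if_pos le_rfl,
    if_pos (by omega), hsucc, dualDeriv, PNat.one_coe, Nat.cast_one] at h1
  rw [der_mul_apply, PDO.add_apply, mono_zero_mul_apply, mono_zero_mul_apply, dualOp_apply,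
    dualOp_apply, dualOp_apply, dt_zsmul]
  rw [Int.negOnePow_sub, Int.negOnePow_one, mul_neg, mul_one, Units.val_neg, neg_smul,
    ← sub_eq_add_neg, ← smul_sub, h1, mul_smul_comm, mul_smul_comm, ← smul_add]
  congr 1
  rw [dualColumn, dualColumn]
  ring

/-- For fixed m the operators Pₘ₊ₖQₘ^* have zero residue, and the first flow supplies the recursion
that `isDiff_of_residue` needs. -/
lemma isDiff_waveOp_mul_adj (h : IsDressed L w v) (hw : Evolves L w) {n m : ℤ} (hnm : m ≤ n) :
    IsDiff (h.waveOp n * adj (h.dualOp m)) := by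
  have := isDiff_of_residue (X := fun k : ℕ => h.waveOp (m + k) * adj (h.dualOp m))
    (fun k => h.residue_waveOp_mul_adj (by omega))
    (fun k => ⟨1, L (m + k) (m + k), by
      rw [← mul_assoc, h.der_mul_waveOp hw, add_mul, mul_assoc, mul_assoc]
      push_cast
      rw [add_assoc m]⟩) (n - m).toNat
  rwa [show m + ((n - m).toNat : ℤ) = n by omega] at this

lemma isDiff_dualOp_mul_adj (h : IsDressed L w v) (hw : Evolves L w) (n : ℤ) :
    IsDiff (h.dualOp n * adj (h.waveOp n)) := by
  have := isDiff_of_residue (X := fun k : ℕ => h.dualOp (n - k) * adj (h.waveOp n))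
    (fun k => h.residue_dualOp_mul_adj (by omega))
    (fun k => ⟨-1, -L (n - k - 1) (n - k - 1), by
      rw [← mul_assoc, h.der_mul_dualOp hw, add_mul, mul_assoc, mul_assoc]
      push_cast
      rw [sub_sub n]⟩) 0
  rwa [Nat.cast_zero, sub_zero] at this

lemma waveOp_mul_adj (h : IsDressed L w v) (hw : Evolves L w) (n : ℤ) :
    h.waveOp n * adj (h.dualOp n) = 1 := by
  refine eq_one_of_isDiff (h.isDiff_waveOp_mul_adj hw le_rfl) ?_ ?_
  · simpa using ordLE_mul (h.ordLE_waveOp n) (ordLE_adj (h.ordLE_dualOp n))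
  · have := mul_apply_top (h.ordLE_waveOp n) (ordLE_adj (h.ordLE_dualOp n))
    rwa [add_neg_cancel, h.waveOp_top, h.adj_dualOp_top, one_mul] at this

lemma adj_mul_waveOp (h : IsDressed L w v) (hw : Evolves L w) (n : ℤ) :
    adj (h.dualOp n) * h.waveOp n = 1 :=
  mul_eq_one_comm_of_leading (h.ordLE_waveOp n) (ordLE_adj (h.ordLE_dualOp n))
    (h.waveOp_mul_adj hw n) (by rw [h.waveOp_top, h.adj_dualOp_top, one_mul])

/-- The Lax operator needs PQ^* = 1, the adjoint wavefunction QP^* = 1. The second is obtained like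
the first, from residues and the dual first flow, without taking the adjoint of a product. -/
lemma dualOp_mul_adj (h : IsDressed L w v) (hw : Evolves L w) (n : ℤ) :
    h.dualOp n * adj (h.waveOp n) = 1 := by
  refine eq_one_of_isDiff (h.isDiff_dualOp_mul_adj hw n) ?_ ?_
  · simpa using ordLE_mul (h.ordLE_dualOp n) (ordLE_adj (h.ordLE_waveOp n))
  · have := mul_apply_top (h.ordLE_dualOp n) (ordLE_adj (h.ordLE_waveOp n))
    rwa [neg_add_cancel, h.dualOp_mul_adj_top] at this

lemma adj_mul_dualOp (h : IsDressed L w v) (hw : Evolves L w) (n : ℤ) :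
    adj (h.waveOp n) * h.dualOp n = 1 :=
  mul_eq_one_comm_of_leading (N := -n) (h.ordLE_dualOp n)
    (by rw [neg_neg]; exact ordLE_adj (h.ordLE_waveOp n))
    (h.dualOp_mul_adj hw n) (by rw [neg_neg]; exact h.dualOp_mul_adj_top n)

lemma isOscOfType_row (h : IsDressed L w v) (n : ℤ) : IsOscOfType n (w n) :=
  ⟨h.left.2 n, h.ordLE_row n⟩

theorem isAdjointOf (h : IsDressed L w v) (hw : Evolves L w) (n : ℤ) :
    IsAdjointOf n (w n) (dualColumn v n) :=
  ⟨h.isOscOfType_row n, ⟨h.dualColumn_top n, h.ordLE_dualColumn n⟩,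
    congrArg PDO.val (h.dualOp_mul_adj hw n), congrArg PDO.val (h.adj_mul_dualOp hw n)⟩

/-- With Lax operator P∂P⁻¹, the k-th power is (∂ₖ(P) + P∂ᵏ)P⁻¹ - ∂ₖ(P)P⁻¹. The first term is
differential and the second has negative order, so the first is the differential part; applied to P
it gives ∂ₖψₙ. -/
theorem isKPWavefunction (h : IsDressed L w v) (hw : Evolves L w) (n : ℤ) :
    IsKPWavefunction n (w n) := by
  set P := h.waveOp n with hP
  set R := adj (h.dualOp n)
  have hPR : P * R = 1 := h.waveOp_mul_adj hw n
  have hRP : R * P = 1 := h.adj_mul_waveOp hw n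
  have hR : OrdLE (-n) R.1 := ordLE_adj (h.ordLE_dualOp n)
  have hpow : ∀ k : ℕ, (P * mono 1 1 * R) ^ k = P * mono k 1 * R := by
    intro k
    rw [← mono_one_pow]
    induction k with
    | zero => rw [pow_zero, pow_zero, mul_one, hPR]
    | succ k ih =>
      calc (P * mono 1 1 * R) ^ (k + 1) = P * mono 1 1 ^ k * (R * P) * mono 1 1 * R := by
            rw [pow_succ, ih]; simp only [mul_assoc]
        _ = _ := by rw [hRP, mul_one, pow_succ]; simp only [mul_assoc]
  -- The leading coefficient 1 of P is constant, so differentiating the coefficients lowers the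
  -- order.
  have hdord : ∀ k : ℕ+, OrdLE (n - 1) (fun j => dt k (w n j)) := fun k l hl =>
    h.left.strictLower_deriv k n l (by omega)
  let D : ℕ+ → PDO K := fun k => ⟨fun j => dt k (w n j), n - 1, hdord k⟩
  have hosc : ∀ k : ℕ+, (D k + P * mono (k : ℕ) 1).1 = oscDeriv k (w n) := fun k => by
    funext l
    rw [PDO.add_apply, mul_mono_one_apply]
    rfl
  have hlow : ∀ k : ℕ+, OrdLE (-1) (-(D k * R)).1 := fun k l hl => by
    rw [PDO.neg_apply, ordLE_mul (hdord k : OrdLE (n - 1) (D k).1) hR l (by omega), neg_zero]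
  have hsplit : ∀ k : ℕ+, (P * mono 1 1 * R) ^ (k : ℕ) =
      (D k + P * mono (k : ℕ) 1) * R + -(D k * R) := fun k => by
    rw [hpow, add_mul]; abel
  refine ⟨h.isOscOfType_row n, (P * mono 1 1 * R).1, ?_, ?_, fun k => ?_⟩
  · have h1 : P * mono 1 1 * R = mono 1 1 + -(D 1 * R) := by
      have h2 : D 1 + P * mono 1 1 = mono 1 1 * P := by
        refine PDO.ext fun l => ?_
        rw [der_mul_apply, PDO.add_apply, mul_mono_one_apply]
        rfl
      have := hsplit 1
      rwa [PNat.one_coe, pow_one, Nat.cast_one, h2, mul_assoc (mono 1 1), hPR, mul_one] at this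
    rw [h1]
    refine ⟨?_, ?_, fun j hj => ?_⟩
    · rw [PDO.add_apply, mono_apply, if_pos rfl, hlow 1 1 (by norm_num), add_zero]
    · rw [PDO.add_apply, mono_apply, if_neg (by norm_num), hlow 1 0 (by norm_num), add_zero]
    · rw [PDO.add_apply, mono_apply, if_neg (by omega), hlow 1 j (by omega), add_zero]
  · change (P * mono 1 1 * R * P).1 = _
    rw [mul_assoc, hRP, mul_one]
    funext l
    rw [mul_mono_one_apply]
    rfl
  · obtain ⟨N, hN⟩ := (BMat.plus (L ^ (k : ℕ))).2
    have hsum : D k + P * mono (k : ℕ) 1 =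
        ∑ l ∈ Finset.Icc n (n + N), mono 0 (BMat.plus (L ^ (k : ℕ)) n l) * h.waveOp l := by
      refine PDO.ext fun j => ?_
      rw [hosc, oscDeriv_row, hw k, (upper_plus _).mul_apply_eq_sum hN, PDO.sum_apply]
      refine Finset.sum_congr rfl fun l _ => ?_
      rw [mono_zero_mul_apply]
      rfl
    -- By the Sato equations this is a combination of the differential operators P_lQₙ^* with l ≥ n.
    have hdiff : IsDiff ((D k + P * mono (k : ℕ) 1) * R) := by
      rw [hsum, Finset.sum_mul]
      refine IsDiff.sum fun l hl => ?_
      rw [mul_assoc]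
      exact (h.isDiff_waveOp_mul_adj hw (Finset.mem_Icc.mp hl).1).mono_zero_mul _
    rw [psPow_val, psPlus_eq_of_eq_add (hsplit k) hdiff (hlow k)]
    change _ = ((D k + P * mono (k : ℕ) 1) * R * P).1
    rw [mul_assoc, hRP, mul_one, hosc]

end IsDressed

end Wavefunctions

section ModifiedKP

variable {K : Type*} [CommRing K] [Algebra ℚ K] {L w v : BMat K}

theorem IsDressed.evolves_iff_modifiedKP (h : IsDressed L w v) :
    Evolves L w ↔ SatisfiesModifiedKP w (dualColumn v) :=
  ⟨fun hw => ⟨fun n => ⟨h.isKPWavefunction hw n, h.isAdjointOf hw n⟩, h.pairing_eq_zero hw⟩,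
    fun hkp => h.evolves_of_pairing hkp.2⟩

end ModifiedKP

/-! ### Triangular recursions, the intertwiner with the shift, and flatness -/

section Existence

variable {K : Type*} [CommRing K]

open BMat

/-- Recursion over the diagonals below the main one. -/
lemma BMat.exists_lowerUnitriangular_of_recursion (Ψ : ℤ → ℤ → BMat K → TimeSeries K)
    (hΨ : ∀ k l (w w' : BMat K), l < k → (∀ m n, m - n < k - l → w m n = w' m n) →
      Ψ k l w = Ψ k l w') :
    ∃ w : BMat K, LowerUnitriangular w ∧ ∀ k l, l < k → w k l = Ψ k l w := by
  let step : BMat K → BMat K := fun w =>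
    ⟨fun k l => if l < k then Ψ k l w else (1 : BMat K) k l, 0, fun k l hkl => by
      beta_reduce
      rw [if_neg (by omega), BMat.one_apply, if_neg (by omega)]⟩
  have hstep : ∀ w k l, step w k l = if l < k then Ψ k l w else (1 : BMat K) k l :=
    fun _ _ _ => rfl
  -- Each step settles one more diagonal: `W d` is final on entries with m - n ≤ d, and the limit is
  -- read off there.
  let W : ℕ → BMat K := fun d => step^[d] 1
  have hW : ∀ d, W (d + 1) = step (W d) := fun d => Function.iterate_succ_apply' _ _ _
  have hagree : ∀ d : ℕ, ∀ m n : ℤ, m - n ≤ d → W (d + 1) m n = W d m n := by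
    intro d
    induction d with
    | zero =>
      intro m n hmn
      rw [hW, hstep, if_neg (by push_cast at hmn; omega)]
      rfl
    | succ d ih =>
      intro m n hmn
      rw [hW (d + 1), hW d, hstep, hstep]
      split_ifs with h
      · refine hΨ _ _ _ _ h fun m' n' h' => ?_
        rw [← hW]
        exact ih m' n' (by push_cast at hmn; omega)
      · rfl
  have hstable : ∀ d e : ℕ, ∀ m n : ℤ, m - n ≤ d → W (d + e) m n = W d m n := by
    intro d e
    induction e with
    | zero => intros; rfl
    | succ e ih =>
      intro m n hmn
      rw [← add_assoc, hagree (d + e) m n (by push_cast; omega), ih m n hmn]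
  have hlu : ∀ d k l, k ≤ l → W d k l = (1 : BMat K) k l := by
    intro d k l hkl
    cases d with
    | zero => rfl
    | succ d => rw [hW, hstep, if_neg (by omega)]
  let w : BMat K := ⟨fun k l => W (k - l).toNat k l, 0, fun k l hkl => by
    beta_reduce
    rw [hlu _ _ _ (by omega), BMat.one_apply, if_neg (by omega)]⟩
  have hw : ∀ d : ℕ, ∀ m n : ℤ, m - n ≤ d → w m n = W d m n := by
    intro d m n hmn
    change W (m - n).toNat m n = W d m n
    have := hstable (m - n).toNat (d - (m - n).toNat) m n (by omega)
    rwa [show (m - n).toNat + (d - (m - n).toNat) = d by omega, eq_comm] at this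
  refine ⟨w, ⟨fun k l hkl => ?_, fun k => ?_⟩, fun k l hkl => ?_⟩
  · change W (k - l).toNat k l = 0
    rw [hlu _ _ _ (by omega), BMat.one_apply, if_neg (by omega)]
  · change W (k - k).toNat k k = 1
    rw [hlu _ _ _ le_rfl, BMat.one_apply, if_pos rfl]
  · rw [hw ((k - l - 1).toNat + 1) k l (by push_cast; omega), hW, hstep, if_pos hkl]
    exact hΨ _ _ _ _ hkl fun m n hmn => (hw _ m n (by omega)).symm

/-- Forward substitution: the unit diagonal of `w` expresses an entry of `v` through entries on
diagonals closer to the main one. -/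
lemma BMat.LowerUnitriangular.exists_right_inverse {w : BMat K} (hw : LowerUnitriangular w) :
    ∃ v : BMat K, LowerUnitriangular v ∧ w * v = 1 := by
  obtain ⟨v, hv, hrec⟩ := exists_lowerUnitriangular_of_recursion
    (fun k l v => -∑ m ∈ Finset.Ico l k, w k m * v m l) (fun k l v v' hkl h => by
      congr 1
      refine Finset.sum_congr rfl fun m hm => ?_
      rw [Finset.mem_Ico] at hm
      rw [h m l (by omega)])
  refine ⟨v, hv, BMat.ext fun k l => ?_⟩
  rcases lt_trichotomy l k with h | rfl | h
  · rw [BMat.mul_apply_eq_sum hw.1 hv.1 (show l ≤ l - 0 by omega) (show k + 0 ≤ k by omega),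
      ← Finset.Ico_insert_right h.le, Finset.sum_insert (by simp), hw.2, one_mul, hrec k l h,
      neg_add_cancel, BMat.one_apply, if_neg (by omega)]
  · rw [LowerUnitriangular.mul_apply_self hw.1 hv.1, hw.2, hv.2, BMat.one_apply, if_pos rfl,
      mul_one]
  · rw [BMat.one_apply, if_neg (by omega)]
    exact (hw.1.matMul hv.1) k l (by omega)

lemma BMat.LowerUnitriangular.exists_inverse {w : BMat K} (hw : LowerUnitriangular w) :
    ∃ v : BMat K, LowerUnitriangular v ∧ w * v = 1 ∧ v * w = 1 := by
  obtain ⟨v, hv, hwv⟩ := hw.exists_right_inverse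
  obtain ⟨u, -, hvu⟩ := hv.exists_right_inverse
  have : w = u := by rw [← mul_one w, ← hvu, ← mul_assoc, hwv, one_mul]
  exact ⟨v, hv, hwv, by rw [this, hvu]⟩

/-- A discrete antiderivative of a function on `ℤ`. -/
def antidifference (r : ℤ → TimeSeries K) (l : ℤ) : TimeSeries K :=
  ∑ i ∈ Finset.Ioc 0 l, r i - ∑ i ∈ Finset.Ioc l 0, r i

lemma antidifference_sub (r : ℤ → TimeSeries K) (l : ℤ) :
    antidifference r l - antidifference r (l - 1) = r l := by
  unfold antidifference
  rcases lt_or_ge 0 l with h | h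
  · rw [Finset.Ioc_eq_empty (show ¬ l < 0 by omega),
      Finset.Ioc_eq_empty (show ¬ l - 1 < 0 by omega),
      show Finset.Ioc 0 l = insert l (Finset.Ioc 0 (l - 1)) by ext; simp; omega,
      Finset.sum_insert (by simp)]
    simp
  · rw [Finset.Ioc_eq_empty (show ¬ 0 < l by omega),
      Finset.Ioc_eq_empty (show ¬ 0 < l - 1 by omega),
      show Finset.Ioc (l - 1) 0 = insert l (Finset.Ioc l 0) by ext; simp; omega,
      Finset.sum_insert (by simp)]
    simp

/-- A matrix `L` with ones on the diagonal above the main one, and zeros above, is conjugate to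
the shift matrix. -/
lemma exists_intertwiner {L : BMat K} (hL : VanishesAbove 1 L.1) (h1 : ∀ n, L n (n + 1) = 1) :
    ∃ w : BMat K, LowerUnitriangular w ∧ L * w = w * shift := by
  -- Entry (k, l) of Lw = wS reads w(k+1, l) - w(k, l-1) = -∑_{l ≤ m ≤ k} L(k, m)w(m, l). This is a
  -- difference equation along one diagonal, with right-hand side determined by diagonals closer to
  -- the main one; it is solved by `antidifference`.
  obtain ⟨w, hw, hrec⟩ := exists_lowerUnitriangular_of_recursion
    (fun k l w => antidifference
      (fun l' => -∑ m ∈ Finset.Icc l' (l' + (k - l) - 1), L (l' + (k - l) - 1) m * w m l') l)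
    (fun k l v v' hkl h => by
      congr 1
      funext l'
      congr 1
      refine Finset.sum_congr rfl fun m hm => ?_
      rw [Finset.mem_Icc] at hm
      rw [h m l' (by omega)])
  have hdiff : ∀ k l, l ≤ k → w (k + 1) l - w k (l - 1) =
      -∑ m ∈ Finset.Icc l k, L k m * w m l := by
    intro k l hlk
    rw [hrec (k + 1) l (by omega), hrec k (l - 1) (by omega),
      show k - (l - 1) = k + 1 - l by ring, antidifference_sub,
      show l + (k + 1 - l) - 1 = k by ring]
  refine ⟨w, hw, BMat.ext fun k l => ?_⟩
  rw [mul_shift_apply, BMat.mul_apply_eq_sum hL hw.1 (show l ≤ l - 0 by omega) le_rfl]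
  rcases lt_trichotomy l (k + 1) with h | rfl | h
  · rw [← Finset.Ico_insert_right h.le, Finset.sum_insert (by simp), h1, one_mul,
      show Finset.Ico l (k + 1) = Finset.Icc l k by ext; simp,
      ← neg_eq_iff_eq_neg.mpr (hdiff k l (by omega))]
    ring
  · rw [Finset.Icc_self, Finset.sum_singleton, h1, hw.2, add_sub_cancel_right, hw.2, one_mul]
  · rw [Finset.Icc_eq_empty (by omega), Finset.sum_empty, hw.1 _ _ (by omega)]

lemma deriv_pow_of_toda {L A : BMat K} {k : ℕ+} (h : BMat.deriv k L = A * L - L * A) (n : ℕ) :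
    BMat.deriv k (L ^ n) = A * L ^ n - L ^ n * A := by
  induction n with
  | zero => simp
  | succ n ih =>
    rw [pow_succ, BMat.deriv_mul, ih, h]
    noncomm_ring

/-- Flatness of the connection given by the strictly lower triangular parts. -/
lemma flat_of_toda {L : BMat K} (h : ∀ k : ℕ+, BMat.deriv k L =
      plus (L ^ (k : ℕ)) * L - L * plus (L ^ (k : ℕ))) (m n : ℕ+) :
    BMat.deriv m (minus (L ^ (n : ℕ))) - BMat.deriv n (minus (L ^ (m : ℕ))) =
      minus (L ^ (n : ℕ)) * minus (L ^ (m : ℕ)) - minus (L ^ (m : ℕ)) * minus (L ^ (n : ℕ)) := by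
  have hm := deriv_pow_of_toda (h m) n
  have hn := deriv_pow_of_toda (h n) m
  have hc : L ^ (m : ℕ) * L ^ (n : ℕ) = L ^ (n : ℕ) * L ^ (m : ℕ) := pow_mul_comm L _ _
  rw [deriv_minus, deriv_minus, ← minus_sub, hm, hn]
  have em := plus_add_minus (L ^ (m : ℕ))
  have en := plus_add_minus (L ^ (n : ℕ))
  -- With p, q the upper and x, y the lower parts of Lᵐ, Lⁿ, the difference of derivatives is 2[p,
  -- q] + [p, y] + [x, q]. Since Lᵐ and Lⁿ commute, this equals [p, q] + [y, x], whose terms are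
  -- upper and strictly lower triangular.
  refine minus_eq_of_eq_add (B := plus (L ^ (m : ℕ)) * plus (L ^ (n : ℕ)) -
    plus (L ^ (n : ℕ)) * plus (L ^ (m : ℕ))) ?_ ?_ ?_
  · set p := plus (L ^ (m : ℕ))
    set q := plus (L ^ (n : ℕ))
    set x := minus (L ^ (m : ℕ))
    set y := minus (L ^ (n : ℕ))
    rw [← em, ← en] at hc ⊢
    have hc' : p * q + p * y + x * q + x * y = q * p + q * x + y * p + y * x := by
      calc p * q + p * y + x * q + x * y = (p + x) * (q + y) := by noncomm_ring
        _ = _ := by rw [hc]; noncomm_ring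
    have hc'' : p * q + p * y + x * q - q * p - q * x - y * p = y * x - x * y := by
      rw [eq_sub_iff_add_eq, ← sub_eq_zero]
      rw [← sub_eq_zero] at hc'
      rw [← hc']
      abel
    calc p * (q + y) - (q + y) * p - (q * (p + x) - (p + x) * q) =
        (p * q - q * p) + (p * q + p * y + x * q - q * p - q * x - y * p) := by noncomm_ring
      _ = _ := by rw [hc'']
  · exact ((upper_plus _).mul (upper_plus _)).sub ((upper_plus _).mul (upper_plus _))
  · exact ((strictLower_minus _).mul (strictLower_minus _)).sub
      ((strictLower_minus _).mul (strictLower_minus _))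

lemma coeff_mul_eq_zero {f g : TimeSeries K} {d : ℕ+ →₀ ℕ}
    (h : ∀ e ≤ d, MvPowerSeries.coeff e g = 0) : MvPowerSeries.coeff d (f * g) = 0 := by
  classical
  rw [MvPowerSeries.coeff_mul]
  refine Finset.sum_eq_zero fun x hx => ?_
  rw [h x.2 (by
    rw [← Finset.HasAntidiagonal.mem_antidiagonal.mp hx]
    exact le_add_self), mul_zero]

lemma BMat.StrictLower.mul_apply_eq_sum {B A : BMat K} (hB : StrictLower B) {N : ℤ}
    (hA : VanishesAbove N A.1) (k l : ℤ) :
    (B * A) k l = ∑ m ∈ Finset.Icc (l - N) (k - 1), B k m * A m l :=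
  BMat.mul_apply_eq_sum hB.vanishesAbove hA le_rfl (by omega)

end Existence

/-! ### Solving the flat system and constructing a dressing matrix -/

section Evolution

variable {K : Type*} [CommRing K] [Algebra ℚ K]

open BMat

/-- A flat system `∂ₙ w = Bₙ w` with strictly lower triangular `Bₙ` has a solution with prescribed
initial values. -/
theorem exists_solution_of_flat {B : ℕ+ → BMat K} (hB : ∀ n, StrictLower (B n))
    (hflat : ∀ m n, BMat.deriv m (B n) + B n * B m = BMat.deriv n (B m) + B m * B n)
    (w₀ : BMat K) (hw₀ : LowerUnitriangular w₀) :
    ∃ w : BMat K, LowerUnitriangular w ∧ (∀ n, BMat.deriv n w = B n * w) ∧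
      ∀ k l, MvPowerSeries.constantCoeff (w k l) = MvPowerSeries.constantCoeff (w₀ k l) := by
  -- As `B n` is strictly lower triangular, (Bₙw)(k, l) involves only entries of `w` on diagonals
  -- closer to the main one. Each entry is thus an initial value plus a primitive of known series.
  obtain ⟨w, hw, hrec⟩ := exists_lowerUnitriangular_of_recursion
    (fun k l w => MvPowerSeries.C (MvPowerSeries.constantCoeff (w₀ k l)) +
      primitive (fun n => ∑ m ∈ Finset.Icc (l - 0) (k - 1), B n k m * w m l))
    (fun k l v v' hkl h => by
      congr 2
      funext n
      refine Finset.sum_congr rfl fun m hm => ?_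
      rw [Finset.mem_Icc] at hm
      rw [h m l (by omega)])
  have hrec' : ∀ k l, l < k → w k l = MvPowerSeries.C (MvPowerSeries.constantCoeff (w₀ k l)) +
      primitive (fun n => (B n * w) k l) := fun k l hkl => by
    rw [hrec k l hkl]
    simp only [(hB _).mul_apply_eq_sum hw.1]
  have key : ∀ d : ℕ, ∀ k l : ℤ, k - l = d → ∀ n, dt n (w k l) = (B n * w) k l := by
    intro d
    induction d using Nat.strong_induction_on with
    | _ d ih =>
      have hlow : ∀ n, ∀ k l : ℤ, k - l < d → dt n (w k l) = (B n * w) k l := by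
        intro n k l hkl
        rcases lt_or_ge k l with h | h
        · rw [hw.1 k l (by omega), dt_zero, (hB n).mul_of_vanishesAbove hw.1 k l h.le]
        · exact ih (k - l).toNat (by omega) k l (by omega) n
      intro k l hkl n
      rcases d.eq_zero_or_pos with rfl | hd
      · obtain rfl : k = l := by push_cast at hkl; omega
        rw [hw.2, dt_one, (hB n).mul_of_vanishesAbove hw.1 k k le_rfl]
      rw [hrec' k l (by omega), dt_add, dt_C, zero_add]
      refine pderiv_primitive (fun n => (B n * w) k l) (fun m n => ?_) n
      -- Closedness of the integrand: the equation already proved on the diagonals closer to the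
      -- main one replaces ∂ₘw by Bₘw, after which flatness gives symmetry in m and n.
      have hcomp : ∀ m n, dt m ((B n * w) k l) = ((BMat.deriv m (B n) + B n * B m) * w) k l := by
        intro m n
        have h1 : (B n * BMat.deriv m w) k l = (B n * (B m * w)) k l := by
          rw [(hB n).mul_apply_eq_sum (N := 0)
              ((hw.strictLower_deriv m).vanishesAbove.mono (by norm_num)),
            (hB n).mul_apply_eq_sum (N := 0)
              (((hB m).mul_of_vanishesAbove hw.1).vanishesAbove.mono (by norm_num))]
          refine Finset.sum_congr rfl fun j hj => ?_
          rw [Finset.mem_Icc] at hj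
          rw [deriv_apply, hlow m j l (by omega)]
        rw [← deriv_apply, BMat.deriv_mul, BMat.add_apply, h1, add_mul, mul_assoc, BMat.add_apply]
      change dt m ((B n * w) k l) = dt n ((B m * w) k l)
      rw [hcomp, hcomp, hflat]
  refine ⟨w, hw, fun n => BMat.ext fun k l => ?_, fun k l => ?_⟩
  · rcases lt_or_ge k l with h | h
    · rw [hw.strictLower_deriv n k l h.le, (hB n).mul_of_vanishesAbove hw.1 k l h.le]
    · exact key (k - l).toNat k l (by omega) n
  · rcases lt_trichotomy l k with h | rfl | h
    · rw [hrec' k l h, map_add, MvPowerSeries.constantCoeff_C,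
        ← MvPowerSeries.coeff_zero_eq_constantCoeff_apply (primitive _), coeff_zero_primitive,
        add_zero]
    · rw [hw.2, hw₀.2]
    · rw [hw.1 k l (by omega), hw₀.1 k l (by omega)]

/-- The intertwiner `w₀` supplies only the values at t = 0. Flowing by ∂ₙw = -(Lⁿ)₋w preserves Lw =
wS; then Lᵏw = wSᵏ and Lᵏ - (Lᵏ)₋ = (Lᵏ)₊ give the Sato equations. -/
theorem exists_isDressed_of_toda {L : BMat K} (hL : VanishesAbove 1 L.1)
    (h1 : ∀ n, L n (n + 1) = 1) (h : ∀ k : ℕ+, BMat.deriv k L =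
      plus (L ^ (k : ℕ)) * L - L * plus (L ^ (k : ℕ))) :
    ∃ w v : BMat K, IsDressed L w v ∧ Evolves L w := by
  obtain ⟨w₀, hw₀, hint⟩ := exists_intertwiner hL h1
  have hB : ∀ n : ℕ+, StrictLower (-minus (L ^ (n : ℕ))) := fun n i j hij => by
    rw [BMat.neg_apply, strictLower_minus _ i j hij, neg_zero]
  obtain ⟨w, hw, hderiv, hconst⟩ := exists_solution_of_flat
    (B := fun n : ℕ+ => -minus (L ^ (n : ℕ))) hB (fun m n => by
      have := flat_of_toda h m n
      rw [sub_eq_iff_eq_add] at this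
      rw [BMat.deriv_neg, BMat.deriv_neg, neg_mul_neg, neg_mul_neg, this]
      abel) w₀ hw₀
  have hXb : VanishesAbove 1 (L * w - w * shift).1 := fun i j hij => by
    have e1 : (L * w) i j = 0 := (hL.matMul hw.1) i j (by omega)
    have e2 : (w * shift : BMat K) i j = 0 := (hw.1.matMul vanishesAbove_shift) i j (by omega)
    rw [BMat.sub_apply, e1, e2, sub_zero]
  -- The Lax equation may be written with -(Lⁿ)₋ in place of (Lⁿ)₊, because Lⁿ commutes with L. The
  -- defect of the intertwining relation thus solves the same linear system as `w`.
  have hX : ∀ n, BMat.deriv n (L * w - w * shift) =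
      (-minus (L ^ (n : ℕ))) * (L * w - w * shift) := by
    intro n
    have hp : plus (L ^ (n : ℕ)) = L ^ (n : ℕ) - minus (L ^ (n : ℕ)) := by
      rw [eq_sub_iff_add_eq, plus_add_minus]
    have hc : L ^ (n : ℕ) * L = L * L ^ (n : ℕ) := pow_mul_comm' L _
    rw [BMat.deriv_sub, BMat.deriv_mul, BMat.deriv_mul, h, hderiv, deriv_shift, hp]
    calc _ = (L ^ (n : ℕ) * L - L * L ^ (n : ℕ)) * w - minus (L ^ (n : ℕ)) * L * w +
          minus (L ^ (n : ℕ)) * w * shift := by noncomm_ring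
      _ = _ := by rw [hc]; noncomm_ring
  have hzero : ∀ k l, (L * w - w * shift : BMat K) k l = 0 := by
    intro k l
    refine eq_zero_of_coeff_pderiv
      (fun x : ℤ × ℤ => (L * w - w * shift : BMat K) x.1 x.2) ?_ ?_ (k, l)
    · rintro ⟨k, l⟩
      have e := congrArg (fun A : BMat K => MvPowerSeries.constantCoeff (A k l)) hint
      simp only [mul_shift_apply, BMat.mul_apply_eq_sum hL hw₀.1 le_rfl le_rfl, map_sum, map_mul]
        at e
      dsimp only
      rw [BMat.sub_apply, mul_shift_apply, BMat.mul_apply_eq_sum hL hw.1 le_rfl le_rfl,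
        MvPowerSeries.coeff_zero_eq_constantCoeff_apply, map_sub, map_sum, hconst, ← e, sub_eq_zero]
      refine Finset.sum_congr rfl fun m _ => ?_
      rw [map_mul, hconst]
    · rintro ⟨k, l⟩ n d hd
      change MvPowerSeries.coeff d (BMat.deriv n (L * w - w * shift) k l) = 0
      rw [hX, (hB n).mul_apply_eq_sum hXb, map_sum]
      exact Finset.sum_eq_zero fun m _ => coeff_mul_eq_zero (hd (m, l))
  have hLw : L * w = w * shift := sub_eq_zero.mp (BMat.ext hzero)
  obtain ⟨v, hv, hwv, hvw⟩ := hw.exists_inverse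
  have hd : IsDressed L w v :=
    ⟨hw, hv, hwv, hvw, by rw [← hLw, mul_assoc, hwv, mul_one]⟩
  refine ⟨w, v, hd, fun k => ?_⟩
  rw [hderiv, ← hd.pow_mul, ← add_mul]
  congr 1
  nth_rw 2 [← plus_add_minus (L ^ (k : ℕ))]
  abel

end Evolution

/-! ### Removing `ε` by conjugation -/

section Gauge

variable {K : Type*} [CommRing K]

open BMat

/-- The diagonal matrix with entries `dₖ`. -/
def BMat.diag (d : ℤ → K) : BMat K := ⟨fun i j => if i = j then MvPowerSeries.C (d i) else 0, 0,
  fun i j hij => if_neg (by omega)⟩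

lemma BMat.diag_apply (d : ℤ → K) (i j : ℤ) :
    diag d i j = if i = j then MvPowerSeries.C (d i) else 0 := rfl

lemma BMat.diag_mul_apply (d : ℤ → K) (A : BMat K) (i j : ℤ) :
    (diag d * A) i j = MvPowerSeries.C (d i) * A i j := by
  rw [BMat.mul_apply, finsum_eq_single _ i]
  · rw [diag_apply, if_pos rfl]
  · intro k hk
    rw [diag_apply, if_neg hk.symm, zero_mul]

lemma BMat.mul_diag_apply (d : ℤ → K) (A : BMat K) (i j : ℤ) :
    (A * diag d) i j = A i j * MvPowerSeries.C (d j) := by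
  rw [BMat.mul_apply, finsum_eq_single _ j]
  · rw [diag_apply, if_pos rfl]
  · intro k hk
    rw [diag_apply, if_neg hk, mul_zero]

lemma BMat.deriv_diag (d : ℤ → K) (n : ℕ+) : BMat.deriv n (diag d) = 0 := by
  refine BMat.ext fun i j => ?_
  rw [deriv_apply, diag_apply]
  split_ifs <;> simp

variable (ε : ℤ → Kˣ)

/-- The diagonal matrix `ε`. -/
def gauge : BMat K := diag fun k => (ε k : K)

/-- The diagonal matrix `ε⁻¹`. -/
def gaugeInv : BMat K := diag fun k => ((ε k)⁻¹ : Kˣ)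

lemma gauge_mul_gaugeInv : gauge ε * gaugeInv ε = 1 := by
  refine BMat.ext fun i j => ?_
  rw [gauge, diag_mul_apply, gaugeInv, diag_apply, BMat.one_apply]
  split_ifs
  · rw [← map_mul, Units.mul_inv, map_one]
  · rw [mul_zero]

lemma gaugeInv_mul_gauge : gaugeInv ε * gauge ε = 1 := by
  refine BMat.ext fun i j => ?_
  rw [gaugeInv, diag_mul_apply, gauge, diag_apply, BMat.one_apply]
  split_ifs
  · rw [← map_mul, Units.inv_mul, map_one]
  · rw [mul_zero]

lemma conj_eq (A : BMat K) : conj ε A = gaugeInv ε * A * gauge ε := by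
  refine BMat.ext fun i j => ?_
  rw [conj_apply, gauge, mul_diag_apply, gaugeInv, diag_mul_apply, Units.val_mul, map_mul]
  ring

lemma gauge_mul_conj (A : BMat K) : gauge ε * conj ε A = A * gauge ε := by
  rw [conj_eq, ← mul_assoc, ← mul_assoc, gauge_mul_gaugeInv, one_mul]

lemma conj_mul_gaugeInv (A : BMat K) : conj ε A * gaugeInv ε = gaugeInv ε * A := by
  rw [conj_eq, mul_assoc, gauge_mul_gaugeInv, mul_one]

lemma gauge_mul_injective {A B : BMat K} (h : gauge ε * A = gauge ε * B) : A = B := by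
  have := congrArg (gaugeInv ε * ·) h
  simpa only [← mul_assoc, gaugeInv_mul_gauge, one_mul] using this

lemma shiftPow_apply (m k l : ℤ) : (shiftPow ε m : Matrix ℤ ℤ (TimeSeries K)) k l =
    if l = k + m then MvPowerSeries.C ((ε k * (ε l)⁻¹ : Kˣ) : K) else 0 := rfl

lemma laxMatrix_apply_of_lt (a : ℕ → ℤ → TimeSeries K) {k l : ℤ} (h : k < l) :
    laxMatrix ε a k l = shiftPow ε 1 k l := by
  unfold laxMatrix
  rw [finsum_eq_zero_of_forall_eq_zero, add_zero]
  intro i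
  rw [shiftPow_apply, if_neg (by omega), mul_zero]

lemma vanishesAbove_laxMatrix (a : ℕ → ℤ → TimeSeries K) : VanishesAbove 1 (laxMatrix ε a) :=
  fun k l hkl => by rw [laxMatrix_apply_of_lt ε a (by omega), shiftPow_apply, if_neg (by omega)]

/-- The matrix `L` as an element of the ring of banded matrices. -/
def laxBMat (a : ℕ → ℤ → TimeSeries K) : BMat K := ⟨laxMatrix ε a, 1, vanishesAbove_laxMatrix ε a⟩

lemma vanishesAbove_conj {A : BMat K} {N : ℤ} (hA : VanishesAbove N A.1) :
    VanishesAbove N (conj ε A).1 := fun i j hij => by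
  rw [conj_apply, hA i j hij, mul_zero]

lemma conj_laxBMat_apply_succ (a : ℕ → ℤ → TimeSeries K) (n : ℤ) :
    conj ε (laxBMat ε a) n (n + 1) = 1 := by
  rw [conj_apply]
  change _ * laxMatrix ε a n (n + 1) = 1
  rw [laxMatrix_apply_of_lt ε a (by omega), shiftPow_apply, if_pos rfl, ← map_mul, ← Units.val_mul]
  simp [mul_assoc]

lemma waveMatrix_apply_of_le (p : ℕ+ → ℤ → TimeSeries K) {k l : ℤ} (h : k ≤ l) :
    waveMatrix ε p k l = (1 : Matrix ℤ ℤ (TimeSeries K)) k l := by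
  unfold waveMatrix
  rw [finsum_eq_zero_of_forall_eq_zero, add_zero]
  intro i
  have := i.pos
  rw [shiftPow_apply, if_neg (by omega), mul_zero]

lemma waveMatrix_apply_sub (p : ℕ+ → ℤ → TimeSeries K) (k : ℤ) (i : ℕ+) :
    waveMatrix ε p k (k - (i : ℕ)) =
      p i k * MvPowerSeries.C ((ε k * (ε (k - (i : ℕ)))⁻¹ : Kˣ) : K) := by
  have := i.pos
  unfold waveMatrix
  rw [Matrix.one_apply_ne (by omega), zero_add, finsum_eq_single _ i]
  · rw [shiftPow_apply, if_pos (by ring)]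
  · intro j hj
    have : (j : ℕ) ≠ i := fun h => hj (PNat.coe_injective h)
    rw [shiftPow_apply, if_neg (by omega), mul_zero]

lemma vanishesAbove_waveMatrix (p : ℕ+ → ℤ → TimeSeries K) : VanishesAbove 0 (waveMatrix ε p) :=
  fun k l hkl => by rw [waveMatrix_apply_of_le ε p (by omega), Matrix.one_apply_ne (by omega)]

/-- The matrix `P` as an element of the ring of banded matrices. -/
def waveBMat (p : ℕ+ → ℤ → TimeSeries K) : BMat K :=
  ⟨waveMatrix ε p, 0, vanishesAbove_waveMatrix ε p⟩

lemma lowerUnitriangular_conj_waveBMat (p : ℕ+ → ℤ → TimeSeries K) :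
    LowerUnitriangular (conj ε (waveBMat ε p)) := by
  refine ⟨vanishesAbove_conj ε (vanishesAbove_waveMatrix ε p), fun i => ?_⟩
  rw [conj_apply]
  change _ * waveMatrix ε p i i = 1
  rw [waveMatrix_apply_of_le ε p le_rfl, Matrix.one_apply_eq]
  simp

/-- Conjugation cancels the factor εₖ/εₖ₋ᵢ in Λ^{-i}, so the pᵢ are the diagonals of `w` themselves.
-/
lemma exists_conj_waveBMat_eq {w : BMat K} (hw : LowerUnitriangular w) :
    ∃ p, conj ε (waveBMat ε p) = w := by
  let p : ℕ+ → ℤ → TimeSeries K := fun i k => w k (k - (i : ℕ))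
  refine ⟨p, BMat.ext fun k l => ?_⟩
  rcases lt_trichotomy l k with h | rfl | h
  · obtain ⟨i, hi⟩ : ∃ i : ℕ+, l = k - (i : ℕ) :=
      ⟨⟨(k - l).toNat, by omega⟩, by simp only [PNat.mk_coe]; omega⟩
    have h1 : (waveBMat ε p) k (k - (i : ℕ)) =
        w k (k - (i : ℕ)) * MvPowerSeries.C ((ε k * (ε (k - (i : ℕ)))⁻¹ : Kˣ) : K) :=
      waveMatrix_apply_sub ε p k i
    have h2 : (ε k)⁻¹ * ε (k - (i : ℕ)) * (ε k * (ε (k - (i : ℕ)))⁻¹) = 1 := by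
      rw [mul_comm (ε k), ← mul_assoc, mul_inv_cancel_right, inv_mul_cancel]
    rw [hi, conj_apply, h1, mul_left_comm, ← map_mul, ← Units.val_mul, h2, Units.val_one, map_one,
      mul_one]
  · rw [(lowerUnitriangular_conj_waveBMat ε _).2, hw.2]
  · rw [(lowerUnitriangular_conj_waveBMat ε _).1 k l (by omega), hw.1 k l (by omega)]

/-- The matrix `Λ` as an element of the ring of banded matrices. -/
def shiftBMat : BMat K := ⟨shiftPow ε 1, 1, fun k l hkl => if_neg (by omega)⟩

lemma conj_shiftBMat : conj ε (shiftBMat ε) = shift := by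
  refine BMat.ext fun k l => ?_
  rw [conj_apply, shift_apply]
  change _ * shiftPow ε 1 k l = _
  rw [shiftPow_apply]
  split_ifs with h
  · rw [← map_mul, ← Units.val_mul]
    simp [mul_assoc]
  · rw [mul_zero]

lemma BMat.val_injective {A B : BMat K} (h : A.1 = B.1) : A = B :=
  BMat.ext fun i j => congrFun (congrFun h i) j

lemma isDressing_iff (a : ℕ → ℤ → TimeSeries K) (p q : ℕ+ → ℤ → TimeSeries K) :
    IsDressing ε (laxMatrix ε a) p q ↔
      IsDressed (conj ε (laxBMat ε a)) (conj ε (waveBMat ε p)) (conj ε (waveBMat ε q)) := by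
  have e1 : matMul (waveMatrix ε p) (waveMatrix ε q) = 1 ↔
      conj ε (waveBMat ε p) * conj ε (waveBMat ε q) = 1 := by
    rw [← map_mul, EmbeddingLike.map_eq_one_iff]
    exact ⟨fun h => BMat.val_injective h, fun h => congrArg BMat.val h⟩
  have e2 : matMul (waveMatrix ε q) (waveMatrix ε p) = 1 ↔
      conj ε (waveBMat ε q) * conj ε (waveBMat ε p) = 1 := by
    rw [← map_mul, EmbeddingLike.map_eq_one_iff]
    exact ⟨fun h => BMat.val_injective h, fun h => congrArg BMat.val h⟩
  have e3 : laxMatrix ε a = matMul (matMul (waveMatrix ε p) (shiftPow ε 1)) (waveMatrix ε q) ↔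
      conj ε (laxBMat ε a) = conj ε (waveBMat ε p) * shift * conj ε (waveBMat ε q) := by
    rw [← conj_shiftBMat ε, ← map_mul, ← map_mul, EmbeddingLike.apply_eq_iff_eq]
    exact ⟨fun h => BMat.val_injective h, fun h => congrArg BMat.val h⟩
  rw [IsDressing, e1, e2, e3]
  exact ⟨fun h => ⟨lowerUnitriangular_conj_waveBMat ε p, lowerUnitriangular_conj_waveBMat ε q,
    h.1, h.2.1, h.2.2⟩, fun h => ⟨h.mul_inv, h.inv_mul, h.eq⟩⟩

lemma BMat.sub_val (A B : BMat K) : (A - B).1 = A.1 - B.1 :=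
  funext fun i => funext fun j => BMat.sub_apply A B i j

lemma satisfiesToda_iff (a : ℕ → ℤ → TimeSeries K) :
    SatisfiesToda (laxMatrix ε a) ↔ ∀ k : ℕ+, BMat.deriv k (conj ε (laxBMat ε a)) =
      plus (conj ε (laxBMat ε a) ^ (k : ℕ)) * conj ε (laxBMat ε a) -
        conj ε (laxBMat ε a) * plus (conj ε (laxBMat ε a) ^ (k : ℕ)) := by
  refine forall_congr' fun k => ?_
  have h := matPow_val (laxBMat ε a) k
  rw [← map_pow, ← conj_plus, ← conj_deriv, ← map_mul, ← map_mul, ← map_sub,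
    EmbeddingLike.apply_eq_iff_eq]
  change (BMat.deriv k (laxBMat ε a)).1 = _ ↔ _
  change _ = matMul (matPlus (matPow (laxBMat ε a).1 k)) (laxBMat ε a).1 -
    matMul (laxBMat ε a).1 (matPlus (matPow (laxBMat ε a).1 k)) ↔ _
  rw [h, ← plus_val, ← BMat.mul_val, ← BMat.mul_val, ← BMat.sub_val]
  exact ⟨fun h => BMat.val_injective h, fun h => congrArg BMat.val h⟩

lemma waveVector_eq (p : ℕ+ → ℤ → TimeSeries K) :
    waveVector ε p = (waveBMat ε p * gauge ε).1 := by
  rw [BMat.mul_val]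
  refine funext fun n => funext fun j => finsum_congr fun k => ?_
  change waveMatrix ε p n k * (if j = k then MvPowerSeries.C ((ε k : Kˣ) : K) else 0) =
    waveMatrix ε p n k * (if k = j then MvPowerSeries.C ((ε k : Kˣ) : K) else 0)
  simp only [eq_comm]

/-- The k-th entry of χ(z⁻¹) is z^{-k}, which accounts for the row index `-j`. -/
lemma adjointWaveVector_apply (q : ℕ+ → ℤ → TimeSeries K) (n j : ℤ) :
    adjointWaveVector ε q n j = (gaugeInv ε * waveBMat ε q) (-j) n := by
  rw [BMat.mul_apply]
  refine finsum_congr fun k => ?_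
  change waveMatrix ε q k n * (if j = -k then MvPowerSeries.C (((ε k)⁻¹ : Kˣ) : K) else 0) =
    (if -j = k then MvPowerSeries.C (((ε (-j))⁻¹ : Kˣ) : K) else 0) * waveMatrix ε q k n
  rcases eq_or_ne j (-k) with rfl | h
  · rw [if_pos rfl, neg_neg, if_pos rfl, mul_comm]
  · rw [if_neg h, if_neg (fun h' => h (by omega)), mul_zero, zero_mul]

lemma psi_eq (p : ℕ+ → ℤ → TimeSeries K) : psi ε p = (conj ε (waveBMat ε p)).1 := by
  funext n j
  rw [psi, waveVector_eq, conj_eq, mul_assoc, gaugeInv, diag_mul_apply]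

lemma psiStar_eq (q : ℕ+ → ℤ → TimeSeries K) :
    psiStar ε q = dualColumn (conj ε (waveBMat ε q)) := by
  funext m j
  rw [psiStar, adjointWaveVector_apply, dualColumn, conj_eq, gauge, mul_diag_apply, mul_comm,
    neg_add']

lemma matVec_transpose_eq (A B : BMat K) (n j : ℤ) :
    matVec A.1.transpose (fun k j => B (-j) k) n j = (B * A) (-j) n :=
  finsum_congr fun _ => mul_comm _ _

/-- Multiplication by z is S acting on columns of εw or rows of vε⁻¹, so the eigenvalue equations
are Lw = wS and vL = Sv (L conjugated), which hold for any dressing. The flow of Ψ is `Evolves`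
multiplied by the invertible ε, and that of Ψ^* is `deriv_inv`. -/
theorem satisfiesLinearSystem_iff {a : ℕ → ℤ → TimeSeries K} {p q : ℕ+ → ℤ → TimeSeries K}
    (h : IsDressed (conj ε (laxBMat ε a)) (conj ε (waveBMat ε p)) (conj ε (waveBMat ε q))) :
    SatisfiesLinearSystem (laxMatrix ε a) (waveVector ε p) (adjointWaveVector ε q) ↔
      Evolves (conj ε (laxBMat ε a)) (conj ε (waveBMat ε p)) := by
  set L := laxBMat ε a with hL
  set w := conj ε (waveBMat ε p)
  set v := conj ε (waveBMat ε q)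
  have hΨ : waveVector ε p = (gauge ε * w).1 := by rw [waveVector_eq, gauge_mul_conj]
  have hΨs : adjointWaveVector ε q = fun n j => (v * gaugeInv ε) (-j) n := by
    funext n j
    rw [adjointWaveVector_apply, conj_mul_gaugeInv]
  have hpow : ∀ k : ℕ, matPow (laxMatrix ε a) k = (L ^ k).1 := fun k => matPow_val L k
  have hderiv : ∀ k : ℕ+, BMat.deriv k (gauge ε * w) = gauge ε * BMat.deriv k w := fun k => by
    rw [BMat.deriv_mul, gauge, deriv_diag, zero_mul, zero_add]
  have hosc : ∀ k : ℕ+, (fun n => oscDeriv k (waveVector ε p n)) =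
      (gauge ε * (BMat.deriv k w + w * shift ^ (k : ℕ))).1 := fun k => by
    funext n
    rw [hΨ, oscDeriv_row, hderiv, mul_add, mul_assoc]
  have hplus : ∀ k : ℕ+, matVec (matPlus (matPow (laxMatrix ε a) k)) (waveVector ε p) =
      (gauge ε * (plus (conj ε L ^ (k : ℕ)) * w)).1 := fun k => by
    have h1 : gauge ε * (plus (conj ε L ^ (k : ℕ)) * w) = plus (L ^ (k : ℕ)) * (gauge ε * w) := by
      rw [← map_pow, ← conj_plus, ← mul_assoc, gauge_mul_conj, mul_assoc]
    rw [hpow, hΨ, h1]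
    rfl
  constructor
  · rintro ⟨-, -, hlin⟩ k
    have h1 := (hlin k).1
    rw [hosc, hplus] at h1
    exact gauge_mul_injective ε (BMat.val_injective h1)
  · intro hw
    refine ⟨?_, ?_, fun k => ⟨?_, ?_⟩⟩
    · have h1 : L * (gauge ε * w) = gauge ε * w * shift := by
        have := h.pow_mul 1
        rw [pow_one, pow_one] at this
        rw [← mul_assoc, ← gauge_mul_conj, mul_assoc, this, mul_assoc]
      funext n j
      rw [hΨ]
      change (L * (gauge ε * w)) n j = (gauge ε * w) n (j - 1)
      rw [h1, mul_shift_apply]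
    · have h1 : v * gaugeInv ε * L = shift * (v * gaugeInv ε) := by
        have := h.mul_pow 1
        rw [pow_one, pow_one] at this
        rw [mul_assoc, ← conj_mul_gaugeInv, ← mul_assoc, this, mul_assoc]
      funext n j
      rw [hΨs]
      change matVec L.1.transpose _ n j = (v * gaugeInv ε) (-(j - 1)) n
      rw [matVec_transpose_eq, h1, shift_mul_apply]
      congr 1
      ring
    · rw [hosc, hplus, hw k]
    · have h1 : BMat.deriv k (v * gaugeInv ε) - shift ^ (k : ℕ) * (v * gaugeInv ε) =
          -(v * gaugeInv ε * plus (L ^ (k : ℕ))) := by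
        rw [BMat.deriv_mul, gaugeInv, deriv_diag, mul_zero, add_zero, ← gaugeInv, ← mul_assoc,
          ← sub_mul, h.deriv_inv hw, neg_mul, mul_assoc, mul_assoc, ← map_pow, ← conj_plus,
          conj_mul_gaugeInv]
      funext n j
      have h2 := congrArg (fun A : BMat K => A (-j) n) h1
      simp only [BMat.sub_apply, BMat.neg_apply, shift_pow_mul_apply, deriv_apply] at h2
      rw [hΨs, hpow, ← plus_val, Pi.neg_apply, Pi.neg_apply, matVec_transpose_eq, ← h2, dualDeriv]
      beta_reduce
      rw [neg_sub', sub_neg_eq_add]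

end Gauge

end OneToda

end

/-! ### The main theorem -/

theorem proposition8 {K : Type*} [CommRing K] [Algebra ℚ K] (ε : ℤ → Kˣ)
    (a : ℕ → ℤ → OneToda.TimeSeries K) :
    (OneToda.SatisfiesToda (OneToda.laxMatrix ε a) ↔
      ∃ p q : ℕ+ → ℤ → OneToda.TimeSeries K,
        OneToda.IsDressing ε (OneToda.laxMatrix ε a) p q ∧
        OneToda.SatisfiesModifiedKP (OneToda.psi ε p) (OneToda.psiStar ε q)) ∧
    ∀ p q : ℕ+ → ℤ → OneToda.TimeSeries K,
      OneToda.IsDressing ε (OneToda.laxMatrix ε a) p q →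
      (OneToda.SatisfiesLinearSystem (OneToda.laxMatrix ε a)
          (OneToda.waveVector ε p) (OneToda.adjointWaveVector ε q) ↔
        OneToda.SatisfiesModifiedKP (OneToda.psi ε p) (OneToda.psiStar ε q)) := by
  refine ⟨⟨fun h => ?_, ?_⟩, fun p q hpq => ?_⟩
  · obtain ⟨w, v, hd, hw⟩ := OneToda.exists_isDressed_of_toda
      (OneToda.vanishesAbove_conj ε (OneToda.vanishesAbove_laxMatrix ε a))
      (OneToda.conj_laxBMat_apply_succ ε a) ((OneToda.satisfiesToda_iff ε a).mp h)
    obtain ⟨p, rfl⟩ := OneToda.exists_conj_waveBMat_eq ε hd.left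
    obtain ⟨q, rfl⟩ := OneToda.exists_conj_waveBMat_eq ε hd.right
    refine ⟨p, q, (OneToda.isDressing_iff ε a p q).mpr hd, ?_⟩
    rw [OneToda.psi_eq, OneToda.psiStar_eq]
    exact hd.evolves_iff_modifiedKP.mp hw
  · rintro ⟨p, q, hpq, hkp⟩
    have hd := (OneToda.isDressing_iff ε a p q).mp hpq
    rw [OneToda.psi_eq, OneToda.psiStar_eq] at hkp
    exact (OneToda.satisfiesToda_iff ε a).mpr (hd.toda (hd.evolves_iff_modifiedKP.mpr hkp))
  · have hd := (OneToda.isDressing_iff ε a p q).mp hpq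
    rw [OneToda.satisfiesLinearSystem_iff ε hd, OneToda.psi_eq, OneToda.psiStar_eq]
    exact hd.evolves_iff_modifiedKP
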